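/- Let $k$ be an algebraically closed field of characteristic zero (for instance $k=\mathbb C$). Let $A$ and $B$ be cosemisimple Hopf algebras over $k$ (every right comodule is completely reducible) that are non-trivial, i.e. $A\neq k$ and $B\neq k$, and let $A*B$ be their free product: the free product of the algebras $A$ and $B$, with the Hopf algebra structure extending those of $A$ and $B$. For a Hopf algebra $H$ over $k$, let $\mathcal{YD}_H^H$ be the abelian category of right-right Yetter--Drinfeld modules over $H$: right $H$-modules and right $H$-comodules $V$ such that $(v\cdot a)_{(0)}\otimes (v\cdot a)_{(1)} = v_{(0)}\cdot a_{(2)}\otimes S(a_{(1)})v_{(1)}a_{(3)}$ for all $v\in V$, $a\in H$, with the $H$-linear $H$-colinear maps as morphisms. For $V\in\mathcal{YD}_H^H$ put $H^n_{\rm GS}(H,V)=\mathrm{Ext}^n_{\mathcal{YD}_H^H}(k,V)$, where $k$ is the trivial Yetter--Drinfeld module, and let $$\mathrm{cd}_{\rm GS}(H)=\sup\{n : H^n_{\rm GS}(H,V)\neq 0 \text{ for some } V\in\mathcal{YD}_H^H\}\in\mathbb N\cup\{\infty\}.$$ Then $$\mathrm{cd}_{\rm GS}(A*B)=\begin{cases}1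 & \text{if } \mathrm{cd}_{\rm GS}(A)=0=\mathrm{cd}_{\rm GS}(B),\\ \max(\mathrm{cd}_{\rm GS}(A),\mathrm{cd}_{\rm GS}(B)) & \text{if } \max(\mathrm{cd}_{\rm GS}(A),\mathrm{cd}_{\rm GS}(B))\geq 1.\end{cases}$$ -/

import Mathlib

universe u

noncomputable section

open TensorProduct CategoryTheory

/-! ## The Hopf algebra structure on a free product -/

namespace LinearAlgebra.FreeProduct

universe v w

section Ext

variable {I : Type u} [DecidableEq I] {k : Type v} [CommSemiring k]
  {H : I → Type w} [∀ i, Semiring (H i)] [∀ i, Algebra k (H i)]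

theorem algHom_ext' {B : Type*} [Semiring B] [Algebra k B]
    {f g : LinearAlgebra.FreeProduct k H →ₐ[k] B}
    (h : ∀ i, f.comp (ι k H i) = g.comp (ι k H i)) : f = g := by
  rw [lift_unique k H (fun {i} => g.comp (ι k H i)) f h]
  exact (lift_unique k H (fun {i} => g.comp (ι k H i)) g fun _ => rfl).symm

theorem lift_ι_apply {B : Type*} [Semiring B] [Algebra k B] (f : ∀ i, H i →ₐ[k] B) (i : I)
    (a : H i) : lift k H (fun {i} => f i) (ι k H i a) = f i a :=
  DFunLike.congr_fun (lift_comp_ι k H (fun {i} => f i)) a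

/-- A subalgebra that contains all factors is everything. -/
theorem mem_of_factors (S : Subalgebra k (LinearAlgebra.FreeProduct k H))
    (hS : ∀ i a, ι k H i a ∈ S) (x : LinearAlgebra.FreeProduct k H) : x ∈ S := by
  let f : LinearAlgebra.FreeProduct k H →ₐ[k] S :=
    lift k H (fun {i} => (ι k H i).codRestrict S (hS i))
  have hf : S.val.comp f = AlgHom.id k _ := by
    apply algHom_ext'
    intro i
    ext a
    simp only [AlgHom.comp_apply, f, lift_ι_apply (fun i => (ι k H i).codRestrict S (hS i))]
    rfl
  have := DFunLike.congr_fun hf x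
  simp only [AlgHom.comp_apply, AlgHom.id_apply] at this
  rw [← this]
  exact (f x).2

end Ext

section Hopf

variable {I : Type u} [DecidableEq I] (k : Type v) [CommRing k]
  (H : I → Type w) [∀ i, Ring (H i)] [∀ i, HopfAlgebra k (H i)]

/-- The comultiplication of a free product: the algebra map extending those of the factors. -/
def comulHom : LinearAlgebra.FreeProduct k H →ₐ[k]
    LinearAlgebra.FreeProduct k H ⊗[k] LinearAlgebra.FreeProduct k H :=
  lift k H (fun {i} =>
    (Algebra.TensorProduct.map (ι k H i) (ι k H i)).comp (Bialgebra.comulAlgHom k (H i)))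

/-- The counit of a free product: the algebra map extending those of the factors. -/
def counitHom : LinearAlgebra.FreeProduct k H →ₐ[k] k :=
  lift k H (fun {i} => Bialgebra.counitAlgHom k (H i))

/-- The antipode of a free product: the algebra anti-morphism extending those of the factors. -/
def antipodeHom : LinearAlgebra.FreeProduct k H →ₐ[k] (LinearAlgebra.FreeProduct k H)ᵐᵒᵖ :=
  lift k H (fun {i} => (AlgHom.op (ι k H i)).comp (HopfAlgebra.antipodeAlgHomOp k (H i)))

theorem comulHom_ι (i : I) (a : H i) : comulHom k H (ι k H i a) =
    Algebra.TensorProduct.map (ι k H i) (ι k H i) (Coalgebra.comul (R := k) a) :=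
  lift_ι_apply (fun i => (Algebra.TensorProduct.map (ι k H i) (ι k H i)).comp
    (Bialgebra.comulAlgHom k (H i))) i a

theorem counitHom_ι (i : I) (a : H i) :
    counitHom k H (ι k H i a) = Coalgebra.counit (R := k) a :=
  lift_ι_apply (fun i => Bialgebra.counitAlgHom k (H i)) i a

theorem antipodeHom_ι (i : I) (a : H i) :
    antipodeHom k H (ι k H i a) = MulOpposite.op (ι k H i (HopfAlgebra.antipode k a)) :=
  lift_ι_apply (fun i => (AlgHom.op (ι k H i)).comp (HopfAlgebra.antipodeAlgHomOp k (H i))) i a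

instance instBialgebra : Bialgebra k (LinearAlgebra.FreeProduct k H) :=
  Bialgebra.ofAlgHom (comulHom k H) (counitHom k H)
    (by
      apply algHom_ext'
      intro i
      ext a
      have h1 : ∀ t : H i ⊗[k] H i,
          Algebra.TensorProduct.assoc k k k _ _ _
            (Algebra.TensorProduct.map (comulHom k H) (.id k _)
              (Algebra.TensorProduct.map (ι k H i) (ι k H i) t)) =
          Algebra.TensorProduct.map (ι k H i)
            (Algebra.TensorProduct.map (ι k H i) (ι k H i))
            (TensorProduct.assoc k _ _ _ (Coalgebra.comul.rTensor (H i) t)) := by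
        intro t
        induction t with
        | zero => simp
        | add x y hx hy => simp only [map_add, hx, hy]
        | tmul x y =>
          simp only [Algebra.TensorProduct.map_tmul, comulHom_ι, LinearMap.rTensor_tmul,
            AlgHom.id_apply]
          generalize (Coalgebra.comul (R := k) x) = u
          induction u with
          | zero => simp
          | add x y hx hy => simp only [map_add, TensorProduct.add_tmul, hx, hy]
          | tmul x y => simp
      have h2 : ∀ t : H i ⊗[k] H i,
          Algebra.TensorProduct.map (.id k _) (comulHom k H)
            (Algebra.TensorProduct.map (ι k H i) (ι k H i) t) =
          Algebra.TensorProduct.map (ι k H i)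
            (Algebra.TensorProduct.map (ι k H i) (ι k H i))
            (Coalgebra.comul.lTensor (H i) t) := by
        intro t
        induction t with
        | zero => simp
        | add x y hx hy => simp only [map_add, hx, hy]
        | tmul x y => simp [comulHom_ι]
      have h3 := h1 (Coalgebra.comul (R := k) a)
      rw [Coalgebra.coassoc_apply, ← h2, ← comulHom_ι] at h3
      exact h3)
    (by
      apply algHom_ext'
      intro i
      ext a
      have h1 : ∀ t : H i ⊗[k] H i,
          Algebra.TensorProduct.map (counitHom k H) (.id k _)
            (Algebra.TensorProduct.map (ι k H i) (ι k H i) t) =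
          (ι k H i).toLinearMap.lTensor k (Coalgebra.counit.rTensor (H i) t) := by
        intro t
        induction t with
        | zero => simp
        | add x y hx hy => simp only [map_add, hx, hy]
        | tmul x y => simp [counitHom_ι]
      have h3 := h1 (Coalgebra.comul (R := k) a)
      rw [Coalgebra.rTensor_counit_comul, ← comulHom_ι] at h3
      exact h3)
    (by
      apply algHom_ext'
      intro i
      ext a
      have h1 : ∀ t : H i ⊗[k] H i,
          Algebra.TensorProduct.map (.id k _) (counitHom k H)
            (Algebra.TensorProduct.map (ι k H i) (ι k H i) t) =
          (ι k H i).toLinearMap.rTensor k (Coalgebra.counit.lTensor (H i) t) := by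
        intro t
        induction t with
        | zero => simp
        | add x y hx hy => simp only [map_add, hx, hy]
        | tmul x y => simp [counitHom_ι]
      have h3 := h1 (Coalgebra.comul (R := k) a)
      rw [Coalgebra.lTensor_counit_comul, ← comulHom_ι] at h3
      exact h3)

theorem comul_eq (x : LinearAlgebra.FreeProduct k H) :
    Coalgebra.comul (R := k) x = comulHom k H x := rfl

theorem counit_eq (x : LinearAlgebra.FreeProduct k H) :
    Coalgebra.counit (R := k) x = counitHom k H x := rfl

/-- The antipode as a linear endomorphism. -/
def antipodeLin : LinearAlgebra.FreeProduct k H →ₗ[k] LinearAlgebra.FreeProduct k H :=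
  (MulOpposite.opLinearEquiv k).symm.toLinearMap ∘ₗ (antipodeHom k H).toLinearMap

theorem antipodeLin_mul (x y : LinearAlgebra.FreeProduct k H) :
    antipodeLin k H (x * y) = antipodeLin k H y * antipodeLin k H x := by
  simp [antipodeLin]

theorem antipodeLin_one : antipodeLin k H 1 = 1 := by
  simp [antipodeLin]

theorem antipodeLin_ι (i : I) (a : H i) :
    antipodeLin k H (ι k H i a) = ι k H i (HopfAlgebra.antipode k a) := by
  simp [antipodeLin, antipodeHom_ι]

theorem antipode_left (x : LinearAlgebra.FreeProduct k H) :
    LinearMap.mul' k _ ((antipodeLin k H).rTensor _ (comulHom k H x)) =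
      algebraMap k _ (counitHom k H x) := by
  let m : LinearAlgebra.FreeProduct k H ⊗[k] LinearAlgebra.FreeProduct k H →ₗ[k]
      LinearAlgebra.FreeProduct k H := LinearMap.mul' k _ ∘ₗ (antipodeLin k H).rTensor _
  have hm : ∀ s x y, m (s * (x ⊗ₜ y)) = antipodeLin k H x * m s * y := by
    intro s x y
    induction s with
    | zero => simp
    | add s t hs ht => simp only [map_add, add_mul, mul_add, hs, ht]
    | tmul s t => simp [m, antipodeLin_mul, mul_assoc]
  have hm' : ∀ s t c, m s = algebraMap k _ c → m (s * t) = algebraMap k _ c * m t := by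
    intro s t c hs
    induction t with
    | zero => simp
    | add x y hx hy => simp only [map_add, mul_add, hx, hy]
    | tmul x y => rw [hm, hs, ← Algebra.commutes]; simp [m, mul_assoc]
  let S : Subalgebra k (LinearAlgebra.FreeProduct k H) :=
    { carrier := {x | m (comulHom k H x) = algebraMap k _ (counitHom k H x)}
      mul_mem' := by
        intro x y hx hy
        change m (comulHom k H _) = algebraMap k _ (counitHom k H _) at hx hy ⊢
        rw [map_mul, hm' _ _ _ hx, hy, map_mul, map_mul]
      add_mem' := by
        intro x y hx hy
        change m (comulHom k H _) = algebraMap k _ (counitHom k H _) at hx hy ⊢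
        simp only [map_add, hx, hy]
      algebraMap_mem' := by
        intro c
        simp [m, Algebra.TensorProduct.one_def, antipodeLin_one,
          Algebra.algebraMap_eq_smul_one] }
  refine mem_of_factors S ?_ x
  intro i a
  change m (comulHom k H (ι k H i a)) = algebraMap k _ (counitHom k H (ι k H i a))
  rw [comulHom_ι, counitHom_ι]
  have h1 : ∀ t : H i ⊗[k] H i, m (Algebra.TensorProduct.map (ι k H i) (ι k H i) t) =
      ι k H i (LinearMap.mul' k _ ((HopfAlgebra.antipode k).rTensor _ t)) := by
    intro t
    induction t with
    | zero => simp
    | add x y hx hy => simp only [map_add, hx, hy]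
    | tmul x y => simp [m, antipodeLin_ι]
  rw [h1, HopfAlgebra.mul_antipode_rTensor_comul_apply, AlgHom.commutes]

theorem antipode_right (x : LinearAlgebra.FreeProduct k H) :
    LinearMap.mul' k _ ((antipodeLin k H).lTensor _ (comulHom k H x)) =
      algebraMap k _ (counitHom k H x) := by
  let m : LinearAlgebra.FreeProduct k H ⊗[k] LinearAlgebra.FreeProduct k H →ₗ[k]
      LinearAlgebra.FreeProduct k H := LinearMap.mul' k _ ∘ₗ (antipodeLin k H).lTensor _
  have hm : ∀ s x y, m ((x ⊗ₜ y) * s) = x * m s * antipodeLin k H y := by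
    intro s x y
    induction s with
    | zero => simp
    | add s t hs ht => simp only [map_add, add_mul, mul_add, hs, ht]
    | tmul s t => simp [m, antipodeLin_mul, mul_assoc]
  have hm' : ∀ s t c, m t = algebraMap k _ c → m (s * t) = m s * algebraMap k _ c := by
    intro s t c hs
    induction s with
    | zero => simp
    | add x y hx hy => simp only [map_add, add_mul, hx, hy]
    | tmul x y => rw [hm, hs, mul_assoc, Algebra.commutes]; simp [m, mul_assoc]
  let S : Subalgebra k (LinearAlgebra.FreeProduct k H) :=
    { carrier := {x | m (comulHom k H x) = algebraMap k _ (counitHom k H x)}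
      mul_mem' := by
        intro x y hx hy
        change m (comulHom k H _) = algebraMap k _ (counitHom k H _) at hx hy ⊢
        rw [map_mul, hm' _ _ _ hy, hx, map_mul, map_mul]
      add_mem' := by
        intro x y hx hy
        change m (comulHom k H _) = algebraMap k _ (counitHom k H _) at hx hy ⊢
        simp only [map_add, hx, hy]
      algebraMap_mem' := by
        intro c
        simp [m, Algebra.TensorProduct.one_def, antipodeLin_one,
          Algebra.algebraMap_eq_smul_one] }
  refine mem_of_factors S ?_ x
  intro i a
  change m (comulHom k H (ι k H i a)) = algebraMap k _ (counitHom k H (ι k H i a))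
  rw [comulHom_ι, counitHom_ι]
  have h1 : ∀ t : H i ⊗[k] H i, m (Algebra.TensorProduct.map (ι k H i) (ι k H i) t) =
      ι k H i (LinearMap.mul' k _ ((HopfAlgebra.antipode k).lTensor _ t)) := by
    intro t
    induction t with
    | zero => simp
    | add x y hx hy => simp only [map_add, hx, hy]
    | tmul x y => simp [m, antipodeLin_ι]
  rw [h1, HopfAlgebra.mul_antipode_lTensor_comul_apply, AlgHom.commutes]

instance instHopfAlgebra : HopfAlgebra k (LinearAlgebra.FreeProduct k H) where
  antipode := antipodeLin k H
  mul_antipode_rTensor_comul := LinearMap.ext (antipode_left k H)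
  mul_antipode_lTensor_comul := LinearMap.ext (antipode_right k H)

end Hopf
end LinearAlgebra.FreeProduct

/-- The two-element family of algebras with members `A` and `B`. -/
def FactorPair (A B : Type u) : Bool → Type u
  | false => A
  | true => B

instance FactorPair.instRing (A B : Type u) [Ring A] [Ring B] :
    ∀ b, Ring (FactorPair A B b)
  | false => inferInstanceAs (Ring A)
  | true => inferInstanceAs (Ring B)

instance FactorPair.instHopfAlgebra (k A B : Type u) [CommRing k] [Ring A] [HopfAlgebra k A]
    [Ring B] [HopfAlgebra k B] : ∀ b, HopfAlgebra k (FactorPair A B b)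
  | false => inferInstanceAs (HopfAlgebra k A)
  | true => inferInstanceAs (HopfAlgebra k B)

/-- The free product `A * B` of two Hopf algebras over `k`: the free product (coproduct) of
algebras, with the comultiplication, counit and antipode that extend those of `A` and `B`. -/
abbrev HopfFreeProduct (k A B : Type u) [CommRing k] [Ring A] [HopfAlgebra k A]
    [Ring B] [HopfAlgebra k B] : Type u :=
  LinearAlgebra.FreeProduct k (FactorPair A B)

/-! ## Comodules and cosemisimplicity -/

/-- A right comodule `V` over a coalgebra `A`, with coaction `v ↦ v₍₀₎ ⊗ v₍₁₎`. -/
class RightComodule (k A V : Type*) [CommSemiring k] [AddCommMonoid A] [Module k A]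
    [Coalgebra k A] [AddCommMonoid V] [Module k V] where
  /-- The coaction. -/
  coact : V →ₗ[k] V ⊗[k] A
  coassoc : (TensorProduct.assoc k V A A).toLinearMap ∘ₗ coact.rTensor A ∘ₗ coact =
    Coalgebra.comul.lTensor V ∘ₗ coact
  counit_coact : (TensorProduct.rid k V).toLinearMap ∘ₗ Coalgebra.counit.lTensor V ∘ₗ coact =
    LinearMap.id

/-- `W` is a subcomodule of `V`: the coaction maps `W` into the image of `W ⊗ A`. -/
def IsSubcomodule {k : Type*} (A : Type*) {V : Type*} [CommRing k] [AddCommGroup A] [Module k A]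
    [Coalgebra k A] [AddCommGroup V] [Module k V] [RightComodule k A V]
    (W : Submodule k V) : Prop :=
  ∀ w ∈ W, RightComodule.coact (A := A) w ∈ LinearMap.range (W.subtype.rTensor A)

/-- A coalgebra is cosemisimple if each right comodule is completely reducible: each of
its subcomodules has a complement that is a subcomodule. -/
def IsCosemisimple (k A : Type u) [Field k] [AddCommGroup A] [Module k A]
    [Coalgebra k A] : Prop :=
  ∀ (V : Type u) [AddCommGroup V] [Module k V] [RightComodule k A V] (W : Submodule k V),
    IsSubcomodule A W → ∃ W' : Submodule k V, IsSubcomodule A W' ∧ IsCompl W W'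

/-! ## Yetter-Drinfeld modules -/

section YD

variable (k A : Type u) [Field k] [Ring A] [HopfAlgebra k A]

section Op

variable (V : Type u) [AddCommGroup V] [Module k V] [Module Aᵐᵒᵖ V] [IsScalarTower k Aᵐᵒᵖ V]

/-- The right action of `b : A` on a right `A`-module. -/
def rightAct (b : A) : V →ₗ[k] V := Algebra.lsmul k k V (MulOpposite.op b)

@[simp] theorem rightAct_apply (b : A) (v : V) : rightAct k A V b v = MulOpposite.op b • v := rfl

/-- The linear map `(a ⊗ b) ⊗ c ↦ (v ⊗ x ↦ v · b ⊗ S(a) x c)`. -/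
def ydTwist : (A ⊗[k] A) ⊗[k] A →ₗ[k] (V ⊗[k] A →ₗ[k] V ⊗[k] A) :=
  TensorProduct.lift <| TensorProduct.lift <| LinearMap.mk₂ k
    (fun a b =>
      { toFun := fun c => TensorProduct.map (rightAct k A V b)
          (LinearMap.mulRight k c ∘ₗ LinearMap.mulLeft k (HopfAlgebra.antipode k a))
        map_add' := by intros; ext; simp [mul_add, TensorProduct.tmul_add]
        map_smul' := by intros; ext; simp })
    (by intros; ext; simp [add_mul, TensorProduct.tmul_add])
    (by intros; ext; simp)
    (by intros; ext; simp [add_smul, TensorProduct.add_tmul])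
    (by intros; ext; simp [TensorProduct.smul_tmul'])

@[simp] theorem ydTwist_tmul (a b c x : A) (v : V) :
    ydTwist k A V ((a ⊗ₜ b) ⊗ₜ c) (v ⊗ₜ x) =
      (MulOpposite.op b • v) ⊗ₜ (HopfAlgebra.antipode k a * x * c) := rfl

end Op

/-- A right-right Yetter-Drinfeld module over the Hopf algebra `A`: a right `A`-module (that is,
an `Aᵐᵒᵖ`-module) and right `A`-comodule such that
`(v · a)₍₀₎ ⊗ (v · a)₍₁₎ = v₍₀₎ · a₍₂₎ ⊗ S(a₍₁₎) v₍₁₎ a₍₃₎`. -/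
structure YetterDrinfeld where
  carrier : Type u
  [addCommGroup : AddCommGroup carrier]
  [module : Module k carrier]
  [opModule : Module Aᵐᵒᵖ carrier]
  [isScalarTower : IsScalarTower k Aᵐᵒᵖ carrier]
  [comodule : RightComodule k A carrier]
  compat : ∀ (v : carrier) (a : A),
    RightComodule.coact (k := k) (A := A) (MulOpposite.op a • v) =
      ydTwist k A carrier (Coalgebra.comul.rTensor A (Coalgebra.comul (R := k) a))
        (RightComodule.coact v)

namespace YetterDrinfeld

attribute [instance] addCommGroup module opModule isScalarTower comodule

variable {k A}

instance : CoeSort (YetterDrinfeld k A) (Type u) := ⟨carrier⟩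

/-- The coaction of a Yetter-Drinfeld module. -/
abbrev coact (X : YetterDrinfeld k A) : X →ₗ[k] X ⊗[k] A := RightComodule.coact

/-- Morphisms of Yetter-Drinfeld modules: the `A`-linear `A`-colinear maps. -/
@[ext]
structure Hom (X Y : YetterDrinfeld k A) where
  toLin : X →ₗ[k] Y
  map_act : ∀ (a : A) (v : X), toLin (MulOpposite.op a • v) = MulOpposite.op a • toLin v
  map_coact : ∀ v : X, Y.coact (toLin v) = toLin.rTensor A (X.coact v)

instance : Category (YetterDrinfeld k A) where
  Hom X Y := Hom X Y
  id X := ⟨LinearMap.id, fun _ _ => rfl, fun _ => by simp⟩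
  comp f g := ⟨g.toLin ∘ₗ f.toLin, fun a v => by simp [f.map_act, g.map_act],
    fun v => by simp [f.map_coact, g.map_coact, LinearMap.rTensor_comp]⟩

variable {X Y Z : YetterDrinfeld k A}

@[ext] theorem hom_ext {f g : X ⟶ Y} (h : ∀ v, f.toLin v = g.toLin v) : f = g :=
  Hom.ext (LinearMap.ext h)

@[simp] theorem id_toLin (v : X) : (𝟙 X : X ⟶ X).toLin v = v := rfl
@[simp] theorem comp_toLin (f : X ⟶ Y) (g : Y ⟶ Z) (v : X) :
    (f ≫ g).toLin v = g.toLin (f.toLin v) := rfl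

instance : Zero (X ⟶ Y) := ⟨⟨0, by simp, by simp⟩⟩
instance : Add (X ⟶ Y) := ⟨fun f g => ⟨f.toLin + g.toLin, by simp [f.map_act, g.map_act],
  by simp [f.map_coact, g.map_coact, LinearMap.rTensor_add]⟩⟩
instance : Neg (X ⟶ Y) := ⟨fun f => ⟨-f.toLin, by simp [f.map_act],
  by simp [f.map_coact, LinearMap.rTensor_neg]⟩⟩

@[simp] theorem zero_toLin (v : X) : (0 : X ⟶ Y).toLin v = 0 := rfl
@[simp] theorem add_toLin (f g : X ⟶ Y) (v : X) : (f + g).toLin v = f.toLin v + g.toLin v := rfl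
@[simp] theorem neg_toLin (f : X ⟶ Y) (v : X) : (-f).toLin v = -f.toLin v := rfl

instance : AddCommGroup (X ⟶ Y) where
  add_assoc _ _ _ := by ext; simp [add_assoc]
  zero_add _ := by ext; simp
  add_zero _ := by ext; simp
  nsmul := nsmulRec
  zsmul := zsmulRec
  neg_add_cancel _ := by ext; simp
  add_comm _ _ := by ext; simp [add_comm]

instance : Preadditive (YetterDrinfeld k A) where
  add_comp _ _ _ _ _ _ := by ext; simp
  comp_add _ _ _ _ _ _ := by ext; simp

/-- The trivial Yetter-Drinfeld module `k`: `A` acts through the counit, and `1` is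
coinvariant. -/
def trivial (k A : Type u) [Field k] [Ring A] [HopfAlgebra k A] : YetterDrinfeld k A :=
  letI : Module Aᵐᵒᵖ k := Module.compHom k
    ((Bialgebra.counitAlgHom k A).toRingHom.fromOpposite fun _ _ => mul_comm _ _)
  haveI : IsScalarTower k Aᵐᵒᵖ k := ⟨fun c a x => by
    change Coalgebra.counit (R := k) (c • a.unop) * x = c * (Coalgebra.counit (R := k) a.unop * x)
    rw [map_smul, smul_eq_mul, mul_assoc]⟩
  letI : RightComodule k A k :=
    { coact := (TensorProduct.mk k k A).flip 1
      coassoc := by ext; simp [Algebra.TensorProduct.one_def]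
      counit_coact := by ext; simp }
  { carrier := k
    compat := by
      intro v a
      have h1 : ∀ t : (A ⊗[k] A) ⊗[k] A, ydTwist k A k t (v ⊗ₜ 1) =
          v ⊗ₜ LinearMap.mul' k A ((HopfAlgebra.antipode k).rTensor A
            (((TensorProduct.rid k A).toLinearMap ∘ₗ
              Coalgebra.counit.lTensor A).rTensor A t)) := by
        intro t
        induction t with
        | zero => simp
        | add x y hx hy => simp only [map_add, LinearMap.add_apply, hx, hy, TensorProduct.tmul_add]
        | tmul x c =>
          induction x with
          | zero => simp
          | add x y hx hy =>
            simp only [map_add, LinearMap.add_apply, hx, hy, TensorProduct.tmul_add,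
              TensorProduct.add_tmul]
          | tmul a b =>
            have h2 : (MulOpposite.op b • v : k) = Coalgebra.counit (R := k) b • v := rfl
            simp only [ydTwist_tmul, h2, LinearMap.rTensor_tmul, LinearMap.comp_apply,
              LinearMap.lTensor_tmul, LinearEquiv.coe_coe, TensorProduct.rid_tmul,
              LinearMap.mul'_apply, mul_one, TensorProduct.smul_tmul, mul_smul_comm]
      have h3 : ((TensorProduct.rid k A).toLinearMap ∘ₗ Coalgebra.counit.lTensor A) ∘ₗ
          Coalgebra.comul (R := k) (A := A) = LinearMap.id := by
        ext; simp
      have h4 : (MulOpposite.op a • v : k) = Coalgebra.counit (R := k) a • v := rfl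
      change (MulOpposite.op a • v : k) ⊗ₜ[k] (1 : A) = ydTwist k A k _ (v ⊗ₜ 1)
      rw [h1, ← LinearMap.rTensor_comp_apply A _ (Coalgebra.comul (R := k) (A := A)), h3,
        LinearMap.rTensor_id, LinearMap.id_apply,
        HopfAlgebra.mul_antipode_rTensor_comul_apply, h4, TensorProduct.smul_tmul,
        Algebra.algebraMap_eq_smul_one] }

theorem ydTwist_natural {V W : Type u} [AddCommGroup V] [Module k V] [Module Aᵐᵒᵖ V]
    [IsScalarTower k Aᵐᵒᵖ V] [AddCommGroup W] [Module k W] [Module Aᵐᵒᵖ W]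
    [IsScalarTower k Aᵐᵒᵖ W] (f : V →ₗ[k] W)
    (hf : ∀ (a : A) (v : V), f (MulOpposite.op a • v) = MulOpposite.op a • f v)
    (t : (A ⊗[k] A) ⊗[k] A) (x : V ⊗[k] A) :
    f.rTensor A (ydTwist k A V t x) = ydTwist k A W t (f.rTensor A x) := by
  induction x with
  | zero => simp
  | add x y hx hy => simp only [map_add, hx, hy]
  | tmul v x =>
    induction t with
    | zero => simp
    | add x y hx hy => simp only [map_add, LinearMap.add_apply, hx, hy]
    | tmul t c =>
      induction t with
      | zero => simp
      | add x y hx hy =>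
        simp only [map_add, LinearMap.add_apply, hx, hy, TensorProduct.add_tmul]
      | tmul a b => simp [hf]

/-- The underlying `A`-linear map of a morphism. -/
def Hom.opLin (f : X ⟶ Y) : X →ₗ[Aᵐᵒᵖ] Y where
  toFun := f.toLin
  map_add' := map_add _
  map_smul' a v := f.map_act a.unop v

theorem rTensor_injective {V W : Type u} [AddCommGroup V] [Module k V] [AddCommGroup W]
    [Module k W] (f : V →ₗ[k] W) (hf : Function.Injective f) :
    Function.Injective (f.rTensor A) :=
  Module.Flat.rTensor_preserves_injective_linearMap f hf

section Comodule

variable {V W : Type u} [AddCommGroup V] [Module k V] [AddCommGroup W] [Module k W]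

theorem rTensor_assoc (f : V →ₗ[k] W) (t : (V ⊗[k] A) ⊗[k] A) :
    f.rTensor (A ⊗[k] A) (TensorProduct.assoc k V A A t) =
      TensorProduct.assoc k W A A ((f.rTensor A).rTensor A t) := by
  induction t with
  | zero => simp
  | add x y hx hy => simp only [map_add, hx, hy]
  | tmul t c =>
    induction t with
    | zero => simp
    | add x y hx hy => simp only [map_add, hx, hy, TensorProduct.add_tmul]
    | tmul a b => simp

theorem rTensor_comul (f : V →ₗ[k] W) (t : V ⊗[k] A) :
    f.rTensor (A ⊗[k] A) (Coalgebra.comul.lTensor V t) =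
      Coalgebra.comul.lTensor W (f.rTensor A t) := by
  induction t with
  | zero => simp
  | add x y hx hy => simp only [map_add, hx, hy]
  | tmul v a => simp

theorem rid_counit (f : V →ₗ[k] W) (t : V ⊗[k] A) :
    f (TensorProduct.rid k V (Coalgebra.counit.lTensor V t)) =
      TensorProduct.rid k W (Coalgebra.counit.lTensor W (f.rTensor A t)) := by
  induction t with
  | zero => simp
  | add x y hx hy => simp only [map_add, hx, hy]
  | tmul v a => simp

theorem coassoc_apply [RightComodule k A V] (v : V) :
    TensorProduct.assoc k V A A ((RightComodule.coact (k := k) (A := A) (V := V)).rTensor A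
      (RightComodule.coact v)) = Coalgebra.comul.lTensor V (RightComodule.coact v) :=
  LinearMap.congr_fun RightComodule.coassoc v

theorem counit_coact_apply [RightComodule k A V] (v : V) :
    TensorProduct.rid k V (Coalgebra.counit.lTensor V (RightComodule.coact (A := A) v)) = v :=
  LinearMap.congr_fun (RightComodule.counit_coact (k := k) (A := A) (V := V)) v

theorem coassoc_of_comp_eq [RightComodule k A V] (f : V →ₗ[k] W) (δ : W →ₗ[k] W ⊗[k] A)
    (hδ : δ ∘ₗ f = f.rTensor A ∘ₗ RightComodule.coact) (v : V) :
    TensorProduct.assoc k W A A (δ.rTensor A (δ (f v))) =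
      Coalgebra.comul.lTensor W (δ (f v)) := by
  have h : δ (f v) = f.rTensor A (RightComodule.coact v) := LinearMap.congr_fun hδ v
  rw [h, ← LinearMap.rTensor_comp_apply, hδ, LinearMap.rTensor_comp_apply, ← rTensor_assoc,
    coassoc_apply, rTensor_comul]

theorem counit_of_comp_eq [RightComodule k A V] (f : V →ₗ[k] W) (δ : W →ₗ[k] W ⊗[k] A)
    (hδ : δ ∘ₗ f = f.rTensor A ∘ₗ RightComodule.coact) (v : V) :
    TensorProduct.rid k W (Coalgebra.counit.lTensor W (δ (f v))) = f v := by
  have h : δ (f v) = f.rTensor A (RightComodule.coact v) := LinearMap.congr_fun hδ v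
  rw [h, ← rid_counit, counit_coact_apply]

theorem exists_coact_of_injective [RightComodule k A W] (f : V →ₗ[k] W)
    (hf : Function.Injective f)
    (h : ∀ v, RightComodule.coact (A := A) (f v) ∈ LinearMap.range (f.rTensor A)) :
    ∃ δ : V →ₗ[k] V ⊗[k] A, f.rTensor A ∘ₗ δ = RightComodule.coact ∘ₗ f := by
  refine ⟨(LinearEquiv.ofInjective (f.rTensor A) (rTensor_injective f hf)).symm.toLinearMap ∘ₗ
    (RightComodule.coact ∘ₗ f).codRestrict _ h, ?_⟩
  ext v
  exact congrArg Subtype.val ((LinearEquiv.ofInjective (f.rTensor A)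
    (rTensor_injective f hf)).apply_symm_apply ⟨RightComodule.coact (f v), h v⟩)

/-- The comodule structure on `V` induced by an injective map to a comodule `W` such that the
coaction of `W` maps the image of `V` to the image of `V ⊗ A`. -/
@[reducible]
def comoduleOfInjective [RightComodule k A W] (f : V →ₗ[k] W) (hf : Function.Injective f)
    (h : ∀ v, RightComodule.coact (A := A) (f v) ∈ LinearMap.range (f.rTensor A)) :
    RightComodule k A V where
  coact := (exists_coact_of_injective f hf h).choose
  coassoc := by
    have hδ := (exists_coact_of_injective f hf h).choose_spec
    set δ := (exists_coact_of_injective f hf h).choose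
    have hδ' : ∀ v, f.rTensor A (δ v) = RightComodule.coact (f v) := LinearMap.congr_fun hδ
    ext v
    apply Module.Flat.rTensor_preserves_injective_linearMap (M := A ⊗[k] A) f hf
    change f.rTensor (A ⊗[k] A) (TensorProduct.assoc k V A A (δ.rTensor A (δ v))) =
      f.rTensor (A ⊗[k] A) (Coalgebra.comul.lTensor V (δ v))
    rw [rTensor_assoc, rTensor_comul, ← LinearMap.rTensor_comp_apply, hδ,
      LinearMap.rTensor_comp_apply, hδ', coassoc_apply]
  counit_coact := by
    have hδ := (exists_coact_of_injective f hf h).choose_spec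
    set δ := (exists_coact_of_injective f hf h).choose
    have hδ' : ∀ v, f.rTensor A (δ v) = RightComodule.coact (f v) := LinearMap.congr_fun hδ
    ext v
    apply hf
    change f (TensorProduct.rid k V (Coalgebra.counit.lTensor V (δ v))) = f v
    rw [rid_counit, hδ', counit_coact_apply]

theorem comoduleOfInjective_coact [RightComodule k A W] (f : V →ₗ[k] W)
    (hf : Function.Injective f)
    (h : ∀ v, RightComodule.coact (A := A) (f v) ∈ LinearMap.range (f.rTensor A)) (v : V) :
    f.rTensor A ((comoduleOfInjective f hf h).coact v) = RightComodule.coact (f v) :=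
  LinearMap.congr_fun (exists_coact_of_injective f hf h).choose_spec v

theorem exists_desc (f : V →ₗ[k] W) (hf : Function.Surjective f) {U : Type u} [AddCommGroup U]
    [Module k U] (g : V →ₗ[k] U) (h : ∀ v, f v = 0 → g v = 0) :
    ∃ l : W →ₗ[k] U, l ∘ₗ f = g := by
  refine ⟨(LinearMap.ker f).liftQ g h ∘ₗ (f.quotKerEquivOfSurjective hf).symm.toLinearMap, ?_⟩
  ext v
  have : (f.quotKerEquivOfSurjective hf).symm (f v) = (LinearMap.ker f).mkQ v := by
    rw [LinearEquiv.symm_apply_eq]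
    rfl
  rw [LinearMap.comp_apply, LinearMap.comp_apply, LinearEquiv.coe_coe, this]
  rfl

/-- The comodule structure on `W` induced by a surjective map from a comodule `V`, provided
the coaction of `V` maps the kernel to zero in `W ⊗ A`. -/
@[reducible]
def comoduleOfSurjective [RightComodule k A V] (f : V →ₗ[k] W) (hf : Function.Surjective f)
    (h : ∀ v, f v = 0 → (f.rTensor A ∘ₗ RightComodule.coact (A := A)) v = 0) :
    RightComodule k A W where
  coact := (exists_desc f hf _ h).choose
  coassoc := by
    ext w
    obtain ⟨v, rfl⟩ := hf w
    exact coassoc_of_comp_eq f _ (exists_desc f hf _ h).choose_spec v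
  counit_coact := by
    ext w
    obtain ⟨v, rfl⟩ := hf w
    exact counit_of_comp_eq f _ (exists_desc f hf _ h).choose_spec v

theorem comoduleOfSurjective_coact [RightComodule k A V] (f : V →ₗ[k] W)
    (hf : Function.Surjective f)
    (h : ∀ v, f v = 0 → (f.rTensor A ∘ₗ RightComodule.coact (A := A)) v = 0) (v : V) :
    (comoduleOfSurjective f hf h).coact (f v) = f.rTensor A (RightComodule.coact v) :=
  LinearMap.congr_fun (exists_desc f hf _ h).choose_spec v

end Comodule

section Induced

variable (V : Type u) [AddCommGroup V] [Module k V] [Module Aᵐᵒᵖ V] [IsScalarTower k Aᵐᵒᵖ V]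

/-- The Yetter-Drinfeld module structure on an `A`-module `V` induced by an injective
`A`-linear map. -/
def ofInjective (X : YetterDrinfeld k A) (f : V →ₗ[k] X) (hf : Function.Injective f)
    (hact : ∀ (a : A) (v : V), f (MulOpposite.op a • v) = MulOpposite.op a • f v)
    (h : ∀ v, X.coact (f v) ∈ LinearMap.range (f.rTensor A)) : YetterDrinfeld k A where
  carrier := V
  comodule := comoduleOfInjective f hf h
  compat v a := by
    apply rTensor_injective f hf
    rw [ydTwist_natural f hact, comoduleOfInjective_coact, comoduleOfInjective_coact, hact,
      X.compat]

/-- The Yetter-Drinfeld module structure on an `A`-module `V` induced by a surjective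
`A`-linear map. -/
def ofSurjective (X : YetterDrinfeld k A) (f : X →ₗ[k] V) (hf : Function.Surjective f)
    (hact : ∀ (a : A) (v : X), f (MulOpposite.op a • v) = MulOpposite.op a • f v)
    (h : ∀ v, f v = 0 → (f.rTensor A ∘ₗ X.coact) v = 0) : YetterDrinfeld k A where
  carrier := V
  comodule := comoduleOfSurjective f hf h
  compat v a := by
    obtain ⟨v, rfl⟩ := hf v
    rw [← hact, comoduleOfSurjective_coact, comoduleOfSurjective_coact,
      ← ydTwist_natural f hact, X.compat]

/-- The structure map of an induced Yetter-Drinfeld module is a morphism. -/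
def ofInjectiveHom (X : YetterDrinfeld k A) (f : V →ₗ[k] X) (hf : Function.Injective f)
    (hact : ∀ (a : A) (v : V), f (MulOpposite.op a • v) = MulOpposite.op a • f v)
    (h : ∀ v, X.coact (f v) ∈ LinearMap.range (f.rTensor A)) :
    ofInjective V X f hf hact h ⟶ X :=
  Hom.mk (X := ofInjective V X f hf hact h) f hact
    fun v => (comoduleOfInjective_coact f hf h v).symm

/-- The structure map of a coinduced Yetter-Drinfeld module is a morphism. -/
def ofSurjectiveHom (X : YetterDrinfeld k A) (f : X →ₗ[k] V) (hf : Function.Surjective f)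
    (hact : ∀ (a : A) (v : X), f (MulOpposite.op a • v) = MulOpposite.op a • f v)
    (h : ∀ v, f v = 0 → (f.rTensor A ∘ₗ X.coact) v = 0) :
    X ⟶ ofSurjective V X f hf hact h :=
  Hom.mk (Y := ofSurjective V X f hf hact h) f hact
    fun v => comoduleOfSurjective_coact f hf h v

end Induced

/-- A morphism that factors, on underlying spaces, through an injective morphism. -/
def liftOfInjective (f : X ⟶ Y) (hf : Function.Injective f.toLin) (g : Z ⟶ Y)
    (h : ∀ z, g.toLin z ∈ LinearMap.range f.toLin) : Z ⟶ X :=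
  let l : Z →ₗ[k] X := (LinearEquiv.ofInjective f.toLin hf).symm.toLinearMap ∘ₗ
      g.toLin.codRestrict _ h
  have hl : ∀ z, f.toLin (l z) = g.toLin z := fun z =>
    congrArg Subtype.val ((LinearEquiv.ofInjective f.toLin hf).apply_symm_apply
      ⟨g.toLin z, h z⟩)
  { toLin := l
    map_act := fun a v => hf <| by rw [hl, f.map_act, g.map_act, hl]
    map_coact := fun v => rTensor_injective f.toLin hf <| by
      have h2 : f.toLin ∘ₗ l = g.toLin := LinearMap.ext hl
      rw [← f.map_coact, hl, g.map_coact, ← LinearMap.rTensor_comp_apply, h2] }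

theorem liftOfInjective_comp (f : X ⟶ Y) (hf : Function.Injective f.toLin) (g : Z ⟶ Y)
    (h : ∀ z, g.toLin z ∈ LinearMap.range f.toLin) : liftOfInjective f hf g h ≫ f = g := by
  ext z
  exact congrArg Subtype.val ((LinearEquiv.ofInjective f.toLin hf).apply_symm_apply
      ⟨g.toLin z, h z⟩)

/-- A morphism that factors, on underlying spaces, through a surjective morphism. -/
def descOfSurjective (f : X ⟶ Y) (hf : Function.Surjective f.toLin) (g : X ⟶ Z)
    (h : ∀ x, f.toLin x = 0 → g.toLin x = 0) : Y ⟶ Z :=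
  have hl := LinearMap.congr_fun (exists_desc f.toLin hf g.toLin h).choose_spec
  { toLin := (exists_desc f.toLin hf g.toLin h).choose
    map_act := fun a v => by
      obtain ⟨v, rfl⟩ := hf v
      rw [← f.map_act]
      exact (hl _).trans ((g.map_act a v).trans (congrArg _ (hl v).symm))
    map_coact := fun v => by
      obtain ⟨v, rfl⟩ := hf v
      rw [f.map_coact, ← LinearMap.rTensor_comp_apply,
        (exists_desc f.toLin hf g.toLin h).choose_spec, ← g.map_coact]
      exact congrArg _ (hl v) }

theorem comp_descOfSurjective (f : X ⟶ Y) (hf : Function.Surjective f.toLin) (g : X ⟶ Z)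
    (h : ∀ x, f.toLin x = 0 → g.toLin x = 0) : f ≫ descOfSurjective f hf g h = g := by
  ext x
  exact LinearMap.congr_fun (exists_desc f.toLin hf g.toLin h).choose_spec x

/-- The kernel of a morphism, included in its source. -/
def kerIncl (f : X ⟶ Y) : LinearMap.ker (Hom.opLin f) →ₗ[k] X :=
  (LinearMap.ker (Hom.opLin f)).subtype.restrictScalars k

theorem kerIncl_injective (f : X ⟶ Y) : Function.Injective (kerIncl f) :=
  Submodule.injective_subtype (LinearMap.ker (Hom.opLin f))

theorem coact_mem_range (f : X ⟶ Y) (v : LinearMap.ker (Hom.opLin f)) :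
    X.coact (kerIncl f v) ∈ LinearMap.range ((kerIncl f).rTensor A) := by
  have hex : Function.Exact (kerIncl f) f.toLin := by
    intro x
    exact ⟨fun hx => ⟨⟨x, hx⟩, rfl⟩, by rintro ⟨x, rfl⟩; exact x.2⟩
  refine (Module.Flat.rTensor_exact A hex _).1 ?_
  rw [← f.map_coact, (show f.toLin (kerIncl f v) = 0 from v.2), map_zero]

/-- The kernel of a morphism. -/
def ker (f : X ⟶ Y) : YetterDrinfeld k A :=
  ofInjective (LinearMap.ker (Hom.opLin f)) X (kerIncl f)
    (kerIncl_injective f) (fun _ _ => rfl) (coact_mem_range f)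

/-- The inclusion of the kernel. -/
def kerι (f : X ⟶ Y) : ker f ⟶ X :=
  ofInjectiveHom (LinearMap.ker (Hom.opLin f)) X (kerIncl f)
    (kerIncl_injective f) (fun _ _ => rfl) (coact_mem_range f)

theorem kerι_injective (f : X ⟶ Y) : Function.Injective (kerι f).toLin :=
  kerIncl_injective f

theorem toLin_kerIncl (f : X ⟶ Y) (v : LinearMap.ker (Hom.opLin f)) :
    f.toLin (kerIncl f v) = 0 := v.2

theorem kerι_comp (f : X ⟶ Y) : kerι f ≫ f = 0 :=
  hom_ext fun v => toLin_kerIncl f v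

theorem mem_range_kerIncl (f : X ⟶ Y) (v : X) (h : f.toLin v = 0) :
    v ∈ LinearMap.range (kerIncl f) :=
  ⟨⟨v, h⟩, rfl⟩

theorem mem_range_kerι (f : X ⟶ Y) (v : X) (h : f.toLin v = 0) :
    v ∈ LinearMap.range (kerι f).toLin :=
  mem_range_kerIncl f v h

/-- The projection of the target of a morphism to its cokernel. -/
def cokerProj (f : X ⟶ Y) : Y →ₗ[k] (Y ⧸ LinearMap.range (Hom.opLin f)) :=
  (LinearMap.range (Hom.opLin f)).mkQ.restrictScalars k

theorem cokerProj_surjective (f : X ⟶ Y) : Function.Surjective (cokerProj f) :=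
  Submodule.mkQ_surjective (LinearMap.range (Hom.opLin f))

theorem cokerProj_toLin (f : X ⟶ Y) (x : X) : cokerProj f (f.toLin x) = 0 :=
  (Submodule.Quotient.mk_eq_zero (LinearMap.range (Hom.opLin f))).2 ⟨x, rfl⟩

theorem mem_range_of_cokerProj (f : X ⟶ Y) (v : Y) (h : cokerProj f v = 0) :
    v ∈ LinearMap.range f.toLin :=
  (Submodule.Quotient.mk_eq_zero (LinearMap.range (Hom.opLin f))).1 h

theorem cokerProj_coact (f : X ⟶ Y) (v : Y) (hv : cokerProj f v = 0) :
    ((cokerProj f).rTensor A ∘ₗ Y.coact) v = 0 := by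
  obtain ⟨x, rfl⟩ := mem_range_of_cokerProj f v hv
  have h : cokerProj f ∘ₗ f.toLin = 0 := LinearMap.ext fun x => cokerProj_toLin f x
  rw [LinearMap.comp_apply, f.map_coact, ← LinearMap.rTensor_comp_apply, h,
    LinearMap.rTensor_zero, LinearMap.zero_apply]

/-- The cokernel of a morphism. -/
def coker (f : X ⟶ Y) : YetterDrinfeld k A :=
  ofSurjective (Y ⧸ LinearMap.range (Hom.opLin f)) Y (cokerProj f)
    (cokerProj_surjective f) (fun _ _ => rfl) (cokerProj_coact f)

/-- The projection to the cokernel. -/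
def cokerπ (f : X ⟶ Y) : Y ⟶ coker f :=
  ofSurjectiveHom (Y ⧸ LinearMap.range (Hom.opLin f)) Y (cokerProj f)
    (cokerProj_surjective f) (fun _ _ => rfl) (cokerProj_coact f)

theorem cokerπ_surjective (f : X ⟶ Y) : Function.Surjective (cokerπ f).toLin :=
  cokerProj_surjective f

theorem comp_cokerπ (f : X ⟶ Y) : f ≫ cokerπ f = 0 :=
  hom_ext fun v => cokerProj_toLin f v

theorem mem_range_of_cokerπ (f : X ⟶ Y) (v : Y) (h : (cokerπ f).toLin v = 0) :
    v ∈ LinearMap.range f.toLin :=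
  mem_range_of_cokerProj f v h

/-- The coaction on a product. -/
def prodCoact (X Y : YetterDrinfeld k A) : X × Y →ₗ[k] (X × Y) ⊗[k] A :=
  (LinearMap.inl k X Y).rTensor A ∘ₗ X.coact ∘ₗ LinearMap.fst k X Y +
    (LinearMap.inr k X Y).rTensor A ∘ₗ Y.coact ∘ₗ LinearMap.snd k X Y

theorem prodCoact_inl : prodCoact X Y ∘ₗ LinearMap.inl k X Y =
    (LinearMap.inl k X Y).rTensor A ∘ₗ X.coact := by
  ext v; simp [prodCoact]

theorem prodCoact_inr : prodCoact X Y ∘ₗ LinearMap.inr k X Y =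
    (LinearMap.inr k X Y).rTensor A ∘ₗ Y.coact := by
  ext v; simp [prodCoact]

/-- The product of two Yetter-Drinfeld modules. -/
def prod (X Y : YetterDrinfeld k A) : YetterDrinfeld k A where
  carrier := X × Y
  comodule :=
    { coact := prodCoact X Y
      coassoc := by
        apply LinearMap.prod_ext
        · ext v; exact coassoc_of_comp_eq _ _ prodCoact_inl v
        · ext v; exact coassoc_of_comp_eq _ _ prodCoact_inr v
      counit_coact := by
        apply LinearMap.prod_ext
        · ext1 v; exact counit_of_comp_eq _ _ prodCoact_inl v
        · ext1 v; exact counit_of_comp_eq _ _ prodCoact_inr v }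
  compat v a := by
    change prodCoact X Y (MulOpposite.op a • v) = ydTwist k A (X × Y) _ (prodCoact X Y v)
    simp only [prodCoact, LinearMap.add_apply, LinearMap.comp_apply, map_add]
    rw [← ydTwist_natural _ (fun _ _ => by simp), ← ydTwist_natural _ (fun _ _ => by simp)]
    exact congrArg₂ (· + ·) (congrArg _ (X.compat v.1 a)) (congrArg _ (Y.compat v.2 a))

open Limits

theorem injective_of_mono (f : X ⟶ Y) [Mono f] : Function.Injective f.toLin := by
  have h : kerι f = 0 := by rw [← cancel_mono f, kerι_comp, zero_comp]
  rw [injective_iff_map_eq_zero]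
  intro v hv
  obtain ⟨w, rfl⟩ := mem_range_kerι f v hv
  rw [h, zero_toLin]

theorem surjective_of_epi (f : X ⟶ Y) [Epi f] : Function.Surjective f.toLin := by
  have h : cokerπ f = 0 := by rw [← cancel_epi f, comp_cokerπ, comp_zero]
  intro v
  exact mem_range_of_cokerπ f v (by rw [h, zero_toLin])

/-- An injective morphism whose image is the zero set of `g` is a kernel of `g`. -/
def isLimitOfInjective (f : X ⟶ Y) (hf : Function.Injective f.toLin) (g : Y ⟶ Z)
    (w : f ≫ g = 0) (h : ∀ y, g.toLin y = 0 → y ∈ LinearMap.range f.toLin) :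
    IsLimit (KernelFork.ofι f w) :=
  KernelFork.IsLimit.ofι f w
    (fun g' hg' => liftOfInjective f hf g' fun z =>
      h _ (by rw [← comp_toLin, hg', zero_toLin]))
    (fun _ _ => liftOfInjective_comp _ _ _ _)
    (fun _ _ m hm => by
      ext v
      apply hf
      rw [← comp_toLin, ← comp_toLin, hm, liftOfInjective_comp])

/-- A surjective morphism whose zero set is the image of `f` is a cokernel of `f`. -/
def isColimitOfSurjective (f : X ⟶ Y) (g : Y ⟶ Z) (hg : Function.Surjective g.toLin)
    (w : f ≫ g = 0) (h : ∀ y, g.toLin y = 0 → y ∈ LinearMap.range f.toLin) :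
    IsColimit (CokernelCofork.ofπ g w) :=
  CokernelCofork.IsColimit.ofπ g w
    (fun g' hg' => descOfSurjective g hg g' fun y hy => by
      obtain ⟨x, rfl⟩ := h y hy
      rw [← comp_toLin, hg', zero_toLin])
    (fun _ _ => comp_descOfSurjective _ _ _ _)
    (fun _ _ m hm => by
      ext v
      obtain ⟨v, rfl⟩ := hg v
      rw [← comp_toLin, ← comp_toLin, hm, comp_descOfSurjective])

instance : HasZeroObject (YetterDrinfeld k A) :=
  ⟨coker (𝟙 (trivial k A)), by
    rw [IsZero.iff_id_eq_zero]
    ext v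
    obtain ⟨v, rfl⟩ := cokerπ_surjective _ v
    have h := congrArg (fun g => Hom.toLin g v) (comp_cokerπ (𝟙 (trivial k A)))
    simpa using h⟩

theorem fst_prodCoact (v : X × Y) :
    X.coact v.1 = (LinearMap.fst k X Y).rTensor A (prodCoact X Y v) := by
  simp [prodCoact, ← LinearMap.rTensor_comp_apply, LinearMap.rTensor_zero]

theorem snd_prodCoact (v : X × Y) :
    Y.coact v.2 = (LinearMap.snd k X Y).rTensor A (prodCoact X Y v) := by
  simp [prodCoact, ← LinearMap.rTensor_comp_apply, LinearMap.rTensor_zero]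

theorem inl_act (a : A) (v : X) : LinearMap.inl k X Y (MulOpposite.op a • v) =
    MulOpposite.op a • LinearMap.inl k X Y v := by simp

theorem inr_act (a : A) (v : Y) : LinearMap.inr k X Y (MulOpposite.op a • v) =
    MulOpposite.op a • LinearMap.inr k X Y v := by simp

/-- The biproduct of two Yetter-Drinfeld modules. -/
def bicone (X Y : YetterDrinfeld k A) : BinaryBicone X Y where
  pt := prod X Y
  fst := Hom.mk (X := prod X Y) (LinearMap.fst k X Y) (fun _ _ => rfl) fst_prodCoact
  snd := Hom.mk (X := prod X Y) (LinearMap.snd k X Y) (fun _ _ => rfl) snd_prodCoact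
  inl := Hom.mk (Y := prod X Y) (LinearMap.inl k X Y) inl_act (LinearMap.congr_fun prodCoact_inl)
  inr := Hom.mk (Y := prod X Y) (LinearMap.inr k X Y) inr_act (LinearMap.congr_fun prodCoact_inr)
  inl_fst := by ext; rfl
  inl_snd := by ext; rfl
  inr_fst := by ext; rfl
  inr_snd := by ext; rfl

instance : HasBinaryBiproducts (YetterDrinfeld k A) where
  has_binary_biproduct X Y := hasBinaryBiproduct_of_total (bicone X Y) <| by
    ext v
    exact Prod.fst_add_snd (M := X) (N := Y) v

instance : Abelian (YetterDrinfeld k A) where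
  has_finite_products :=
    haveI : HasBinaryProducts (YetterDrinfeld k A) := inferInstance
    haveI : HasTerminal (YetterDrinfeld k A) := inferInstance
    hasFiniteProducts_of_has_binary_and_terminal
  has_kernels := ⟨fun f => ⟨⟨⟨_, isLimitOfInjective (kerι f) (kerι_injective f) f
    (kerι_comp f) (mem_range_kerι f)⟩⟩⟩⟩
  has_cokernels := ⟨fun f => ⟨⟨⟨_, isColimitOfSurjective f (cokerπ f) (cokerπ_surjective f)
    (comp_cokerπ f) (mem_range_of_cokerπ f)⟩⟩⟩⟩
  normalMonoOfMono f _ := ⟨⟨_, cokerπ f, comp_cokerπ f,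
    isLimitOfInjective f (injective_of_mono f) _ _ (mem_range_of_cokerπ f)⟩⟩
  normalEpiOfEpi f _ := ⟨⟨_, kerι f, kerι_comp f,
    isColimitOfSurjective _ f (surjective_of_epi f) _ (mem_range_kerι f)⟩⟩

end YetterDrinfeld

/-! ## Gerstenhaber-Schack cohomology -/

/-- `H_GS^n(A, V) = Ext^n(k, V)` in the category of Yetter-Drinfeld modules over `A`. -/
def GSCohomology (V : YetterDrinfeld k A) (n : ℕ) : Type (u + 1) :=
  haveI : HasExt.{u + 1} (YetterDrinfeld k A) := HasExt.standard _
  Abelian.Ext.{u + 1} (YetterDrinfeld.trivial k A) V n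

instance (V : YetterDrinfeld k A) (n : ℕ) : AddCommGroup (GSCohomology k A V n) :=
  haveI : HasExt.{u + 1} (YetterDrinfeld k A) := HasExt.standard _
  inferInstanceAs (AddCommGroup (Abelian.Ext.{u + 1} (YetterDrinfeld.trivial k A) V n))

/-- The Gerstenhaber-Schack cohomological dimension of `A`: the supremum in `ℕ ∪ {∞}` of the
degrees `n` such that `H_GS^n(A, V) ≠ 0` for some Yetter-Drinfeld module `V`. -/
def cdGS : ℕ∞ :=
  sSup {d : ℕ∞ | ∃ (n : ℕ) (V : YetterDrinfeld k A), d = n ∧ Nontrivial (GSCohomology k A V n)}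

end YD

end

/-! For a Hopf algebra H, `cdGS` is the projective dimension of the trivial module k_H in
Yetter-Drinfeld modules (`cdGS_le_iff`). Put H = A * B. The theorem comes from one short exact
sequence (`mayerVietoris`)

0 → F → Ind k_A ⊕ Ind k_B → k_H → 0,

where F is the free module on the trivial comodule (H itself, with a coadjoint coaction) and Ind X =
X ⊗_A H is induction along A → H, likewise for B. If F is projective, then for every d ≥ 1 the
module k_H has projective dimension at most d exactly when Ind k_A and Ind k_B do. It remains to see
that Ind preserves projective dimension and that k_H is not projective.

Projectivity. Cosemisimplicity yields a Haar functional (`exists_isHaar`). Averaging against it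
lifts colinear maps along colinear surjections, so free modules on comodules are projective
(`projective_free`). Every Yetter-Drinfeld module is a quotient of one of them, which gives enough
projectives.

Induction. With a basis-free form of the normal form theorem, H = A ⊕ M, where M is spanned by
reduced words with a letter from B; M is an A-bimodule and a subcoalgebra. The projection E : H → A
is therefore bilinear and bicolinear (`IsFreeProd.exists_isExpectation`). It transports the Haar
functional of A to H, and v ⊗ h ↦ v · E(h) retracts Ind V onto V, so Ind reflects projectivity
(`projective_of_ind`). Ind also preserves projectives and is exact (`IsFreeProd.indMap_injective`,
`ind_shortExact`). Dimension shifting gives `hasProjectiveDimensionLT_ind_iff`.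

Derivations. A map out of a free product is determined freely by its values on the factors, and this
holds for ε-derivations too (`IsFreeProd.exists_derivation`). The derivation that is a ↦ a - ε(a) on
A and 0 on B gives the injectivity of F → Ind k_A ⊕ Ind k_B. Its analogue with values in A ⊗ B
contradicts the existence of a normalized integral in H, which projectivity of k_H would produce
(`not_projective_trivial`). -/

noncomputable section

open TensorProduct CategoryTheory

/-! ## Convolution of linear maps -/

section Conv

variable {k C D R R' : Type*} [Field k] [AddCommMonoid C] [Module k C] [Coalgebra k C]
  [AddCommMonoid D] [Module k D] [Coalgebra k D] [Semiring R] [Algebra k R]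
  [Semiring R'] [Algebra k R']

/-- The convolution product `c ↦ f(c₁) g(c₂)`. -/
def conv (f g : C →ₗ[k] R) : C →ₗ[k] R :=
  LinearMap.mul' k R ∘ₗ TensorProduct.map f g ∘ₗ Coalgebra.comul

/-- The unit of the convolution product. -/
def convUnit (k C R : Type*) [Field k] [AddCommMonoid C] [Module k C] [Coalgebra k C]
    [Semiring R] [Algebra k R] : C →ₗ[k] R :=
  Algebra.linearMap k R ∘ₗ Coalgebra.counit

theorem conv_apply (f g : C →ₗ[k] R) (c : C) :
    conv f g c = LinearMap.mul' k R (TensorProduct.map f g (Coalgebra.comul c)) := rfl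

theorem conv_assoc (f g h : C →ₗ[k] R) : conv (conv f g) h = conv f (conv g h) :=
  congrArg WithConv.ofConv (mul_assoc (WithConv.toConv f) (WithConv.toConv g) (WithConv.toConv h))

theorem convUnit_conv (f : C →ₗ[k] R) : conv (convUnit k C R) f = f :=
  congrArg WithConv.ofConv (one_mul (WithConv.toConv f))

theorem conv_convUnit (f : C →ₗ[k] R) : conv f (convUnit k C R) = f :=
  congrArg WithConv.ofConv (mul_one (WithConv.toConv f))

theorem algHom_comp_conv (φ : R →ₐ[k] R') (f g : C →ₗ[k] R) :
    φ.toLinearMap ∘ₗ conv f g = conv (φ.toLinearMap ∘ₗ f) (φ.toLinearMap ∘ₗ g) := by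
  ext c
  simp only [LinearMap.comp_apply, conv_apply]
  induction Coalgebra.comul (R := k) c with
  | zero => simp
  | add x y hx hy => simp only [map_add, hx, hy]
  | tmul x y => simp

theorem algHom_comp_convUnit (φ : R →ₐ[k] R') :
    φ.toLinearMap ∘ₗ convUnit k C R = convUnit k C R' := by
  ext c
  simp [convUnit]

/-- If `T` intertwines `f` with `f'` and `g` with `g'`, it intertwines their convolutions. -/
theorem conv_intertwine {X Y : Type*} [AddCommMonoid X] [Module k X] [AddCommMonoid Y] [Module k Y]
    (T : X →ₗ[k] Y) {f g : C →ₗ[k] Module.End k X} {f' g' : C →ₗ[k] Module.End k Y}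
    (hf : ∀ a x, T (f a x) = f' a (T x)) (hg : ∀ a x, T (g a x) = g' a (T x)) (a : C) (x : X) :
    T (conv f g a x) = conv f' g' a (T x) := by
  simp only [conv_apply]
  induction Coalgebra.comul (R := k) a with
  | zero => simp
  | add x y hx hy => simp only [map_add, LinearMap.add_apply, hx, hy]
  | tmul x y => simp [hf, hg]

/-- In use, E is the expectation of H on A and i the inclusion: f(h₁) g(E(h₂)) becomes an expression
in the coproduct of E(h). -/
theorem conv_comp_right (f : C →ₗ[k] R) (g : D →ₗ[k] R) (E : C →ₗ[k] D) (i : D →ₗ[k] C)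
    (h : ∀ c, E.lTensor C (Coalgebra.comul c) = i.rTensor D (Coalgebra.comul (E c))) :
    conv f (g ∘ₗ E) = conv (f ∘ₗ i) g ∘ₗ E := by
  ext c
  have h1 : TensorProduct.map f (g ∘ₗ E) = TensorProduct.map f g ∘ₗ E.lTensor C := by
    ext; simp
  have h2 : TensorProduct.map (f ∘ₗ i) g = TensorProduct.map f g ∘ₗ i.rTensor D := by
    ext; simp
  rw [LinearMap.comp_apply, conv_apply, conv_apply, h1, h2, LinearMap.comp_apply, h,
    LinearMap.comp_apply]

theorem conv_comp_left (f : C →ₗ[k] R) (g : D →ₗ[k] R) (E : C →ₗ[k] D) (i : D →ₗ[k] C)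
    (h : ∀ c, E.rTensor C (Coalgebra.comul c) = i.lTensor D (Coalgebra.comul (E c))) :
    conv (g ∘ₗ E) f = conv g (f ∘ₗ i) ∘ₗ E := by
  ext c
  have h1 : TensorProduct.map (g ∘ₗ E) f = TensorProduct.map g f ∘ₗ E.rTensor C := by
    ext; simp
  have h2 : TensorProduct.map g (f ∘ₗ i) = TensorProduct.map g f ∘ₗ i.lTensor D := by
    ext; simp
  rw [LinearMap.comp_apply, conv_apply, conv_apply, h1, h2, LinearMap.comp_apply, h,
    LinearMap.comp_apply]

end Conv

/-! ## The antipode is anti-comultiplicative -/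

section Antipode

variable (k A : Type*) [Field k] [Ring A] [HopfAlgebra k A]

theorem conv_antipode_id : conv (HopfAlgebra.antipode k) LinearMap.id = convUnit k A A :=
  HopfAlgebra.mul_antipode_rTensor_comul

theorem conv_id_antipode : conv LinearMap.id (HopfAlgebra.antipode k) = convUnit k A A :=
  HopfAlgebra.mul_antipode_lTensor_comul

/-- Uniqueness of convolution inverses in Hom(A, A ⊗ A): Δ ∘ S is a left inverse of Δ. Since Δ is
the convolution of the two inclusions `j1` and `j2`, the convolution of `j2` ∘ S and `j1` ∘ S is a
right inverse. -/
theorem comul_antipode : Coalgebra.comul (R := k) ∘ₗ HopfAlgebra.antipode k =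
    conv (Algebra.TensorProduct.includeRight.toLinearMap ∘ₗ HopfAlgebra.antipode k)
      ((Algebra.TensorProduct.includeLeft : A →ₐ[k] A ⊗[k] A).toLinearMap ∘ₗ
        HopfAlgebra.antipode k) := by
  set j1 : A →ₐ[k] A ⊗[k] A := Algebra.TensorProduct.includeLeft
  set j2 : A →ₐ[k] A ⊗[k] A := Algebra.TensorProduct.includeRight
  have h1 : conv j1.toLinearMap j2.toLinearMap = (Bialgebra.comulAlgHom k A).toLinearMap := by
    ext a
    rw [conv_apply]
    change _ = Coalgebra.comul (R := k) a
    induction Coalgebra.comul (R := k) a with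
    | zero => simp
    | add x y hx hy => simp only [map_add, hx, hy]
    | tmul x y => simp [j1, j2]
  have h2 : ∀ j : A →ₐ[k] A ⊗[k] A,
      conv j.toLinearMap (j.toLinearMap ∘ₗ HopfAlgebra.antipode k) = convUnit k A _ := by
    intro j
    rw [← algHom_comp_convUnit j, ← conv_id_antipode, algHom_comp_conv, LinearMap.comp_id]
  have h3 : conv (Coalgebra.comul (R := k) ∘ₗ HopfAlgebra.antipode k)
      (Bialgebra.comulAlgHom k A).toLinearMap = convUnit k A _ := by
    rw [← algHom_comp_convUnit (Bialgebra.comulAlgHom k A), ← conv_antipode_id, algHom_comp_conv,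
      LinearMap.comp_id]
    rfl
  have h4 : conv (Bialgebra.comulAlgHom k A).toLinearMap
      (conv (j2.toLinearMap ∘ₗ HopfAlgebra.antipode k)
        (j1.toLinearMap ∘ₗ HopfAlgebra.antipode k)) = convUnit k A _ := by
    rw [← h1, conv_assoc, ← conv_assoc j2.toLinearMap, h2, convUnit_conv, h2]
  rw [← conv_convUnit (Coalgebra.comul (R := k) ∘ₗ HopfAlgebra.antipode k), ← h4,
    ← conv_assoc, h3, convUnit_conv]

end Antipode

/-! ## Twisted actions on tensor products -/

section Twist

variable (k A : Type*) [Field k] [Ring A] [HopfAlgebra k A] (X : Type*) [AddCommMonoid X]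
  [Module k X]

/-- `a` acts on `X ⊗ A` by left multiplication with `S(a)`. -/
def leftAntipode : A →ₗ[k] Module.End k (X ⊗[k] A) :=
  LinearMap.lTensorHom X ∘ₗ LinearMap.mul k A ∘ₗ HopfAlgebra.antipode k

/-- `a` acts on `X ⊗ A` by right multiplication with `a`. -/
def rightMul : A →ₗ[k] Module.End k (X ⊗[k] A) :=
  LinearMap.lTensorHom X ∘ₗ (LinearMap.mul k A).flip

variable {k A X}

/-- `a` acts on `X ⊗ A` through an action on `X`. -/
def firstAct {B : Type*} [AddCommMonoid B] [Module k B] (ρ : B →ₗ[k] Module.End k X) :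
    B →ₗ[k] Module.End k (X ⊗[k] A) :=
  LinearMap.rTensorHom A ∘ₗ ρ

@[simp] theorem leftAntipode_apply (a : A) : leftAntipode k A X a =
    (LinearMap.mulLeft k (HopfAlgebra.antipode k a)).lTensor X := rfl

@[simp] theorem rightMul_apply (a : A) : rightMul k A X a = (LinearMap.mulRight k a).lTensor X :=
  rfl

@[simp] theorem firstAct_apply {B : Type*} [AddCommMonoid B] [Module k B]
    (ρ : B →ₗ[k] Module.End k X) (a : B) :
    firstAct (A := A) ρ a = (ρ a).rTensor A := rfl

/-- The action `x ⊗ g ↦ x · a₂ ⊗ S(a₁) g a₃`. -/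
def twist (ρ : A →ₗ[k] Module.End k X) : A →ₗ[k] Module.End k (X ⊗[k] A) :=
  conv (conv (leftAntipode k A X) (firstAct ρ)) (rightMul k A X)

/-- The linear map `x ⊗ g ↦ (x ⊗ g₁) ⊗ g₂`. -/
def comulSnd (k A X : Type*) [Field k] [Ring A] [HopfAlgebra k A] [AddCommMonoid X]
    [Module k X] : X ⊗[k] A →ₗ[k] (X ⊗[k] A) ⊗[k] A :=
  (TensorProduct.assoc k X A A).symm.toLinearMap ∘ₗ Coalgebra.comul.lTensor X

theorem comulSnd_tmul (x : X) (g : A) :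
    comulSnd k A X (x ⊗ₜ g) = (TensorProduct.mk k X A x).rTensor A (Coalgebra.comul g) := by
  simp only [comulSnd, LinearMap.comp_apply, LinearMap.lTensor_tmul]
  induction Coalgebra.comul (R := k) g with
  | zero => simp
  | add x y hx hy => simp only [map_add, TensorProduct.tmul_add, hx, hy]
  | tmul x y => simp

theorem twist_natural {Y : Type*} [AddCommMonoid Y] [Module k Y] (f : X →ₗ[k] Y)
    {ρ : A →ₗ[k] Module.End k X} {σ : A →ₗ[k] Module.End k Y}
    (h : ∀ a x, f (ρ a x) = σ a (f x)) (a : A) (z : X ⊗[k] A) :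
    f.rTensor A (twist ρ a z) = twist σ a (f.rTensor A z) := by
  refine conv_intertwine _ (conv_intertwine _ ?_ ?_) ?_ a z
  · intro a z
    induction z with
    | zero => simp
    | add x y hx hy => simp only [map_add, hx, hy]
    | tmul x y => simp
  · intro a z
    induction z with
    | zero => simp
    | add x y hx hy => simp only [map_add, hx, hy]
    | tmul x y => simp [h]
  · intro a z
    induction z with
    | zero => simp
    | add x y hx hy => simp only [map_add, hx, hy]
    | tmul x y => simp

/-- The source of coassociativity for free modules. Unfolding the double twist gives S(a₁) and a₅ on
the outer factor, S(a₂) and a₄ on the inner one, and a₃ on X. This is what Δ(S(a₁) g a₃) produces,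
because S reverses the coproduct. -/
theorem comulSnd_twist (ρ : A →ₗ[k] Module.End k X) (a : A) (z : X ⊗[k] A) :
    comulSnd k A X (twist ρ a z) = twist (twist ρ) a (comulSnd k A X z) := by
  let fst : Module.End k (X ⊗[k] A) →ₐ[k] Module.End k ((X ⊗[k] A) ⊗[k] A) :=
    Module.End.rTensorAlgHom k (X ⊗[k] A) A
  have hfst : ∀ σ : A →ₗ[k] Module.End k (X ⊗[k] A),
      firstAct (A := A) σ = fst.toLinearMap ∘ₗ σ := fun σ => rfl
  have key : twist (twist ρ) = conv (conv (conv (leftAntipode k A (X ⊗[k] A))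
      (firstAct (leftAntipode k A X))) (firstAct (firstAct ρ)))
      (conv (firstAct (rightMul k A X)) (rightMul k A (X ⊗[k] A))) := by
    rw [twist, twist, hfst (conv _ _), algHom_comp_conv, algHom_comp_conv, ← hfst, ← hfst, ← hfst]
    simp only [conv_assoc]
  rw [key]
  refine conv_intertwine _ (conv_intertwine _ ?_ ?_) ?_ a z
  · intro a z
    induction z with
    | zero => simp
    | add x y hx hy => simp only [map_add, hx, hy]
    | tmul x g =>
      simp only [leftAntipode_apply, LinearMap.lTensor_tmul, comulSnd_tmul,
        LinearMap.mulLeft_apply, Bialgebra.comul_mul]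
      rw [← LinearMap.comp_apply (Coalgebra.comul (R := k)) (HopfAlgebra.antipode k) a,
        comul_antipode]
      simp only [conv_apply]
      induction Coalgebra.comul (R := k) a with
      | zero => simp
      | add x y hx hy => simp only [map_add, add_mul, LinearMap.add_apply, hx, hy]
      | tmul a b =>
        induction Coalgebra.comul (R := k) g with
        | zero => simp
        | add x y hx hy => simp only [map_add, mul_add, hx, hy]
        | tmul x y => simp
  · intro a z
    induction z with
    | zero => simp
    | add x y hx hy => simp only [map_add, hx, hy]
    | tmul x g =>
      simp only [firstAct_apply, LinearMap.rTensor_tmul, comulSnd_tmul,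
        ← LinearMap.rTensor_comp_apply]
      congr 2
  · intro a z
    induction z with
    | zero => simp
    | add x y hx hy => simp only [map_add, hx, hy]
    | tmul x g =>
      simp only [rightMul_apply, LinearMap.lTensor_tmul, comulSnd_tmul, LinearMap.mulRight_apply,
        Bialgebra.comul_mul, conv_apply]
      induction Coalgebra.comul (R := k) a with
      | zero => simp
      | add x y hx hy => simp only [map_add, mul_add, LinearMap.add_apply, hx, hy]
      | tmul a b =>
        induction Coalgebra.comul (R := k) g with
        | zero => simp
        | add x y hx hy => simp only [map_add, add_mul, hx, hy]
        | tmul x y => simp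

/-- The counit turns the outer factors S(a₁) and a₃ into scalars ε(a₁), ε(a₃), which are units for
convolution. -/
theorem twist_counit (ρ : A →ₗ[k] Module.End k X) (a : A) (z : X ⊗[k] A) :
    TensorProduct.rid k X (Coalgebra.counit.lTensor X (twist ρ a z)) =
      ρ a (TensorProduct.rid k X (Coalgebra.counit.lTensor X z)) := by
  have key : ρ = conv (conv (convUnit k A _) ρ) (convUnit k A _) := by
    rw [convUnit_conv, conv_convUnit]
  conv_rhs => rw [key]
  refine conv_intertwine ((TensorProduct.rid k X).toLinearMap ∘ₗ Coalgebra.counit.lTensor X)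
    (conv_intertwine _ ?_ ?_) ?_ a z
  · intro a z
    induction z with
    | zero => simp
    | add x y hx hy => simp only [map_add, hx, hy]
    | tmul x y => simp [convUnit, smul_smul, mul_comm]
  · intro a z
    induction z with
    | zero => simp
    | add x y hx hy => simp only [map_add, hx, hy]
    | tmul x y => simp
  · intro a z
    induction z with
    | zero => simp
    | add x y hx hy => simp only [map_add, hx, hy]
    | tmul x y => simp [convUnit, smul_smul, mul_comm]

end Twist

section TwistModule

variable (k A : Type u) [Field k] [Ring A] [HopfAlgebra k A]
 (V : Type u) [AddCommGroup V] [Module k V]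
variable [Module Aᵐᵒᵖ V] [IsScalarTower k Aᵐᵒᵖ V]

/-- The right action of `A` on an `A`-module as a linear map. -/
def rightActHom : A →ₗ[k] Module.End k V where
  toFun := rightAct k A V
  map_add' _ _ := by ext; simp [add_smul]
  map_smul' _ _ := by ext; simp

@[simp] theorem rightActHom_apply (a : A) (v : V) :
    rightActHom k A V a v = MulOpposite.op a • v := rfl

theorem ydTwist_comul (a : A) :
    ydTwist k A V (Coalgebra.comul.rTensor A (Coalgebra.comul (R := k) a)) =
      twist (rightActHom k A V) a := by
  rw [twist, conv_apply]
  induction Coalgebra.comul (R := k) a with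
  | zero => simp
  | add x y hx hy => simp only [map_add, hx, hy]
  | tmul x y =>
    simp only [LinearMap.rTensor_tmul, TensorProduct.map_tmul, conv_apply, LinearMap.mul'_apply]
    induction Coalgebra.comul (R := k) x with
    | zero => simp
    | add x y hx hy => simp only [map_add, TensorProduct.add_tmul, add_mul, hx, hy]
    | tmul x z =>
      ext v g
      simp [mul_assoc]

theorem ydTwist_mul (s t : (A ⊗[k] A) ⊗[k] A) (z : V ⊗[k] A) :
    ydTwist k A V (s * t) z = ydTwist k A V t (ydTwist k A V s z) := by
  induction z with
  | zero => simp
  | add x y hx hy => simp only [map_add, hx, hy]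
  | tmul v x =>
    induction t with
    | zero => simp
    | add x y hx hy => simp only [map_add, mul_add, LinearMap.add_apply, hx, hy]
    | tmul t c =>
      induction t with
      | zero => simp
      | add x y hx hy =>
        simp only [map_add, LinearMap.add_apply, hx, hy, TensorProduct.add_tmul, mul_add]
      | tmul a b =>
        induction s with
        | zero => simp
        | add x y hx hy => simp only [map_add, add_mul, LinearMap.add_apply, hx, hy]
        | tmul s c' =>
          induction s with
          | zero => simp
          | add x y hx hy =>
            simp only [map_add, LinearMap.add_apply, hx, hy, TensorProduct.add_tmul, add_mul]
          | tmul a' b' => simp [HopfAlgebra.antipode_mul_antidistrib, mul_assoc, mul_smul]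

/-- The order is reversed because the action is on the right; S being antimultiplicative is what
makes the left multiplications agree. -/
theorem twist_mul (a b : A) (z : V ⊗[k] A) :
    twist (rightActHom k A V) (a * b) z =
      twist (rightActHom k A V) b (twist (rightActHom k A V) a z) := by
  have h : ∀ s t : A ⊗[k] A, (Coalgebra.comul (R := k)).rTensor A (s * t) =
      Coalgebra.comul.rTensor A s * Coalgebra.comul.rTensor A t := fun s t =>
    map_mul (Algebra.TensorProduct.map (Bialgebra.comulAlgHom k A) (AlgHom.id k A)) s t
  rw [← ydTwist_comul, ← ydTwist_comul, ← ydTwist_comul, ← ydTwist_mul, Bialgebra.comul_mul, h]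

theorem twist_one (z : V ⊗[k] A) : twist (rightActHom k A V) 1 z = z := by
  rw [← ydTwist_comul, Bialgebra.comul_one, Algebra.TensorProduct.one_def, LinearMap.rTensor_tmul,
    Bialgebra.comul_one, Algebra.TensorProduct.one_def]
  induction z with
  | zero => simp
  | add x y hx hy => simp only [map_add, hx, hy]
  | tmul v x => simp

end TwistModule

/-! ## Morphisms of Hopf algebras -/

section HopfHom

variable {k A H : Type u} [Field k] [Ring A] [HopfAlgebra k A] [Ring H] [HopfAlgebra k H]

/-- An algebra map that is compatible with comultiplication, counit and antipode. -/
structure IsHopfHom (ι : A →ₐ[k] H) : Prop where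
  map_comul : ∀ a, Coalgebra.comul (R := k) (ι a) =
    TensorProduct.map ι.toLinearMap ι.toLinearMap (Coalgebra.comul a)
  map_counit : ∀ a, Coalgebra.counit (R := k) (ι a) = Coalgebra.counit (R := k) a
  map_antipode : ∀ a, HopfAlgebra.antipode k (ι a) = ι (HopfAlgebra.antipode k a)

theorem conv_comp_hopfHom {R : Type*} [Semiring R] [Algebra k R] {ι : A →ₐ[k] H}
    (hι : IsHopfHom ι) (f g : H →ₗ[k] R) :
    conv f g ∘ₗ ι.toLinearMap = conv (f ∘ₗ ι.toLinearMap) (g ∘ₗ ι.toLinearMap) := by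
  ext a
  simp only [LinearMap.comp_apply, conv_apply, AlgHom.toLinearMap_apply, hι.map_comul]
  induction Coalgebra.comul (R := k) a with
  | zero => simp
  | add x y hx hy => simp only [map_add, hx, hy]
  | tmul x y => simp

theorem twist_map {ι : A →ₐ[k] H} (hι : IsHopfHom ι) {X Y : Type u} [AddCommGroup X] [Module k X]
    [AddCommGroup Y] [Module k Y] (f : X →ₗ[k] Y) {ρ : A →ₗ[k] Module.End k X}
    {σ : H →ₗ[k] Module.End k Y} (h : ∀ a x, f (ρ a x) = σ (ι a) (f x)) (a : A) (z : X ⊗[k] A) :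
    TensorProduct.map f ι.toLinearMap (twist ρ a z) =
      twist σ (ι a) (TensorProduct.map f ι.toLinearMap z) := by
  have key : twist σ ∘ₗ ι.toLinearMap = conv (conv (leftAntipode k H Y ∘ₗ ι.toLinearMap)
      (firstAct σ ∘ₗ ι.toLinearMap)) (rightMul k H Y ∘ₗ ι.toLinearMap) := by
    rw [twist, conv_comp_hopfHom hι, conv_comp_hopfHom hι]
  change _ = (twist σ ∘ₗ ι.toLinearMap) a _
  rw [key]
  refine conv_intertwine _ (conv_intertwine _ ?_ ?_) ?_ a z
  · intro a z
    induction z with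
    | zero => simp
    | add x y hx hy => simp only [map_add, hx, hy]
    | tmul x y => simp [hι.map_antipode]
  · intro a z
    induction z with
    | zero => simp
    | add x y hx hy => simp only [map_add, hx, hy]
    | tmul x y => simp [h]
  · intro a z
    induction z with
    | zero => simp
    | add x y hx hy => simp only [map_add, hx, hy]
    | tmul x y => simp

end HopfHom

/-! ## Comodules -/

section Comodule

variable {k A H : Type u} [Field k] [Ring A] [HopfAlgebra k A] [Ring H] [HopfAlgebra k H]
  {V W : Type u} [AddCommGroup V] [Module k V] [AddCommGroup W] [Module k W]

theorem comulSnd_rTensor (f : V →ₗ[k] W) (z : V ⊗[k] A) :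
    comulSnd k A W (f.rTensor A z) = (f.rTensor A).rTensor A (comulSnd k A V z) := by
  induction z with
  | zero => simp
  | add x y hx hy => simp only [map_add, hx, hy]
  | tmul v a =>
    rw [LinearMap.rTensor_tmul, comulSnd_tmul, comulSnd_tmul, ← LinearMap.rTensor_comp_apply]
    rfl

theorem RightComodule.rTensor_coact (c : RightComodule k A V) (v : V) :
    c.coact.rTensor A (c.coact v) = comulSnd k A V (c.coact v) := by
  have h := LinearMap.congr_fun c.coassoc v
  simp only [LinearMap.comp_apply, LinearEquiv.coe_coe] at h
  rw [comulSnd, LinearMap.comp_apply, ← h]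
  simp

theorem RightComodule.rid_coact (c : RightComodule k A V) (v : V) :
    TensorProduct.rid k V (Coalgebra.counit.lTensor V (c.coact v)) = v :=
  LinearMap.congr_fun c.counit_coact v

theorem coassoc_of_rTensor {δ : V →ₗ[k] V ⊗[k] A}
    (h : ∀ v, δ.rTensor A (δ v) = comulSnd k A V (δ v)) :
    (TensorProduct.assoc k V A A).toLinearMap ∘ₗ δ.rTensor A ∘ₗ δ =
      Coalgebra.comul.lTensor V ∘ₗ δ := by
  ext v
  simp [h, comulSnd]

/-- The comodule over `H` obtained from a comodule over `A` along a morphism `A → H`. -/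
@[reducible]
def pushComodule {ι : A →ₐ[k] H} (hι : IsHopfHom ι) (c : RightComodule k A V) :
    RightComodule k H V where
  coact := ι.toLinearMap.lTensor V ∘ₗ c.coact
  coassoc := by
    apply coassoc_of_rTensor
    intro v
    have h1 : ∀ z : V ⊗[k] A, comulSnd k H V (ι.toLinearMap.lTensor V z) =
        TensorProduct.map (ι.toLinearMap.lTensor V) ι.toLinearMap (comulSnd k A V z) := by
      intro z
      induction z with
      | zero => simp
      | add x y hx hy => simp only [map_add, hx, hy]
      | tmul v a =>
        simp only [LinearMap.lTensor_tmul, comulSnd_tmul, AlgHom.toLinearMap_apply, hι.map_comul]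
        induction Coalgebra.comul (R := k) a with
        | zero => simp
        | add x y hx hy => simp only [map_add, hx, hy]
        | tmul x y => simp
    rw [LinearMap.comp_apply, h1, ← c.rTensor_coact]
    induction c.coact v with
    | zero => simp
    | add x y hx hy => simp only [map_add, hx, hy]
    | tmul v a => simp
  counit_coact := by
    ext v
    conv_rhs => rw [LinearMap.id_apply, ← c.rid_coact v]
    simp only [LinearMap.comp_apply, LinearEquiv.coe_coe]
    induction c.coact v with
    | zero => simp
    | add x y hx hy => simp only [map_add, hx, hy]
    | tmul v a => simp [hι.map_counit]

theorem pushComodule_coact {ι : A →ₐ[k] H} (hι : IsHopfHom ι) (c : RightComodule k A V) (v : V) :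
    (pushComodule hι c).coact v = ι.toLinearMap.lTensor V (c.coact v) := rfl

end Comodule

namespace YetterDrinfeld

/-! ## Free Yetter-Drinfeld modules -/

section Free

variable {k A H : Type u} [Field k] [Ring A] [HopfAlgebra k A] [Ring H] [HopfAlgebra k H]
  {V : Type u} [AddCommGroup V] [Module k V]

theorem coact_act (X : YetterDrinfeld k A) (a : A) (v : X) :
    X.coact (MulOpposite.op a • v) = twist (rightActHom k A X) a (X.coact v) := by
  rw [← ydTwist_comul]
  exact X.compat v a

theorem op_smul_tmul (a b : A) (v : V) :
    MulOpposite.op a • (b ⊗ₜ[k] v) = (b * a) ⊗ₜ v := rfl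

theorem tmul_eq_op_smul (a : A) (v : V) :
    a ⊗ₜ[k] v = MulOpposite.op a • ((1 : A) ⊗ₜ[k] v) := by
  rw [op_smul_tmul, one_mul]

/-- The coaction `a ⊗ v ↦ a₂ ⊗ v₀ ⊗ S(a₁) v₁ a₃` on `A ⊗ V`. -/
def freeCoact (c : RightComodule k A V) : A ⊗[k] V →ₗ[k] (A ⊗[k] V) ⊗[k] A :=
  TensorProduct.lift
    (LinearMap.lcomp k _ ((TensorProduct.mk k A V 1).rTensor A ∘ₗ c.coact) ∘ₗ
      twist (rightActHom k A (A ⊗[k] V)))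

theorem freeCoact_tmul (c : RightComodule k A V) (a : A) (v : V) :
    freeCoact c (a ⊗ₜ v) = twist (rightActHom k A (A ⊗[k] V)) a
      ((TensorProduct.mk k A V 1).rTensor A (c.coact v)) := rfl

theorem freeCoact_one_tmul (c : RightComodule k A V) (v : V) :
    freeCoact c (1 ⊗ₜ v) = (TensorProduct.mk k A V 1).rTensor A (c.coact v) := by
  rw [freeCoact_tmul, twist_one]

theorem freeCoact_act (c : RightComodule k A V) (a : A) (x : A ⊗[k] V) :
    freeCoact c (MulOpposite.op a • x) =
      twist (rightActHom k A (A ⊗[k] V)) a (freeCoact c x) := by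
  induction x with
  | zero => simp
  | add x y hx hy => simp only [map_add, smul_add, hx, hy]
  | tmul b v => rw [op_smul_tmul, freeCoact_tmul, freeCoact_tmul, twist_mul]

/-- The free Yetter-Drinfeld module on a comodule. -/
def free (c : RightComodule k A V) : YetterDrinfeld k A where
  carrier := A ⊗[k] V
  comodule :=
    { coact := freeCoact c
      coassoc := by
        apply coassoc_of_rTensor
        intro x
        induction x with
        | zero => simp
        | add x y hx hy => simp only [map_add, hx, hy]
        | tmul a v =>
          -- Both sides are compatible with the action, so it is enough to treat the generators 1 ⊗
          -- v, where the coaction is that of V.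
          rw [tmul_eq_op_smul, freeCoact_act, comulSnd_twist,
            twist_natural (σ := twist (rightActHom k A (A ⊗[k] V))) (freeCoact c)
              (fun b x => freeCoact_act c b x)]
          congr 1
          rw [freeCoact_one_tmul, comulSnd_rTensor, ← c.rTensor_coact,
            ← LinearMap.rTensor_comp_apply, ← LinearMap.rTensor_comp_apply]
          congr 2
          ext v
          simp [freeCoact_one_tmul]
      counit_coact := by
        ext a v
        simp only [TensorProduct.AlgebraTensorModule.curry_apply, TensorProduct.curry_apply,
          LinearMap.coe_restrictScalars, LinearMap.comp_apply, LinearEquiv.coe_coe,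
          LinearMap.id_apply]
        rw [tmul_eq_op_smul, freeCoact_act, twist_counit, freeCoact_one_tmul, ← rid_counit,
          c.rid_coact]
        rfl }
  compat v a := by
    rw [ydTwist_comul]
    exact freeCoact_act c a v

/-- A linear map from an `A`-comodule to an `H`-comodule is colinear along `ι : A → H`. -/
def RelColinear (ι : A →ₐ[k] H) (c : RightComodule k A V) (W : YetterDrinfeld k H)
    (g : V →ₗ[k] W) : Prop :=
  ∀ v, W.coact (g v) = TensorProduct.map g ι.toLinearMap (c.coact v)

/-- The linear map `a ⊗ v ↦ g(v) · ι(a)`. -/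
def freeLin (ι : A →ₐ[k] H) {W : Type u} [AddCommGroup W] [Module k W] [Module Hᵐᵒᵖ W]
    [IsScalarTower k Hᵐᵒᵖ W] (g : V →ₗ[k] W) : A ⊗[k] V →ₗ[k] W :=
  TensorProduct.lift (LinearMap.lcomp k _ g ∘ₗ rightActHom k H W ∘ₗ ι.toLinearMap)

@[simp] theorem freeLin_tmul (ι : A →ₐ[k] H) {W : Type u} [AddCommGroup W] [Module k W]
    [Module Hᵐᵒᵖ W] [IsScalarTower k Hᵐᵒᵖ W] (g : V →ₗ[k] W) (a : A) (v : V) :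
    freeLin ι g (a ⊗ₜ v) = MulOpposite.op (ι a) • g v := rfl

theorem freeLin_act (ι : A →ₐ[k] H) {W : Type u} [AddCommGroup W] [Module k W]
    [Module Hᵐᵒᵖ W] [IsScalarTower k Hᵐᵒᵖ W] (g : V →ₗ[k] W) (a : A) (x : A ⊗[k] V) :
    freeLin ι g (MulOpposite.op a • x) = MulOpposite.op (ι a) • freeLin ι g x := by
  induction x with
  | zero => simp
  | add x y hx hy => simp only [map_add, smul_add, hx, hy]
  | tmul b v => simp [op_smul_tmul, mul_smul]

/-- On generators this is the hypothesis on g. The Yetter-Drinfeld condition in W then prescribes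
the coaction of g(v) · ι(a) by the same twist that defines `freeCoact`. -/
theorem coact_freeLin {ι : A →ₐ[k] H} (hι : IsHopfHom ι) {c : RightComodule k A V}
    {W : YetterDrinfeld k H} {g : V →ₗ[k] W} (hg : RelColinear ι c W g) (x : A ⊗[k] V) :
    W.coact (freeLin ι g x) = TensorProduct.map (freeLin ι g) ι.toLinearMap (freeCoact c x) := by
  induction x with
  | zero => simp
  | add x y hx hy => simp only [map_add, hx, hy]
  | tmul a v =>
    rw [freeLin_tmul, coact_act, hg, freeCoact_tmul,
      twist_map hι (σ := rightActHom k H W) (freeLin ι g) (fun b x => freeLin_act ι g b x)]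
    congr 1
    rw [LinearMap.rTensor, TensorProduct.map_map, LinearMap.comp_id]
    congr 2
    ext v
    simp

theorem RelColinear.push {ι : A →ₐ[k] H} (hι : IsHopfHom ι) {c : RightComodule k A V}
    {W : YetterDrinfeld k H} {g : V →ₗ[k] W} (hg : RelColinear ι c W g) :
    RelColinear (AlgHom.id k H) (pushComodule hι c) W g := by
  intro v
  rw [hg, pushComodule_coact, LinearMap.lTensor, TensorProduct.map_map, LinearMap.comp_id]
  rfl

theorem freeLin_relColinear {ι : A →ₐ[k] H} (hι : IsHopfHom ι) {c : RightComodule k A V}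
    {W : YetterDrinfeld k H} {g : V →ₗ[k] W} (hg : RelColinear ι c W g) :
    RelColinear ι (free c).comodule W (freeLin ι g) :=
  coact_freeLin hι hg

theorem relColinear_id {c : RightComodule k A V} {W : YetterDrinfeld k A} {g : V →ₗ[k] W}
    (hg : ∀ v, W.coact (g v) = g.rTensor A (c.coact v)) : RelColinear (AlgHom.id k A) c W g := hg

theorem isHopfHom_id : IsHopfHom (AlgHom.id k A) where
  map_comul _ := (LinearMap.congr_fun TensorProduct.map_id _).symm
  map_counit _ := rfl
  map_antipode _ := rfl

/-- The morphism from a free module given by a colinear map. -/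
def freeHom (c : RightComodule k A V) (W : YetterDrinfeld k A) (g : V →ₗ[k] W)
    (hg : RelColinear (AlgHom.id k A) c W g) : free c ⟶ W :=
  Hom.mk (X := free c) (freeLin (AlgHom.id k A) g) (freeLin_act (AlgHom.id k A) g)
    (freeLin_relColinear isHopfHom_id hg)

theorem freeHom_tmul (c : RightComodule k A V) (W : YetterDrinfeld k A) (g : V →ₗ[k] W)
    (hg : RelColinear (AlgHom.id k A) c W g) (a : A) (v : V) :
    (freeHom c W g hg).toLin (a ⊗ₜ[k] v) = MulOpposite.op a • g v := rfl

theorem free_hom_ext {c : RightComodule k A V} {W : YetterDrinfeld k A} {f g : free c ⟶ W}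
    (h : ∀ v : V, f.toLin ((1 : A) ⊗ₜ[k] v) = g.toLin ((1 : A) ⊗ₜ[k] v)) : f = g := by
  apply Hom.ext
  refine TensorProduct.ext' fun a v => ?_
  rw [tmul_eq_op_smul]
  exact (f.map_act a _).trans ((congrArg _ (h v)).trans (g.map_act a _).symm)

/-- The canonical morphism to `X` from the free module on the comodule underlying `X`. -/
def freeCounit (X : YetterDrinfeld k A) : free X.comodule ⟶ X :=
  freeHom X.comodule X LinearMap.id (relColinear_id fun _ => by simp)

theorem freeCounit_surjective (X : YetterDrinfeld k A) :
    Function.Surjective (freeCounit X).toLin := fun x =>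
  ⟨(1 : A) ⊗ₜ[k] x, (freeHom_tmul _ _ _ _ _ _).trans (by simp)⟩


end Free

/-! ## Induction along a morphism of Hopf algebras -/

section Induced

variable {k A H : Type u} [Field k] [Ring A] [HopfAlgebra k A] [Ring H] [HopfAlgebra k H]
  {ι : A →ₐ[k] H} (hι : IsHopfHom ι)

/-- A map from a Yetter-Drinfeld module over `A` to one over `H` that is linear and colinear
along `ι : A → H`. -/
structure RelHom (ι : A →ₐ[k] H) (X : YetterDrinfeld k A) (W : YetterDrinfeld k H) where
  toLin : X →ₗ[k] W
  map_act : ∀ (a : A) (v : X), toLin (MulOpposite.op a • v) = MulOpposite.op (ι a) • toLin v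
  map_coact : RelColinear ι X.comodule W toLin

/-- The composition with a morphism over `H`. -/
def RelHom.comp {X : YetterDrinfeld k A} {W W' : YetterDrinfeld k H} (g : RelHom ι X W)
    (f : W ⟶ W') : RelHom ι X W' where
  toLin := f.toLin ∘ₗ g.toLin
  map_act a v := by simp [g.map_act, f.map_act]
  map_coact v := by
    rw [LinearMap.comp_apply, f.map_coact, g.map_coact, LinearMap.rTensor,
      TensorProduct.map_map, LinearMap.id_comp]

/-- The composition with a morphism over `A`. -/
def RelHom.precomp {X Y : YetterDrinfeld k A} {W : YetterDrinfeld k H} (g : RelHom ι Y W)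
    (f : X ⟶ Y) : RelHom ι X W where
  toLin := g.toLin ∘ₗ f.toLin
  map_act a v := by simp [g.map_act, f.map_act]
  map_coact v := by
    rw [LinearMap.comp_apply, g.map_coact, f.map_coact, LinearMap.rTensor,
      TensorProduct.map_map, LinearMap.comp_id]

/-- The map from a free module over `A` to a Yetter-Drinfeld module over `H` given by a map that
is colinear along `ι`. -/
def relFree {V : Type u} [AddCommGroup V] [Module k V] {c : RightComodule k A V}
    {W : YetterDrinfeld k H} {g : V →ₗ[k] W} (hg : RelColinear ι c W g) :
    RelHom ι (free c) W where
  toLin := freeLin ι g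
  map_act := freeLin_act ι g
  map_coact := freeLin_relColinear hι hg

theorem relFree_tmul {V : Type u} [AddCommGroup V] [Module k V] {c : RightComodule k A V}
    {W : YetterDrinfeld k H} {g : V →ₗ[k] W} (hg : RelColinear ι c W g) (a : A) (v : V) :
    (relFree hι hg).toLin (a ⊗ₜ[k] v) = MulOpposite.op (ι a) • g v := rfl

/-- The free module over `H` on the comodule underlying a Yetter-Drinfeld module over `A`. -/
abbrev freeOver (X : YetterDrinfeld k A) : YetterDrinfeld k H :=
  free (pushComodule hι X.comodule)

/-- The linear map `v ↦ 1 ⊗ v`. -/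
def oneTmul (X : YetterDrinfeld k A) : X →ₗ[k] freeOver hι X :=
  TensorProduct.mk k H X 1

theorem oneTmul_relColinear (X : YetterDrinfeld k A) :
    RelColinear ι X.comodule (freeOver hι X) (oneTmul hι X) := by
  intro v
  refine (freeCoact_one_tmul _ v).trans ?_
  rw [pushComodule_coact, LinearMap.rTensor, LinearMap.lTensor, TensorProduct.map_map]
  rfl

/-- The linear map `a ⊗ v ↦ 1 ⊗ v · a - ι(a) ⊗ v`. -/
def relator (X : YetterDrinfeld k A) : free X.comodule →ₗ[k] freeOver hι X :=
  oneTmul hι X ∘ₗ (freeCounit X).toLin - (relFree hι (oneTmul_relColinear hι X)).toLin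

/-- Colinearity of the relations of X ⊗_A H lets them be the image of a morphism of Yetter-Drinfeld
modules, so that the quotient inherits a coaction. -/
theorem relator_relColinear (X : YetterDrinfeld k A) :
    RelColinear ι (free X.comodule).comodule (freeOver hι X) (relator hι X) := by
  intro v
  have h : ∀ (f g : free X.comodule →ₗ[k] freeOver hι X) (z : free X.comodule ⊗[k] A),
      TensorProduct.map (f - g) ι.toLinearMap z =
        TensorProduct.map f ι.toLinearMap z - TensorProduct.map g ι.toLinearMap z := by
    intro f g z
    rw [sub_eq_add_neg, TensorProduct.map_add_left, LinearMap.add_apply, ← neg_one_smul k g,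
      TensorProduct.map_smul_left, LinearMap.smul_apply, neg_one_smul, sub_eq_add_neg]
  rw [relator, h, LinearMap.sub_apply, map_sub]
  refine congrArg₂ (· - ·) ?_ ?_
  · rw [LinearMap.comp_apply, oneTmul_relColinear]
    rw [(freeCounit X).map_coact, LinearMap.rTensor,
      TensorProduct.map_map, LinearMap.comp_id]
  · exact (relFree hι (oneTmul_relColinear hι X)).map_coact v

/-- The morphism of free modules whose cokernel is the induced module. -/
def relatorHom (X : YetterDrinfeld k A) :
    freeOver hι (free X.comodule) ⟶ freeOver hι X :=
  freeHom _ _ (relator hι X) ((relator_relColinear hι X).push hι)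

/-- The Yetter-Drinfeld module `X ⊗_A H` over `H` induced by a Yetter-Drinfeld module `X`
over `A`. -/
def ind (X : YetterDrinfeld k A) : YetterDrinfeld k H :=
  coker (relatorHom hι X)

/-- The projection `h ⊗ v ↦ v ⊗ h`. -/
def indπ (X : YetterDrinfeld k A) : freeOver hι X ⟶ ind hι X :=
  cokerπ (relatorHom hι X)

theorem indπ_surjective (X : YetterDrinfeld k A) : Function.Surjective (indπ hι X).toLin :=
  cokerπ_surjective _

theorem relatorHom_tmul (X : YetterDrinfeld k A) (h : H) (a : A) (v : X) :
    (relatorHom hι X).toLin (h ⊗ₜ[k] (a ⊗ₜ[k] v : A ⊗[k] X)) =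
      (h ⊗ₜ[k] (MulOpposite.op a • v) - (ι a * h) ⊗ₜ[k] v : H ⊗[k] X) := by
  refine (freeHom_tmul _ _ _ _ _ _).trans ?_
  have h1 : relator hι X (a ⊗ₜ[k] v) = ((1 : H) ⊗ₜ[k] (MulOpposite.op a • v) -
      (ι a) ⊗ₜ[k] v : H ⊗[k] X) := by
    have h2 : MulOpposite.op (ι a) • ((1 : H) ⊗ₜ[k] v) = ι a ⊗ₜ[k] v := by
      rw [op_smul_tmul, one_mul]
    rw [← h2]
    rfl
  rw [h1]
  change MulOpposite.op h • (_ - _ : H ⊗[k] X) = _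
  rw [smul_sub, op_smul_tmul, op_smul_tmul, one_mul]

/-- The canonical map `v ↦ v ⊗ 1`. -/
def indUnit (X : YetterDrinfeld k A) : RelHom ι X (ind hι X) where
  toLin := (indπ hι X).toLin ∘ₗ oneTmul hι X
  map_act a v := by
    have h1 := congrArg (fun f => Hom.toLin f ((1 : H) ⊗ₜ[k] (a ⊗ₜ[k] v : A ⊗[k] X)))
      (comp_cokerπ (relatorHom hι X))
    have h2 : (indπ hι X).toLin ((relatorHom hι X).toLin
      ((1 : H) ⊗ₜ[k] (a ⊗ₜ[k] v : A ⊗[k] X))) = 0 := h1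
    rw [relatorHom_tmul, mul_one] at h2
    have h3 := (indπ hι X).map_act (ι a) ((1 : H) ⊗ₜ[k] v : H ⊗[k] X)
    rw [LinearMap.comp_apply, LinearMap.comp_apply]
    refine Eq.trans ?_ h3
    have h4 := (map_sub (indπ hι X).toLin ((1 : H) ⊗ₜ[k] (MulOpposite.op a • v) : H ⊗[k] X)
      (ι a ⊗ₜ[k] v : H ⊗[k] X)).symm.trans h2
    refine (sub_eq_zero.1 h4).trans (congrArg _ ?_)
    exact tmul_eq_op_smul (ι a) v
  map_coact v := by
    rw [LinearMap.comp_apply, (indπ hι X).map_coact, oneTmul_relColinear, LinearMap.rTensor,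
      TensorProduct.map_map, LinearMap.id_comp]

theorem indπ_tmul (X : YetterDrinfeld k A) (h : H) (v : X) :
    (indπ hι X).toLin (h ⊗ₜ[k] v : H ⊗[k] X) =
      MulOpposite.op h • (indUnit hι X).toLin v := by
  refine Eq.trans ?_ ((indπ hι X).map_act h ((1 : H) ⊗ₜ[k] v : H ⊗[k] X))
  exact congrArg _ (tmul_eq_op_smul h v)

variable {hι}

theorem ind_hom_ext {X : YetterDrinfeld k A} {W : YetterDrinfeld k H} {f g : ind hι X ⟶ W}
    (h : ∀ v, f.toLin ((indUnit hι X).toLin v) = g.toLin ((indUnit hι X).toLin v)) : f = g := by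
  have h1 : indπ hι X ≫ f = indπ hι X ≫ g := free_hom_ext h
  apply Hom.ext
  ext x
  obtain ⟨x, rfl⟩ := indπ_surjective hι X x
  exact congrArg (fun f => Hom.toLin f x) h1

/-- A linear map from the induced module. -/
theorem exists_indLin {X : YetterDrinfeld k A} {N : Type u} [AddCommGroup N] [Module k N]
    (L : H ⊗[k] X →ₗ[k] N)
    (hL : ∀ h a (v : X), L (h ⊗ₜ[k] (MulOpposite.op a • v)) = L ((ι a * h) ⊗ₜ[k] v)) :
    ∃ l : ind hι X →ₗ[k] N, ∀ x, l ((indπ hι X).toLin x) = L x := by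
  obtain ⟨l, hl⟩ := exists_desc (indπ hι X).toLin (indπ_surjective hι X) L (by
    intro x hx
    obtain ⟨y, rfl⟩ := mem_range_of_cokerπ (relatorHom hι X) x hx
    have h1 : L ∘ₗ (relatorHom hι X).toLin = 0 := by
      refine TensorProduct.ext' fun h y => ?_
      have h2 : L ∘ₗ (relatorHom hι X).toLin ∘ₗ TensorProduct.mk k H (free X.comodule) h = 0 := by
        refine TensorProduct.ext' fun a v => ?_
        refine (congrArg L (relatorHom_tmul hι X h a v)).trans ?_
        rw [map_sub, hL, sub_self]
        rfl
      exact LinearMap.congr_fun h2 y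
    exact LinearMap.congr_fun h1 y)
  exact ⟨l, fun x => LinearMap.congr_fun hl x⟩

theorem freeHom_eq_zero {X : YetterDrinfeld k A} {W : YetterDrinfeld k H} (g : RelHom ι X W)
    (x : freeOver hι X) (hx : (indπ hι X).toLin x = 0) :
    (freeHom _ W g.toLin (g.map_coact.push hι)).toLin x = 0 := by
  obtain ⟨l, hl⟩ := exists_indLin (hι := hι) (freeLin (AlgHom.id k H) g.toLin)
    (by intro h a v; simp [g.map_act, mul_smul])
  refine (hl x).symm.trans ?_
  rw [hx, map_zero]

/-- The morphism from the induced module given by a map over `A`. -/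
def indLift {X : YetterDrinfeld k A} {W : YetterDrinfeld k H} (g : RelHom ι X W) :
    ind hι X ⟶ W :=
  descOfSurjective (indπ hι X) (indπ_surjective hι X)
    (freeHom _ W g.toLin (g.map_coact.push hι)) (freeHom_eq_zero g)

theorem indLift_unit {X : YetterDrinfeld k A} {W : YetterDrinfeld k H} (g : RelHom ι X W) (v : X) :
    (indLift (hι := hι) g).toLin ((indUnit hι X).toLin v) = g.toLin v := by
  have h := congrArg (fun f => Hom.toLin f ((1 : H) ⊗ₜ[k] v))
    (comp_descOfSurjective (indπ hι X) (indπ_surjective hι X)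
    (freeHom _ W g.toLin (g.map_coact.push hι)) (freeHom_eq_zero g))
  refine Eq.trans h ((freeHom_tmul _ _ _ _ _ _).trans ?_)
  rw [MulOpposite.op_one, one_smul]

variable (hι) in
/-- Induction on morphisms. -/
def indMap {X Y : YetterDrinfeld k A} (f : X ⟶ Y) : ind hι X ⟶ ind hι Y :=
  indLift ((indUnit hι Y).precomp f)

theorem indMap_unit {X Y : YetterDrinfeld k A} (f : X ⟶ Y) (v : X) :
    (indMap hι f).toLin ((indUnit hι X).toLin v) = (indUnit hι Y).toLin (f.toLin v) :=
  indLift_unit _ v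

end Induced

end YetterDrinfeld

/-! ## Haar functionals and lifting of colinear maps -/

section Haar

variable {k A : Type u} [Field k] [Ring A] [HopfAlgebra k A]

/-- A normalized two-sided invariant functional on a Hopf algebra. -/
structure IsHaar (h : A →ₗ[k] k) : Prop where
  map_one : h 1 = 1
  apply_snd : ∀ a, TensorProduct.rid k A (h.lTensor A (Coalgebra.comul a)) = h a • (1 : A)
  apply_fst : ∀ a, TensorProduct.lid k A (h.rTensor A (Coalgebra.comul a)) = h a • (1 : A)

/-- The functional `y ↦ h(y S(g))`. -/
def antipodeShift (h : A →ₗ[k] k) (g : A) : A →ₗ[k] k :=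
  h ∘ₗ LinearMap.mulRight k (HopfAlgebra.antipode k g)

@[simp] theorem antipodeShift_apply (h : A →ₗ[k] k) (g y : A) :
    antipodeShift h g y = h (y * HopfAlgebra.antipode k g) := rfl

/-- The invariance `y₁ h(y₂ S(g)) = h(y S(g₁)) g₂`. -/
theorem IsHaar.antipodeShift_comul {h : A →ₗ[k] k} (hh : IsHaar h) (y g : A) :
    TensorProduct.rid k A ((antipodeShift h g).lTensor A (Coalgebra.comul y)) =
      TensorProduct.lid k A ((h ∘ₗ LinearMap.mulLeft k y ∘ₗ HopfAlgebra.antipode k).rTensor A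
        (Coalgebra.comul g)) := by
  let J : A ⊗[k] A →ₗ[k] A := (TensorProduct.rid k A).toLinearMap ∘ₗ h.lTensor A
  have hJ : ∀ z (c : A), J z * c = J (z * (c ⊗ₜ 1)) := by
    intro z c
    induction z with
    | zero => simp
    | add x y hx hy => simp only [map_add, add_mul, hx, hy]
    | tmul x y => simp [J]
  -- Here F(g) = y₁ h(y₂ S(g)) and p(g) = h(y S(g)) 1. Invariance of h at y S(g) reads F(g₁) S(g₂) =
  -- p(g); convolving with the identity on the right removes S.
  let F : A →ₗ[k] A := J ∘ₗ LinearMap.mulLeft k (Coalgebra.comul y) ∘ₗ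
    (Algebra.TensorProduct.includeRight : A →ₐ[k] A ⊗[k] A).toLinearMap ∘ₗ HopfAlgebra.antipode k
  let p : A →ₗ[k] A := LinearMap.toSpanSingleton k A 1 ∘ₗ h ∘ₗ LinearMap.mulLeft k y ∘ₗ
    HopfAlgebra.antipode k
  have h1 : conv F (HopfAlgebra.antipode k) = p := by
    ext g
    have h2 : p g = J (Coalgebra.comul y * Coalgebra.comul (HopfAlgebra.antipode k g)) := by
      rw [← Bialgebra.comul_mul]
      exact (hh.apply_snd _).symm
    rw [h2, ← LinearMap.comp_apply (Coalgebra.comul (R := k)) (HopfAlgebra.antipode k) g,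
      comul_antipode, conv_apply, conv_apply]
    induction Coalgebra.comul (R := k) g with
    | zero => simp
    | add x y hx hy => simp only [map_add, mul_add, hx, hy]
    | tmul a b => simp [F, hJ, mul_assoc]
  have h3 : F = conv p LinearMap.id := by
    rw [← h1, conv_assoc, conv_antipode_id, conv_convUnit]
  have h4 : TensorProduct.rid k A ((antipodeShift h g).lTensor A (Coalgebra.comul y)) = F g := by
    simp only [F, LinearMap.comp_apply, J, LinearEquiv.coe_coe, LinearMap.mulLeft_apply]
    induction Coalgebra.comul (R := k) y with
    | zero => simp
    | add x y hx hy => simp only [map_add, add_mul, hx, hy]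
    | tmul a b => simp
  rw [h4, h3, conv_apply]
  induction Coalgebra.comul (R := k) g with
  | zero => simp
  | add x y hx hy => simp only [map_add, hx, hy]
  | tmul a b => simp [p]

variable {V W W' : Type u} [AddCommGroup V] [Module k V] [AddCommGroup W] [Module k W]
  [AddCommGroup W'] [Module k W']

/-- The linear map `v ⊗ g ↦ f(v)₀ h(f(v)₁ S(g))`. -/
def avgPair (h : A →ₗ[k] k) (d : RightComodule k A W) (f : V →ₗ[k] W) : V ⊗[k] A →ₗ[k] W :=
  (TensorProduct.rid k W).toLinearMap ∘ₗ h.lTensor W ∘ₗ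
    TensorProduct.lift ((rightMul k A W ∘ₗ HopfAlgebra.antipode k).flip ∘ₗ d.coact ∘ₗ f)

theorem avgPair_tmul (h : A →ₗ[k] k) (d : RightComodule k A W) (f : V →ₗ[k] W) (v : V) (g : A) :
    avgPair h d f (v ⊗ₜ g) =
      TensorProduct.rid k W ((antipodeShift h g).lTensor W (d.coact (f v))) := by
  rw [antipodeShift, LinearMap.lTensor_comp]
  rfl

theorem RightComodule.coact_rid (d : RightComodule k A W) (q : A →ₗ[k] k) (w : W) :
    d.coact (TensorProduct.rid k W (q.lTensor W (d.coact w))) =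
      ((TensorProduct.rid k A).toLinearMap ∘ₗ q.lTensor A ∘ₗ Coalgebra.comul).lTensor W
        (d.coact w) := by
  have h1 : ∀ z : W ⊗[k] A, d.coact (TensorProduct.rid k W (q.lTensor W z)) =
      TensorProduct.rid k (W ⊗[k] A) (q.lTensor (W ⊗[k] A) (d.coact.rTensor A z)) := by
    intro z
    induction z with
    | zero => simp
    | add x y hx hy => simp only [map_add, hx, hy]
    | tmul x y => simp
  rw [h1, d.rTensor_coact]
  induction d.coact w with
  | zero => simp
  | add x y hx hy => simp only [map_add, hx, hy]
  | tmul x y =>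
    simp only [comulSnd_tmul, LinearMap.lTensor_tmul, LinearMap.comp_apply, LinearEquiv.coe_coe]
    induction Coalgebra.comul (R := k) y with
    | zero => simp
    | add x y hx hy => simp only [map_add, hx, hy, TensorProduct.tmul_add]
    | tmul a b => simp

/-- With V ⊗ A coacted on through its second factor, averaging is colinear for any linear f. The
coaction of W produces y₁ h(y₂ S(g)), and `IsHaar.antipodeShift_comul` moves the coproduct from y to
g. -/
theorem IsHaar.coact_avgPair {h : A →ₗ[k] k} (hh : IsHaar h) (d : RightComodule k A W)
    (f : V →ₗ[k] W) (z : V ⊗[k] A) :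
    d.coact (avgPair h d f z) = (avgPair h d f).rTensor A (comulSnd k A V z) := by
  induction z with
  | zero => simp
  | add x y hx hy => simp only [map_add, hx, hy]
  | tmul v g =>
    rw [avgPair_tmul, d.coact_rid, comulSnd_tmul, ← LinearMap.rTensor_comp_apply]
    have h1 : (TensorProduct.rid k A).toLinearMap ∘ₗ (antipodeShift h g).lTensor A ∘ₗ
        Coalgebra.comul = (TensorProduct.lid k A).toLinearMap ∘ₗ
          LinearMap.flip ((LinearMap.rTensorHom A) ∘ₗ (LinearMap.llcomp k A A k h) ∘ₗ
            (LinearMap.lcomp k A (HopfAlgebra.antipode k)) ∘ₗ LinearMap.mul k A)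
            (Coalgebra.comul g) := by
      ext y
      exact hh.antipodeShift_comul y g
    rw [h1]
    have h2 : ∀ a, (avgPair h d f ∘ₗ TensorProduct.mk k V A v) a =
        TensorProduct.rid k W ((antipodeShift h a).lTensor W (d.coact (f v))) :=
      fun a => avgPair_tmul h d f v a
    induction Coalgebra.comul (R := k) g with
    | zero => simp
    | add x y hx hy =>
      simp only [map_add, LinearMap.comp_add, LinearMap.lTensor_add, LinearMap.add_apply, hx, hy]
    | tmul a b =>
      rw [LinearMap.rTensor_tmul, h2]
      induction d.coact (f v) with
      | zero => simp
      | add x y hx hy => simp only [map_add, TensorProduct.add_tmul, hx, hy]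
      | tmul x y => simp [TensorProduct.smul_tmul]

/-- Over a Hopf algebra with a Haar functional, colinear maps lift along colinear surjections. -/
theorem IsHaar.exists_colinear_lift {h : A →ₗ[k] k} (hh : IsHaar h) (c : RightComodule k A V)
    (d : RightComodule k A W) (d' : RightComodule k A W') (p : W →ₗ[k] W')
    (hp : Function.Surjective p) (hpc : ∀ w, d'.coact (p w) = p.rTensor A (d.coact w))
    (g : V →ₗ[k] W') (hg : ∀ v, d'.coact (g v) = g.rTensor A (c.coact v)) :
    ∃ f : V →ₗ[k] W, (∀ v, d.coact (f v) = f.rTensor A (c.coact v)) ∧ p ∘ₗ f = g := by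
  -- A linear lift exists over a field; its average v ↦ f(v₀)₀ h(f(v₀)₁ S(v₁)) is colinear.
  obtain ⟨f, hf⟩ := Module.projective_lifting_property p g hp
  refine ⟨avgPair h d f ∘ₗ c.coact, fun v => ?_, ?_⟩
  · rw [LinearMap.comp_apply, hh.coact_avgPair, ← c.rTensor_coact,
      LinearMap.rTensor_comp_apply]
  -- Since p and g = p ∘ f are colinear, p applied to the average of f is g applied to the average
  -- of the identity. The latter is the identity, as v₀ h(v₁ S(v₂)) = v h(1) = v.
  · have h1 : p ∘ₗ avgPair h d f = g ∘ₗ avgPair h c LinearMap.id := by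
      refine TensorProduct.ext' fun v a => ?_
      have h2 : ∀ {X Y : Type u} [AddCommGroup X] [Module k X] [AddCommGroup Y] [Module k Y]
          (t : X →ₗ[k] Y) (q : A →ₗ[k] k) (z : X ⊗[k] A),
          t (TensorProduct.rid k X (q.lTensor X z)) =
            TensorProduct.rid k Y (q.lTensor Y (t.rTensor A z)) := by
        intro X Y _ _ _ _ t q z
        induction z with
        | zero => simp
        | add x y hx hy => simp only [map_add, hx, hy]
        | tmul x y => simp
      rw [LinearMap.comp_apply, LinearMap.comp_apply, avgPair_tmul, avgPair_tmul, h2, h2, ← hpc,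
        ← LinearMap.comp_apply p f, hf, hg, LinearMap.id_apply]
    rw [← LinearMap.comp_assoc, h1]
    ext v
    let R : (V ⊗[k] A) ⊗[k] A →ₗ[k] V := (TensorProduct.rid k V).toLinearMap ∘ₗ h.lTensor V ∘ₗ
      TensorProduct.lift (rightMul k A V ∘ₗ HopfAlgebra.antipode k).flip
    have h3 : ∀ z, avgPair h c LinearMap.id z = R (c.coact.rTensor A z) := by
      intro z
      induction z with
      | zero => simp
      | add x y hx hy => simp only [map_add, hx, hy]
      | tmul x y => rfl
    have h4 : ∀ z, R (comulSnd k A V z) =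
        TensorProduct.rid k V (Coalgebra.counit.lTensor V z) := by
      intro z
      induction z with
      | zero => simp
      | add x y hx hy => simp only [map_add, hx, hy]
      | tmul x y =>
        have h5 : R ∘ₗ (TensorProduct.mk k V A x).rTensor A =
            LinearMap.toSpanSingleton k V x ∘ₗ h ∘ₗ LinearMap.mul' k A ∘ₗ
              (HopfAlgebra.antipode k).lTensor A := by
          refine TensorProduct.ext' fun a b => ?_
          simp [R]
        rw [comulSnd_tmul, ← LinearMap.comp_apply R, h5]
        simp only [LinearMap.comp_apply, HopfAlgebra.mul_antipode_lTensor_comul_apply,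
          Algebra.algebraMap_eq_smul_one, map_smul, hh.map_one]
        simp
    rw [LinearMap.comp_apply, LinearMap.comp_apply, h3, c.rTensor_coact, h4, c.rid_coact]

end Haar

namespace YetterDrinfeld

/-! ### Projectivity of free modules and of modules induced from projectives. -/

section Projective

variable {k A H : Type u} [Field k] [Ring A] [HopfAlgebra k A] [Ring H] [HopfAlgebra k H]

theorem mono_of_injective {X Y : YetterDrinfeld k A} (f : X ⟶ Y)
    (hf : Function.Injective f.toLin) : Mono f :=
  ⟨fun _ _ e => hom_ext fun v => hf (congrArg (fun t => Hom.toLin t v) e)⟩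

theorem epi_of_surjective {X Y : YetterDrinfeld k A} (f : X ⟶ Y)
    (hf : Function.Surjective f.toLin) : Epi f :=
  ⟨fun _ _ e => hom_ext fun v => by
    obtain ⟨v, rfl⟩ := hf v
    exact congrArg (fun t => Hom.toLin t v) e⟩

/-- Morphisms from the free module on V are colinear maps from V, and these lift along surjections
by Haar averaging. -/
theorem projective_free {h : A →ₗ[k] k} (hh : IsHaar h) {V : Type u} [AddCommGroup V]
    [Module k V] (c : RightComodule k A V) : Projective (free c) := by
  refine ⟨fun {W W'} g p _ => ?_⟩
  let u : V →ₗ[k] free c := TensorProduct.mk k A V 1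
  have hu : ∀ v, (free c).coact (u v) = u.rTensor A (c.coact v) := freeCoact_one_tmul c
  obtain ⟨f, hf, hpf⟩ := hh.exists_colinear_lift c W.comodule W'.comodule p.toLin
    (surjective_of_epi p) p.map_coact (g.toLin ∘ₗ u) (fun v => by
      rw [LinearMap.comp_apply, g.map_coact, hu, LinearMap.rTensor_comp_apply])
  refine ⟨freeHom c W f hf, free_hom_ext fun v => ?_⟩
  refine (congrArg p.toLin (freeHom_tmul c W f hf 1 v)).trans ?_
  rw [MulOpposite.op_one, one_smul]
  exact LinearMap.congr_fun hpf v

/-- Morphisms out of this module correspond to H-colinear maps from V with its coaction pushed to H,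
so the averaging takes place over H. -/
theorem projective_ind_free {ι : A →ₐ[k] H} (hι : IsHopfHom ι) {h : H →ₗ[k] k} (hh : IsHaar h)
    {V : Type u} [AddCommGroup V] [Module k V] (c : RightComodule k A V) :
    Projective (ind hι (free c)) := by
  refine ⟨fun {W W'} g p _ => ?_⟩
  let u : V →ₗ[k] free c := TensorProduct.mk k A V 1
  have hu : ∀ v, (free c).coact (u v) = u.rTensor A (c.coact v) := freeCoact_one_tmul c
  let w := (indUnit hι (free c)).comp g
  have hw : RelColinear ι c W' (w.toLin ∘ₗ u) := by
    intro v
    rw [LinearMap.comp_apply, w.map_coact, hu, LinearMap.rTensor, TensorProduct.map_map,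
      LinearMap.comp_id]
  obtain ⟨f, hf, hpf⟩ := hh.exists_colinear_lift (pushComodule hι c) W.comodule W'.comodule p.toLin
    (surjective_of_epi p) p.map_coact (w.toLin ∘ₗ u) (hw.push hι)
  have hf' : RelColinear ι c W f := by
    intro v
    refine (hf v).trans ?_
    rw [pushComodule_coact, LinearMap.lTensor, LinearMap.rTensor, TensorProduct.map_map]
    rfl
  refine ⟨indLift (relFree hι hf'), ind_hom_ext fun x => ?_⟩
  rw [comp_toLin, indLift_unit]
  have h1 : p.toLin ∘ₗ (relFree hι hf').toLin = w.toLin := by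
    refine TensorProduct.ext' fun a v => ?_
    refine (congrArg p.toLin (relFree_tmul hι hf' a v)).trans ?_
    rw [p.map_act, ← LinearMap.comp_apply, hpf, LinearMap.comp_apply, ← w.map_act]
    exact congrArg w.toLin (tmul_eq_op_smul a v).symm
  exact LinearMap.congr_fun h1 x

/-- Every Yetter-Drinfeld module is a quotient of a free one. -/
theorem epi_freeCounit (X : YetterDrinfeld k A) : Epi (freeCounit X) :=
  epi_of_surjective _ (freeCounit_surjective X)

/-- A projective is a retract of a free module, and induction respects retracts. -/
theorem projective_ind {ι : A →ₐ[k] H} (hι : IsHopfHom ι) {h : H →ₗ[k] k} (hh : IsHaar h)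
    (X : YetterDrinfeld k A) [Projective X] : Projective (ind hι X) := by
  have := epi_freeCounit X
  have := projective_ind_free hι hh X.comodule
  let s : X ⟶ free X.comodule := Projective.factorThru (𝟙 X) (freeCounit X)
  have hs : s ≫ freeCounit X = 𝟙 X := Projective.factorThru_comp _ _
  let r : Retract (ind hι X) (ind hι (free X.comodule)) :=
    { i := indMap hι s
      r := indMap hι (freeCounit X)
      retract := ind_hom_ext fun v => by
        rw [comp_toLin, indMap_unit, indMap_unit, ← comp_toLin, hs, id_toLin, id_toLin] }
  exact r.projective

end Projective

end YetterDrinfeld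

/-! ### Expectations: bilinear and bicolinear retractions H → A. -/

section Expectation

variable {k A H : Type u} [Field k] [Ring A] [HopfAlgebra k A] [Ring H] [HopfAlgebra k H]

/-- A bilinear and bicolinear retraction of a morphism of Hopf algebras. -/
structure IsExpectation (ι : A →ₐ[k] H) (E : H →ₗ[k] A) : Prop where
  apply_map : ∀ a, E (ι a) = a
  map_mul : ∀ a h, E (ι a * h) = a * E h
  mul_map : ∀ a h, E (h * ι a) = E h * a
  comul_fst : ∀ h, E.rTensor H (Coalgebra.comul h) =
    ι.toLinearMap.lTensor A (Coalgebra.comul (E h))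
  comul_snd : ∀ h, E.lTensor H (Coalgebra.comul h) =
    ι.toLinearMap.rTensor A (Coalgebra.comul (E h))

theorem IsExpectation.isHaar_comp {ι : A →ₐ[k] H} {E : H →ₗ[k] A} (hE : IsExpectation ι E)
    {h : A →ₗ[k] k} (hh : IsHaar h) : IsHaar (h ∘ₗ E) where
  map_one := by
    rw [LinearMap.comp_apply, ← map_one ι, hE.apply_map, hh.map_one]
  apply_snd a := by
    have h1 : ∀ z : A ⊗[k] A, TensorProduct.rid k H (h.lTensor H (ι.toLinearMap.rTensor A z)) =
        ι (TensorProduct.rid k A (h.lTensor A z)) := by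
      intro z
      induction z with
      | zero => simp
      | add x y hx hy => simp only [map_add, hx, hy]
      | tmul x y => simp
    rw [LinearMap.lTensor_comp_apply, hE.comul_snd, h1, hh.apply_snd]
    simp
  apply_fst a := by
    have h1 : ∀ z : A ⊗[k] A, TensorProduct.lid k H (h.rTensor H (ι.toLinearMap.lTensor A z)) =
        ι (TensorProduct.lid k A (h.rTensor A z)) := by
      intro z
      induction z with
      | zero => simp
      | add x y hx hy => simp only [map_add, hx, hy]
      | tmul x y => simp
    rw [LinearMap.rTensor_comp_apply, hE.comul_fst, h1, hh.apply_fst]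
    simp

end Expectation

namespace YetterDrinfeld

/-! ### The retraction of an induced module onto the original one. -/

section Retraction

variable {k A H : Type u} [Field k] [Ring A] [HopfAlgebra k A] [Ring H] [HopfAlgebra k H]
  {ι : A →ₐ[k] H} (hι : IsHopfHom ι) {E : H →ₗ[k] A} (hE : IsExpectation ι E)

/-- The linear map `h ⊗ v ↦ v · E(h)`. -/
def retractLin (E : H →ₗ[k] A) (V : YetterDrinfeld k A) : H ⊗[k] V →ₗ[k] V :=
  TensorProduct.lift (rightActHom k A V ∘ₗ E)

@[simp] theorem retractLin_tmul (E : H →ₗ[k] A) (V : YetterDrinfeld k A) (h : H) (v : V) :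
    retractLin E V (h ⊗ₜ v) = MulOpposite.op (E h) • v := rfl

include hE in
theorem exists_indRetract (V : YetterDrinfeld k A) :
    ∃ l : ind hι V →ₗ[k] V, ∀ x, l ((indπ hι V).toLin x) = retractLin E V x :=
  exists_indLin _ fun h a v => by
    rw [retractLin_tmul, retractLin_tmul, hE.map_mul, MulOpposite.op_mul, mul_smul]

/-- The map `v ⊗ h ↦ v · E(h)` on an induced module. -/
def indRetract (V : YetterDrinfeld k A) : ind hι V →ₗ[k] V :=
  (exists_indRetract hι hE V).choose

theorem indRetract_π (V : YetterDrinfeld k A) (x : H ⊗[k] V) :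
    indRetract hι hE V ((indπ hι V).toLin x) = retractLin E V x :=
  (exists_indRetract hι hE V).choose_spec x

theorem indRetract_unit (V : YetterDrinfeld k A) (v : V) :
    indRetract hι hE V ((indUnit hι V).toLin v) = v := by
  refine (indRetract_π hι hE V ((1 : H) ⊗ₜ[k] v)).trans ?_
  rw [retractLin_tmul, ← map_one ι, hE.apply_map, MulOpposite.op_one, one_smul]

theorem indRetract_act (V : YetterDrinfeld k A) (a : A) (x : ind hι V) :
    indRetract hι hE V (MulOpposite.op (ι a) • x) =
      MulOpposite.op a • indRetract hι hE V x := by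
  obtain ⟨x, rfl⟩ := indπ_surjective hι V x
  rw [← (indπ hι V).map_act]
  have h1 : ∀ x : H ⊗[k] V, retractLin E V (MulOpposite.op (ι a) • x) =
      MulOpposite.op a • retractLin E V x := by
    intro x
    induction x with
    | zero => simp
    | add x y hx hy => simp only [map_add, smul_add, hx, hy]
    | tmul h v =>
      rw [op_smul_tmul, retractLin_tmul, retractLin_tmul, hE.mul_map, MulOpposite.op_mul, mul_smul]
  exact (indRetract_π hι hE V (MulOpposite.op (ι a) • x : H ⊗[k] V)).trans
    ((h1 x).trans (congrArg _ (indRetract_π hι hE V x).symm))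

theorem indRetract_map {V W : YetterDrinfeld k A} (p : V ⟶ W) (x : ind hι V) :
    indRetract hι hE W ((indMap hι p).toLin x) = p.toLin (indRetract hι hE V x) := by
  obtain ⟨x, rfl⟩ := indπ_surjective hι V x
  have h1 : indRetract hι hE W ∘ₗ (indMap hι p).toLin ∘ₗ (indπ hι V).toLin =
      p.toLin ∘ₗ indRetract hι hE V ∘ₗ (indπ hι V).toLin := by
    refine TensorProduct.ext' fun h v => ?_
    have h2 := indπ_tmul hι V h v
    have h3 : ∀ (U : YetterDrinfeld k A) (u : U),
        indRetract hι hE U (MulOpposite.op h • (indUnit hι U).toLin u) =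
          MulOpposite.op (E h) • u := fun U u =>
      (congrArg _ (indπ_tmul hι U h u).symm).trans (indRetract_π hι hE U _)
    refine (congrArg (fun t => indRetract hι hE W ((indMap hι p).toLin t)) h2).trans
      (Eq.trans ?_ (congrArg (fun t => p.toLin (indRetract hι hE V t)) h2).symm)
    rw [Hom.map_act, indMap_unit, h3, h3, p.map_act]
  exact LinearMap.congr_fun h1 x

-- The coaction of h ⊗ v carries S(h₁) and h₃ in H, while only E(h₂) acts on V. The two colinearity
-- conditions on E pull E out of the middle, leaving S(a₁), a₂, a₃ with a = E(h).
include hE in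
theorem retractLin_coact (V : YetterDrinfeld k A) (x : H ⊗[k] V) :
    ι.toLinearMap.lTensor V (V.coact (retractLin E V x)) =
      (retractLin E V).rTensor H (freeCoact (pushComodule hι V.comodule) x) := by
  induction x with
  | zero => simp
  | add x y hx hy => simp only [map_add, hx, hy]
  | tmul h v =>
    have h1 : ∀ z : V ⊗[k] A, (retractLin E V).rTensor H (twist (rightActHom k H (H ⊗[k] V)) h
        ((TensorProduct.mk k H V 1).rTensor H (ι.toLinearMap.lTensor V z))) =
        conv (conv (leftAntipode k H V) (firstAct (rightActHom k A V ∘ₗ E)))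
          (rightMul k H V) h (ι.toLinearMap.lTensor V z) := by
      intro z
      induction z with
      | zero => simp
      | add x y hx hy => simp only [map_add, hx, hy]
      | tmul v a =>
        rw [twist, conv_apply, conv_apply]
        induction Coalgebra.comul (R := k) h with
        | zero => simp
        | add x y hx hy => simp only [map_add, LinearMap.add_apply, hx, hy]
        | tmul x y =>
          simp only [TensorProduct.map_tmul, LinearMap.mul'_apply, conv_apply]
          induction Coalgebra.comul (R := k) x with
          | zero => simp
          | add x y hx hy => simp only [map_add, add_mul, LinearMap.add_apply, hx, hy]
          | tmul b c => simp [op_smul_tmul]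
    have h2 : conv (conv (leftAntipode k H V) (firstAct (rightActHom k A V ∘ₗ E)))
          (rightMul k H V) = conv (conv (leftAntipode k H V ∘ₗ ι.toLinearMap)
            (firstAct (rightActHom k A V))) (rightMul k H V ∘ₗ ι.toLinearMap) ∘ₗ E := by
      have h3 : firstAct (A := H) (rightActHom k A V ∘ₗ E) =
        firstAct (rightActHom k A V) ∘ₗ E := rfl
      rw [h3, conv_comp_right _ _ E ι.toLinearMap hE.comul_snd,
        conv_comp_left _ _ E ι.toLinearMap hE.comul_fst]
    rw [retractLin_tmul, coact_act, freeCoact_tmul, pushComodule_coact, h1, h2,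
      LinearMap.comp_apply]
    refine conv_intertwine _ (conv_intertwine _ ?_ ?_) ?_ _ _
    · intro a z
      induction z with
      | zero => simp
      | add x y hx hy => simp only [map_add, hx, hy]
      | tmul x y => simp [hι.map_antipode]
    · intro a z
      induction z with
      | zero => simp
      | add x y hx hy => simp only [map_add, hx, hy]
      | tmul x y => simp
    · intro a z
      induction z with
      | zero => simp
      | add x y hx hy => simp only [map_add, hx, hy]
      | tmul x y => simp

theorem indRetract_coact (V : YetterDrinfeld k A) (x : ind hι V) :
    ι.toLinearMap.lTensor V (V.coact (indRetract hι hE V x)) =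
      (indRetract hι hE V).rTensor H ((ind hι V).coact x) := by
  obtain ⟨x, rfl⟩ := indπ_surjective hι V x
  have hπ : indRetract hι hE V ∘ₗ (indπ hι V).toLin = retractLin E V :=
    LinearMap.ext fun x => indRetract_π hι hE V x
  rw [(indπ hι V).map_coact, ← LinearMap.rTensor_comp_apply, hπ]
  exact (congrArg (ι.toLinearMap.lTensor V ∘ₗ V.coact) (indRetract_π hι hE V x)).trans
    (retractLin_coact hι hE V x)

/-- The morphism over `A` underlying a morphism of induced modules. -/
def underlying {X V : YetterDrinfeld k A} (f : ind hι X ⟶ ind hι V) : X ⟶ V where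
  toLin := indRetract hι hE V ∘ₗ f.toLin ∘ₗ (indUnit hι X).toLin
  map_act a v := by
    simp only [LinearMap.comp_apply]
    rw [(indUnit hι X).map_act, f.map_act, indRetract_act]
  map_coact v := by
    -- The retraction is colinear only after V ⊗ A is embedded in V ⊗ H; since E splits ι, nothing
    -- is lost there.
    have hinj : Function.Injective (ι.toLinearMap.lTensor V) := by
      have h1 : E.lTensor V ∘ₗ ι.toLinearMap.lTensor V = LinearMap.id := by
        refine TensorProduct.ext' fun v a => ?_
        simp [hE.apply_map]
      exact Function.LeftInverse.injective (LinearMap.congr_fun h1)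
    apply hinj
    have h2 := ((indUnit hι X).comp f).map_coact v
    simp only [LinearMap.comp_apply]
    rw [indRetract_coact]
    refine (congrArg _ h2).trans ?_
    rw [LinearMap.rTensor, LinearMap.lTensor, LinearMap.rTensor, TensorProduct.map_map,
      TensorProduct.map_map]
    rfl

end Retraction

/-! ### Projective dimension under induction. -/

section Dimension

variable {k A H : Type u} [Field k] [Ring A] [HopfAlgebra k A] [Ring H] [HopfAlgebra k H]
  {ι : A →ₐ[k] H} (hι : IsHopfHom ι) {E : H →ₗ[k] A}

/-- A map from the target of a surjective morphism, linear and colinear along `ι`. -/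
theorem exists_relHom_desc {X Y : YetterDrinfeld k A} {W : YetterDrinfeld k H} (p : X ⟶ Y)
    (hp : Function.Surjective p.toLin) (g : RelHom ι X W)
    (h : ∀ x, p.toLin x = 0 → g.toLin x = 0) :
    ∃ t : RelHom ι Y W, ∀ x, t.toLin (p.toLin x) = g.toLin x := by
  obtain ⟨l, hl⟩ := exists_desc p.toLin hp g.toLin h
  have hl' : ∀ x, l (p.toLin x) = g.toLin x := LinearMap.congr_fun hl
  refine ⟨⟨l, fun a v => ?_, fun v => ?_⟩, hl'⟩
  · obtain ⟨v, rfl⟩ := hp v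
    rw [← p.map_act, hl', hl', g.map_act]
  · obtain ⟨v, rfl⟩ := hp v
    rw [hl', p.map_coact, g.map_coact, LinearMap.rTensor, TensorProduct.map_map, hl,
      LinearMap.comp_id]

/-- A surjective morphism and its kernel form a short exact sequence. -/
theorem ker_shortExact {X Y : YetterDrinfeld k A} (p : X ⟶ Y) (hp : Function.Surjective p.toLin) :
    (ShortComplex.mk (kerι p) p (kerι_comp p)).ShortExact :=
  ShortComplex.ShortExact.mk' (ShortComplex.exact_of_f_is_kernel _
    (isLimitOfInjective _ (kerι_injective _) _ (kerι_comp _) (mem_range_kerι _)))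
    (mono_of_injective _ (kerι_injective _)) (epi_of_surjective p hp)

theorem epi_indMap {X Y : YetterDrinfeld k A} (p : X ⟶ Y) (hp : Function.Surjective p.toLin) :
    Epi (indMap hι p) := by
  refine ⟨fun a b e => ind_hom_ext fun w => ?_⟩
  obtain ⟨v, rfl⟩ := hp w
  rw [← indMap_unit, ← comp_toLin, e, comp_toLin]

/-- To lift f through p, lift the induced morphism, restrict it to X and retract the induced module
onto V. Naturality of the retraction shows that the result lifts f. -/
theorem projective_of_ind (hE : IsExpectation ι E) (X : YetterDrinfeld k A)
    [Projective (ind hι X)] : Projective X := by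
  refine ⟨fun {V W} f p _ => ?_⟩
  have := epi_indMap hι p (surjective_of_epi p)
  let g : ind hι X ⟶ ind hι V := Projective.factorThru (indMap hι f) (indMap hι p)
  have hg : g ≫ indMap hι p = indMap hι f := Projective.factorThru_comp _ _
  refine ⟨underlying hι hE g, hom_ext fun x => ?_⟩
  rw [comp_toLin]
  change p.toLin (indRetract hι hE V (g.toLin ((indUnit hι X).toLin x))) = _
  rw [← indRetract_map, ← comp_toLin, hg, indMap_unit, indRetract_unit]

/-- Induction preserves short exact sequences, provided it preserves injectivity. -/
theorem ind_shortExact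
    (hinj : ∀ {X Y : YetterDrinfeld k A} (f : X ⟶ Y), Function.Injective f.toLin →
      Function.Injective (indMap hι f).toLin)
    {X Y : YetterDrinfeld k A} (p : X ⟶ Y) (hp : Function.Surjective p.toLin) :
    ∃ w, (ShortComplex.mk (indMap hι (kerι p)) (indMap hι p) w).ShortExact := by
  have w : indMap hι (kerι p) ≫ indMap hι p = 0 := ind_hom_ext fun v => by
    rw [comp_toLin, indMap_unit, indMap_unit, ← comp_toLin, kerι_comp, zero_toLin, zero_toLin,
      map_zero]
  have := epi_indMap hι p hp
  -- Right exactness from the universal property: restrict g to X, where it kills the kernel of p,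
  -- descend to Y, and extend again to the induced module.
  have hdesc : ∀ {W : YetterDrinfeld k H} (g : ind hι X ⟶ W), indMap hι (kerι p) ≫ g = 0 →
      ∃ t : ind hι Y ⟶ W, indMap hι p ≫ t = g := by
    intro W g hg
    obtain ⟨t, ht⟩ := exists_relHom_desc p hp ((indUnit hι X).comp g) (by
      intro x hx
      obtain ⟨z, rfl⟩ := mem_range_kerι p x hx
      change g.toLin ((indUnit hι X).toLin _) = 0
      rw [← indMap_unit, ← comp_toLin, hg, zero_toLin])
    refine ⟨indLift t, ind_hom_ext fun v => ?_⟩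
    rw [comp_toLin, indMap_unit, indLift_unit, ht]
    rfl
  refine ⟨w, ShortComplex.ShortExact.mk' ?_ (mono_of_injective _ (hinj _ (kerι_injective p))) this⟩
  exact ShortComplex.exact_of_g_is_cokernel _ (Limits.CokernelCofork.IsColimit.ofπ _ w
    (fun g hg => (hdesc g hg).choose) (fun g hg => (hdesc g hg).choose_spec)
    (fun g hg m hm => by
      rw [← cancel_epi (indMap hι p), hm, (hdesc g hg).choose_spec]))

/-- Induction preserves projective dimensions. -/
theorem hasProjectiveDimensionLT_ind_iff (hE : IsExpectation ι E) {h : A →ₗ[k] k} (hh : IsHaar h)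
    (hinj : ∀ {X Y : YetterDrinfeld k A} (f : X ⟶ Y), Function.Injective f.toLin →
      Function.Injective (indMap hι f).toLin) (n : ℕ) (X : YetterDrinfeld k A) :
    HasProjectiveDimensionLT (ind hι X) n ↔ HasProjectiveDimensionLT X n := by
  match n with
  | 0 =>
    -- Dimension below 0 means being zero, which the retraction detects.
    rw [hasProjectiveDimensionLT_zero_iff_isZero, hasProjectiveDimensionLT_zero_iff_isZero,
      Limits.IsZero.iff_id_eq_zero, Limits.IsZero.iff_id_eq_zero]
    refine ⟨fun h => hom_ext fun v => ?_, fun h => ind_hom_ext fun v => ?_⟩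
    · have h1 := congrArg (fun t => indRetract hι hE X (Hom.toLin t ((indUnit hι X).toLin v))) h
      simpa [indRetract_unit] using h1
    · have h1 := congrArg (fun t => (indUnit hι X).toLin (Hom.toLin t v)) h
      simpa using h1
  | 1 =>
    rw [← projective_iff_hasProjectiveDimensionLT_one, ← projective_iff_hasProjectiveDimensionLT_one]
    exact ⟨fun _ => projective_of_ind hι hE X, fun _ => projective_ind hι (hE.isHaar_comp hh) X⟩
  | n + 2 =>
    -- Dimension shifting along the free cover of X and along its induced sequence, whose middle
    -- terms are both projective. The shift starts at bound 2 because at bound 1 it fails: a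
    -- quotient of a projective by a nonzero projective may be projective.
    have hS := ker_shortExact (freeCounit X) (freeCounit_surjective X)
    obtain ⟨w, hS'⟩ := ind_shortExact hι hinj (freeCounit X) (freeCounit_surjective X)
    have hP : Projective (free X.comodule) := projective_free hh _
    have hP' : Projective (ind hι (free X.comodule)) := projective_ind hι (hE.isHaar_comp hh) _
    exact (hS'.hasProjectiveDimensionLT_X₃_iff n hP').trans
      ((hasProjectiveDimensionLT_ind_iff hE hh hinj (n + 1) _).trans
        (hS.hasProjectiveDimensionLT_X₃_iff n hP).symm)

end Dimension

end YetterDrinfeld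

/-! ### The Haar functional of a cosemisimple Hopf algebra. -/

section Cosemisimple

variable {k A : Type u} [Field k] [Ring A] [HopfAlgebra k A]

variable (k A) in
/-- The regular comodule. -/
@[reducible]
def regularComodule : RightComodule k A A where
  coact := Coalgebra.comul
  coassoc := Coalgebra.coassoc
  counit_coact := by ext a; simp

/-- A functional `h` with `h(a₁) a₂ = h(a) 1`. -/
def IsRightInvariant (h : A →ₗ[k] k) : Prop :=
  ∀ a, TensorProduct.lid k A (h.rTensor A (Coalgebra.comul a)) = h a • (1 : A)

theorem IsRightInvariant.rTensor_comul {h : A →ₗ[k] k} (hh : IsRightInvariant h) (a : A) :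
    h.rTensor A (Coalgebra.comul a) = h a ⊗ₜ[k] (1 : A) := by
  apply (TensorProduct.lid k A).injective
  rw [hh, TensorProduct.lid_tmul]

/-- The functional is the projection to k1 along a complementary subcomodule W of the regular
comodule: Δ(W) lies in W ⊗ A, so both sides of invariance vanish on W. -/
theorem exists_rightInvariant (hA : IsCosemisimple k A) :
    ∃ h : A →ₗ[k] k, h 1 = 1 ∧ IsRightInvariant h := by
  let := regularComodule k A
  obtain ⟨W, hW, hc⟩ := hA A (Submodule.span k {(1 : A)}) (by
    intro w hw
    obtain ⟨c, rfl⟩ := Submodule.mem_span_singleton.1 hw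
    refine ⟨⟨c • 1, hw⟩ ⊗ₜ 1, ?_⟩
    change _ = Coalgebra.comul (R := k) (c • (1 : A))
    rw [map_smul, Bialgebra.comul_one, Algebra.TensorProduct.one_def]
    simp [TensorProduct.smul_tmul'])
  have hd : ∀ a : A, ∃ (c : k) (w : A), w ∈ W ∧ a = c • 1 + w := by
    intro a
    have : a ∈ Submodule.span k {(1 : A)} ⊔ W := by rw [hc.sup_eq_top]; trivial
    obtain ⟨x, hx, w, hw, rfl⟩ := Submodule.mem_sup.1 this
    obtain ⟨c, rfl⟩ := Submodule.mem_span_singleton.1 hx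
    exact ⟨c, w, hw, rfl⟩
  have h1W : (1 : A) ∉ W := by
    intro h1
    have h0 : (1 : A) = 0 := Submodule.disjoint_def.1 hc.disjoint 1
      (Submodule.mem_span_singleton_self 1) h1
    have h2 := Bialgebra.counit_one (R := k) (A := A)
    rw [h0, map_zero] at h2
    exact zero_ne_one h2
  obtain ⟨h, h1, hW0⟩ : ∃ h : A →ₗ[k] k, h 1 = 1 ∧ ∀ w ∈ W, h w = 0 := by
    obtain ⟨f, hf1, hf⟩ := Submodule.exists_le_ker_of_notMem h1W
    refine ⟨(f 1)⁻¹ • f, ?_, fun w hw => ?_⟩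
    · simp [inv_mul_cancel₀ hf1]
    · have : f w = 0 := hf hw
      simp [this]
  refine ⟨h, h1, fun a => ?_⟩
  obtain ⟨c, w, hw, rfl⟩ := hd a
  obtain ⟨t, ht⟩ := hW w hw
  have h3 : h.rTensor A (Coalgebra.comul (R := k) w) = 0 := by
    rw [show Coalgebra.comul (R := k) w = _ from ht.symm, ← LinearMap.rTensor_comp_apply,
      show h ∘ₗ W.subtype = 0 from LinearMap.ext fun x => hW0 x x.2]
    simp
  rw [map_add, map_add, h3, map_smul, map_smul, Bialgebra.comul_one,
    Algebra.TensorProduct.one_def, map_add h, hW0 w hw]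
  simp [h1]

/-- Invariance makes ker f a subcomodule; f is injective on a complementary subcomodule D. For d in
D, invariance forces Δ(d) = d ⊗ 1, hence d = ε(d)1 and f(d) = ε(d) f(1) = 0. So D = 0. -/
theorem rightInvariant_unique (hA : IsCosemisimple k A) {f : A →ₗ[k] k} (hf : IsRightInvariant f)
    (h1 : f 1 = 0) : f = 0 := by
  let := regularComodule k A
  by_contra hne
  have hex : Function.Exact (LinearMap.ker f).subtype f := by
    intro x
    exact ⟨fun hx => ⟨⟨x, hx⟩, rfl⟩, by rintro ⟨x, rfl⟩; exact x.2⟩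
  obtain ⟨x, hx⟩ : ∃ x, f x ≠ 0 := by
    by_contra! h
    exact hne (LinearMap.ext h)
  have hfs : Function.Surjective f := by
    intro c
    exact ⟨(c * (f x)⁻¹) • x, by simp [hx]⟩
  obtain ⟨D, hD, hc⟩ := hA A (LinearMap.ker f) (by
    intro w hw
    refine (Module.Flat.rTensor_exact A hex _).1 ?_
    change f.rTensor A (Coalgebra.comul (R := k) w) = 0
    rw [hf.rTensor_comul, show f w = 0 from hw, TensorProduct.zero_tmul])
  obtain ⟨d, hd, hfd⟩ : ∃ d ∈ D, f d ≠ 0 := by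
    have : x ∈ LinearMap.ker f ⊔ D := by rw [hc.sup_eq_top]; trivial
    obtain ⟨y, hy, d, hd, rfl⟩ := Submodule.mem_sup.1 this
    refine ⟨d, hd, ?_⟩
    rwa [map_add, show f y = 0 from hy, zero_add] at hx
  obtain ⟨t, ht⟩ := hD d hd
  have hinj : Function.Injective (f ∘ₗ D.subtype) := by
    rw [injective_iff_map_eq_zero]
    intro y hy
    exact Subtype.ext (Submodule.disjoint_def.1 hc.disjoint y hy y.2)
  have h2 : t = ⟨d, hd⟩ ⊗ₜ (1 : A) := by
    apply Module.Flat.rTensor_preserves_injective_linearMap (M := A) _ hinj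
    rw [LinearMap.rTensor_comp_apply, ht, LinearMap.rTensor_tmul]
    exact hf.rTensor_comul d
  have h3 := Coalgebra.rTensor_counit_comul (R := k) d
  rw [show Coalgebra.comul (R := k) d = _ from ht.symm, h2] at h3
  have h4 := congrArg (TensorProduct.lid k A) h3
  simp only [LinearMap.rTensor_tmul, Submodule.subtype_apply, TensorProduct.lid_tmul,
    one_smul] at h4
  apply hfd
  rw [← h4, map_smul, h1, smul_zero]

/-- A cosemisimple Hopf algebra has a Haar functional. -/
theorem exists_isHaar (hA : IsCosemisimple k A) : ∃ h : A →ₗ[k] k, IsHaar h := by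
  obtain ⟨h, h1, hh⟩ := exists_rightInvariant hA
  refine ⟨h, h1, fun a => ?_, hh⟩
  rw [← sub_eq_zero, ← Module.forall_dual_apply_eq_zero_iff k]
  intro α
  -- The functional g(a) = α(a₁) h(a₂) is again right invariant, so g = g(1) h by uniqueness. As α
  -- is arbitrary, this is the invariance of h on the other side.
  let g : A →ₗ[k] k := α ∘ₗ (TensorProduct.rid k A).toLinearMap ∘ₗ h.lTensor A ∘ₗ Coalgebra.comul
  have hg1 : g 1 = α 1 := by
    simp [g, Algebra.TensorProduct.one_def, h1]
  let Q : A ⊗[k] (A ⊗[k] A) →ₗ[k] A :=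
    (TensorProduct.lid k A).toLinearMap ∘ₗ TensorProduct.map α
      ((TensorProduct.lid k A).toLinearMap ∘ₗ h.rTensor A)
  have hg : IsRightInvariant g := by
    intro a
    have h2 : ∀ z : A ⊗[k] A, TensorProduct.lid k A (g.rTensor A z) =
        Q (TensorProduct.assoc k A A A (Coalgebra.comul.rTensor A z)) := by
      intro z
      induction z with
      | zero => simp
      | add x y hx hy => simp only [map_add, hx, hy]
      | tmul x y =>
        simp only [LinearMap.rTensor_tmul, g, LinearMap.comp_apply]
        induction Coalgebra.comul (R := k) x with
        | zero => simp
        | add x y hx hy => simp only [map_add, TensorProduct.add_tmul, hx, hy]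
        | tmul a b => simp [Q, smul_smul]
    have h3 : ∀ z : A ⊗[k] A, Q (Coalgebra.comul.lTensor A z) =
        α (TensorProduct.rid k A (h.lTensor A z)) • (1 : A) := by
      intro z
      induction z with
      | zero => simp
      | add x y hx hy => simp only [map_add, hx, hy, add_smul]
      | tmul x y =>
        simp only [Q, LinearMap.lTensor_tmul, LinearMap.comp_apply, TensorProduct.map_tmul,
          LinearEquiv.coe_coe, hh y]
        simp [smul_smul]
    rw [h2, Coalgebra.coassoc_apply, h3]
    rfl
  have h5 : g - g 1 • h = 0 := by
    apply rightInvariant_unique hA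
    · intro a
      rw [LinearMap.rTensor_sub, LinearMap.rTensor_smul, LinearMap.sub_apply, LinearMap.smul_apply,
        map_sub, map_smul, hg, hh]
      simp [sub_smul, mul_smul]
    · simp [h1]
  have h6 := LinearMap.congr_fun h5 a
  simp only [LinearMap.sub_apply, LinearMap.smul_apply, LinearMap.zero_apply, hg1,
    smul_eq_mul] at h6
  rw [map_sub, map_smul, smul_eq_mul, mul_comm (h a)]
  exact h6

end Cosemisimple

/-! ## Free products -/

section FreeProd

variable {k A B H : Type u} [Field k] [Ring A] [HopfAlgebra k A] [Ring B] [HopfAlgebra k B]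
  [Ring H] [HopfAlgebra k H]

/-- `H` is the free product of the algebras `A` and `B`. -/
structure IsFreeProd (ιA : A →ₐ[k] H) (ιB : B →ₐ[k] H) : Prop where
  exists_lift : ∀ {R : Type u} [Ring R] [Algebra k R] (f : A →ₐ[k] R) (g : B →ₐ[k] R),
    ∃ φ : H →ₐ[k] R, (∀ a, φ (ιA a) = f a) ∧ ∀ b, φ (ιB b) = g b
  generates : ∀ S : Subalgebra k H, (∀ a, ιA a ∈ S) → (∀ b, ιB b ∈ S) → ∀ x, x ∈ S

theorem IsFreeProd.symm {ιA : A →ₐ[k] H} {ιB : B →ₐ[k] H} (h : IsFreeProd ιA ιB) :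
    IsFreeProd ιB ιA where
  exists_lift f g := by
    obtain ⟨φ, h1, h2⟩ := h.exists_lift g f
    exact ⟨φ, h2, h1⟩
  generates S h1 h2 := h.generates S h2 h1

/-- A right action, as a map to the opposite of the endomorphisms, from its defining laws. -/
def actionHom {R N : Type u} [Ring R] [Algebra k R] [AddCommGroup N] [Module k N]
    (ρ : R →ₗ[k] Module.End k N) (h1 : ∀ n, ρ 1 n = n)
    (hmul : ∀ a b n, ρ (a * b) n = ρ b (ρ a n)) : R →ₐ[k] (Module.End k N)ᵐᵒᵖ :=
  AlgHom.ofLinearMap ((MulOpposite.opLinearEquiv k).toLinearMap ∘ₗ ρ)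
    (congrArg MulOpposite.op (LinearMap.ext h1))
    (fun a b => congrArg MulOpposite.op (LinearMap.ext (hmul a b)))

/-- Two actions of the factors extend to an action of the free product. -/
theorem IsFreeProd.exists_action {ιA : A →ₐ[k] H} {ιB : B →ₐ[k] H} (h : IsFreeProd ιA ιB)
    {N : Type u} [AddCommGroup N] [Module k N]
    (ρ : A →ₗ[k] Module.End k N) (h1 : ∀ n, ρ 1 n = n) (hmul : ∀ a b n, ρ (a * b) n = ρ b (ρ a n))
    (σ : B →ₗ[k] Module.End k N) (g1 : ∀ n, σ 1 n = n)
    (gmul : ∀ a b n, σ (a * b) n = σ b (σ a n)) :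
    ∃ τ : H →ₗ[k] Module.End k N, (∀ n, τ 1 n = n) ∧ (∀ x y n, τ (x * y) n = τ y (τ x n)) ∧
      (∀ a, τ (ιA a) = ρ a) ∧ ∀ b, τ (ιB b) = σ b := by
  obtain ⟨φ, hφA, hφB⟩ := h.exists_lift (actionHom ρ h1 hmul) (actionHom σ g1 gmul)
  refine ⟨(MulOpposite.opLinearEquiv k).symm.toLinearMap ∘ₗ φ.toLinearMap, fun n => ?_,
    fun x y n => ?_, fun a => ?_, fun b => ?_⟩
  · simp
  · simp
  · exact congrArg MulOpposite.unop (hφA a)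
  · exact congrArg MulOpposite.unop (hφB b)

open YetterDrinfeld

/-- Induction from a factor of a free product preserves injectivity. -/
theorem IsFreeProd.indMap_injective {ιA : A →ₐ[k] H} {ιB : B →ₐ[k] H} (h : IsFreeProd ιA ιB)
    (hι : IsHopfHom ιA) {X Y : YetterDrinfeld k A} (f : X ⟶ Y) (hf : Function.Injective f.toLin) :
    Function.Injective (indMap hι f).toLin := by
  obtain ⟨r, hr⟩ := LinearMap.exists_leftInverse_of_injective f.toLin (LinearMap.ker_eq_bot.2 hf)
  -- W embeds by j : w ↦ (a ↦ w · a) in the coinduced space Hom(A, W), split by evaluation at 1. The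
  -- plan is to make Hom(A, W) an H-module with j linear and to extend j to a map on the module
  -- induced by Y.
  let W := ind hι X
  let j : W →ₗ[k] (A →ₗ[k] W) := (rightActHom k H W ∘ₗ ιA.toLinearMap).flip
  have hj : ∀ w a, j w a = MulOpposite.op (ιA a) • w := fun _ _ => rfl
  have hj1 : ∀ w, j w 1 = w := by intro w; simp [hj]
  let ev : (A →ₗ[k] W) →ₗ[k] W := LinearMap.applyₗ 1
  have hev : ∀ F, ev F = F 1 := fun _ => rfl
  let ρ : A →ₗ[k] Module.End k (A →ₗ[k] W) :=
    LinearMap.flip (LinearMap.llcomp k A A W) ∘ₗ LinearMap.mul k A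
  have hρ : ∀ a F x, ρ a F x = F (a * x) := fun _ _ _ => rfl
  -- B acts on the image of j as on W, and through the counit on the complement, the kernel of
  -- evaluation. Freeness of the product means that no compatibility with the action of A is needed.
  let σ : B →ₗ[k] Module.End k (A →ₗ[k] W) :=
    (LinearMap.llcomp k _ _ _ j) ∘ₗ (LinearMap.lcomp k _ ev) ∘ₗ
      (rightActHom k H W ∘ₗ ιB.toLinearMap) +
    (LinearMap.toSpanSingleton k _ (LinearMap.id - j ∘ₗ ev)) ∘ₗ Coalgebra.counit
  have hσ : ∀ b F, σ b F = j (MulOpposite.op (ιB b) • F 1) +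
      Coalgebra.counit (R := k) b • (F - j (F 1)) := fun _ _ => rfl
  obtain ⟨τ, hτ1, hτm, hτA, hτB⟩ := h.exists_action ρ (by intro F; ext x; simp [hρ])
    (by intro a b F; ext x; simp [hρ, mul_assoc]) σ
    (by intro F; simp [hσ])
    (by intro a b F; simp [hσ, hj1, mul_smul]; exact smul_comm _ _ _)
  have hτj : ∀ x w, τ x (j w) = j (MulOpposite.op x • w) := by
    let S : Subalgebra k H :=
      { carrier := {x | ∀ w, τ x (j w) = j (MulOpposite.op x • w)}
        mul_mem' := by
          intro x y hx hy w
          rw [hτm, hx, hy, MulOpposite.op_mul, mul_smul]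
        add_mem' := by
          intro x y hx hy w
          rw [map_add, LinearMap.add_apply, hx, hy, MulOpposite.op_add, add_smul, map_add]
        algebraMap_mem' := by
          intro c w
          rw [Algebra.algebraMap_eq_smul_one, map_smul, LinearMap.smul_apply, hτ1,
            MulOpposite.op_smul, smul_assoc, MulOpposite.op_one, one_smul, map_smul] }
    refine fun x => h.generates S ?_ ?_ x
    · intro a w
      rw [hτA]
      ext x
      simp [hρ, hj, mul_smul]
    · intro b w
      rw [hτB, hσ, hj1, sub_self, smul_zero, add_zero]
  -- The linear retraction r of f need not be A-linear, but y ↦ (a ↦ r(y · a) ⊗ 1) is, and it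
  -- restricts to j on X.
  let g : Y →ₗ[k] (A →ₗ[k] W) :=
    LinearMap.flip ((LinearMap.llcomp k _ _ _ ((indUnit hι X).toLin ∘ₗ r)) ∘ₗ rightActHom k A Y)
  have hg : ∀ y a, g y a = (indUnit hι X).toLin (r (MulOpposite.op a • y)) := fun _ _ => rfl
  let L : H ⊗[k] Y →ₗ[k] (A →ₗ[k] W) := TensorProduct.lift (LinearMap.lcomp k _ g ∘ₗ τ)
  have hL : ∀ x y, L (x ⊗ₜ y) = τ x (g y) := fun _ _ => rfl
  obtain ⟨l, hl⟩ := exists_indLin (hι := hι) L (by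
    intro x a v
    rw [hL, hL, hτm, hτA]
    congr 1
    ext y
    simp [hρ, hg, mul_smul])
  have hgf : ∀ v, g (f.toLin v) = j ((indUnit hι X).toLin v) := by
    intro v
    ext a
    rw [hg, hj, ← (indUnit hι X).map_act, ← f.map_act, ← LinearMap.comp_apply r, hr]
    rfl
  -- Both sides are H-linear and agree on X; since j is injective, so is the induced map.
  have key : ∀ w, l ((indMap hι f).toLin w) = j w := by
    intro w
    obtain ⟨x, rfl⟩ := indπ_surjective hι X w
    have h1 : l ∘ₗ (indMap hι f).toLin ∘ₗ (indπ hι X).toLin = j ∘ₗ (indπ hι X).toLin := by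
      refine TensorProduct.ext' fun x v => ?_
      have h2 := indπ_tmul hι X x v
      have h3 := (congrArg l (indπ_tmul hι Y x (f.toLin v))).symm.trans (hl _)
      refine (congrArg (fun t => l ((indMap hι f).toLin t)) h2).trans
        (Eq.trans ?_ (congrArg j h2).symm)
      rw [Hom.map_act, indMap_unit, h3, hL, hgf, hτj]
    exact LinearMap.congr_fun h1 x
  have hinj : Function.Injective (l ∘ₗ (indMap hι f).toLin) := by
    rw [show l ∘ₗ (indMap hι f).toLin = j from LinearMap.ext key]
    exact Function.LeftInverse.injective (g := ev) hj1
  exact Function.Injective.of_comp hinj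

end FreeProd

/-! ### The splitting A = k1 ⊕ ker h. -/

section HaarProj

variable {k A : Type u} [Field k] [Ring A] [HopfAlgebra k A]

/-- The projection `a ↦ a - h(a) 1` to the kernel of a normalized functional. -/
def haarProj (h : A →ₗ[k] k) : A →ₗ[k] A :=
  LinearMap.id - LinearMap.toSpanSingleton k A 1 ∘ₗ h

theorem haarProj_apply (h : A →ₗ[k] k) (a : A) : haarProj h a = a - h a • (1 : A) := rfl

theorem haarProj_add (h : A →ₗ[k] k) (a : A) : a = haarProj h a + h a • (1 : A) := by
  rw [haarProj_apply, sub_add_cancel]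

theorem IsHaar.apply_haarProj {h : A →ₗ[k] k} (hh : IsHaar h) (a : A) : h (haarProj h a) = 0 := by
  simp [haarProj_apply, hh.map_one]

theorem IsHaar.haarProj_haarProj {h : A →ₗ[k] k} (hh : IsHaar h) (a : A) :
    haarProj h (haarProj h a) = haarProj h a := by
  rw [haarProj_apply h (haarProj h a), hh.apply_haarProj, zero_smul, sub_zero]

/-- Two-sided invariance lets the projection cross Δ in either tensor factor, and it is idempotent.
Thus ker h is a subcoalgebra, which keeps coproducts of reduced words reduced. -/
theorem IsHaar.comul_haarProj {h : A →ₗ[k] k} (hh : IsHaar h) (a : A) :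
    Coalgebra.comul (R := k) (haarProj h a) =
      TensorProduct.map (haarProj h) (haarProj h) (Coalgebra.comul a) := by
  have h1 : ∀ z : A ⊗[k] A, (haarProj h).rTensor A z =
      z - (1 : A) ⊗ₜ TensorProduct.lid k A (h.rTensor A z) := by
    intro z
    induction z with
    | zero => simp
    | add x y hx hy => simp only [map_add, hx, hy, TensorProduct.tmul_add]; abel
    | tmul x y => simp [haarProj_apply, TensorProduct.sub_tmul, TensorProduct.smul_tmul]
  have h2 : ∀ z : A ⊗[k] A, (haarProj h).lTensor A z =
      z - TensorProduct.rid k A (h.lTensor A z) ⊗ₜ (1 : A) := by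
    intro z
    induction z with
    | zero => simp
    | add x y hx hy => simp only [map_add, hx, hy, TensorProduct.add_tmul]; abel
    | tmul x y => simp [haarProj_apply, TensorProduct.tmul_sub, TensorProduct.smul_tmul']
  have h3 : ∀ a, (haarProj h).rTensor A (Coalgebra.comul a) =
      Coalgebra.comul (R := k) (haarProj h a) := by
    intro a
    rw [h1, hh.apply_fst, haarProj_apply, map_sub, map_smul, Bialgebra.comul_one,
      Algebra.TensorProduct.one_def, TensorProduct.tmul_smul]
  have h4 : ∀ a, (haarProj h).lTensor A (Coalgebra.comul a) =
      Coalgebra.comul (R := k) (haarProj h a) := by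
    intro a
    rw [h2, hh.apply_snd, haarProj_apply, map_sub, map_smul, Bialgebra.comul_one,
      Algebra.TensorProduct.one_def, TensorProduct.smul_tmul']
  have h5 : TensorProduct.map (haarProj h) (haarProj h) =
      (haarProj h).rTensor A ∘ₗ (haarProj h).lTensor A := by
    ext; simp
  rw [h5, LinearMap.comp_apply, h4, h3, hh.haarProj_haarProj]

/-- The projection to the kernel of a normalized functional. -/
def haarKer {h : A →ₗ[k] k} (hh : IsHaar h) : A →ₗ[k] LinearMap.ker h :=
  (haarProj h).codRestrict _ hh.apply_haarProj

theorem coe_haarKer {h : A →ₗ[k] k} (hh : IsHaar h) (a : A) :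
    (haarKer hh a : A) = haarProj h a := rfl

/-- The decomposition `Z ⊗ A = Z ⊕ Z ⊗ ker h`. -/
def splitEquiv {h : A →ₗ[k] k} (hh : IsHaar h) (Z : Type u) [AddCommGroup Z] [Module k Z] :
    Z ⊗[k] A ≃ₗ[k] Z × (Z ⊗[k] LinearMap.ker h) :=
  LinearEquiv.ofLinearMap
    (((TensorProduct.rid k Z).toLinearMap ∘ₗ h.lTensor Z).prod ((haarKer hh).lTensor Z))
    (((TensorProduct.mk k Z A).flip 1).coprod ((LinearMap.ker h).subtype.lTensor Z))
    (by
      apply LinearMap.prod_ext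
      · refine LinearMap.ext fun z => ?_
        have : haarKer hh 1 = 0 := by
          apply Subtype.ext
          simp [coe_haarKer, haarProj_apply, hh.map_one]
        simp [hh.map_one, this]
      · refine TensorProduct.ext' fun z a => ?_
        have h1 : haarKer hh (a : A) = a := by
          apply Subtype.ext
          rw [coe_haarKer, haarProj_apply, show h a = 0 from a.2, zero_smul, sub_zero]
        simp [h1])
    (by
      refine TensorProduct.ext' fun z a => ?_
      simp [coe_haarKer, haarProj_apply, TensorProduct.tmul_sub])

theorem splitEquiv_tmul {h : A →ₗ[k] k} (hh : IsHaar h) (Z : Type u) [AddCommGroup Z]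
    [Module k Z] (z : Z) (a : A) :
    splitEquiv hh Z (z ⊗ₜ a) = (h a • z, z ⊗ₜ haarKer hh a) := by
  simp [splitEquiv]

end HaarProj

/-- There is a vector space `T` with `T ≅ k ⊕ T ⊗ X`. -/
theorem exists_equiv_prod_tensor (k X : Type u) [Field k] [AddCommGroup X] [Module k X] :
    ∃ (T : Type u) (_ : AddCommGroup T) (_ : Module k T), Nonempty (T ≃ₗ[k] k × (T ⊗[k] X)) := by
  let b := Module.Basis.ofVectorSpace k X
  let J := Module.Basis.ofVectorSpaceIndex k X
  -- T is the tensor algebra of X, with basis the words in a basis of X; a word is empty or a letter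
  -- followed by a word.
  let T := List J →₀ k
  let bT : Module.Basis (List J) k T := Finsupp.basisSingleOne
  let e : List J ≃ Unit ⊕ (List J × J) :=
    { toFun := fun l => match l with
        | [] => Sum.inl ()
        | a :: l => Sum.inr (l, a)
      invFun := fun s => match s with
        | Sum.inl _ => []
        | Sum.inr (l, a) => a :: l
      left_inv := fun l => by cases l <;> rfl
      right_inv := fun s => by rcases s with _ | ⟨l, a⟩ <;> rfl }
  exact ⟨T, inferInstance, inferInstance,
    ⟨bT.equiv ((Module.Basis.singleton Unit k).prod (bT.tensorProduct b)) e⟩⟩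

/-! ### Reduced words and the expectation of the free product on a factor. -/

section Expectation

variable {k A B H : Type u} [Field k] [Ring A] [HopfAlgebra k A] [Ring B] [HopfAlgebra k B]
  [Ring H] [HopfAlgebra k H] {ιA : A →ₐ[k] H} {ιB : B →ₐ[k] H} {hA : A →ₗ[k] k} {hB : B →ₗ[k] k}

/-- The products `a₀ b₁ a₁ b₂ ⋯ bₙ` with `n ≥ 1`, where the inner factors lie in the kernels of
the given functionals. -/
inductive IsWord (ιA : A →ₐ[k] H) (ιB : B →ₐ[k] H) (hA : A →ₗ[k] k) (hB : B →ₗ[k] k) : H → Prop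
  | base (a : A) (b : B) : IsWord ιA ιB hA hB (ιA a * ιB (haarProj hB b))
  | step (w : H) (a : A) (b : B) : IsWord ιA ιB hA hB w →
      IsWord ιA ιB hA hB (w * ιA (haarProj hA a) * ιB (haarProj hB b))

/-- The span of the reduced words with at least one letter from `B`. -/
def wordSpan (ιA : A →ₐ[k] H) (ιB : B →ₐ[k] H) (hA : A →ₗ[k] k) (hB : B →ₗ[k] k) :
    Submodule k H :=
  Submodule.span k {x | ∃ w a, IsWord ιA ιB hA hB w ∧ x = w * ιA a}

theorem word_mul_mem {w : H} (hw : IsWord ιA ιB hA hB w) (a : A) :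
    w * ιA a ∈ wordSpan ιA ιB hA hB :=
  Submodule.subset_span ⟨w, a, hw, rfl⟩

theorem word_mem {w : H} (hw : IsWord ιA ιB hA hB w) : w ∈ wordSpan ιA ιB hA hB := by
  have := word_mul_mem hw 1
  rwa [map_one, mul_one] at this

theorem wordSpan_mul {x : H} (hx : x ∈ wordSpan ιA ιB hA hB) (a : A) :
    x * ιA a ∈ wordSpan ιA ιB hA hB := by
  induction hx using Submodule.span_induction with
  | mem x hx =>
    obtain ⟨w, b, hw, rfl⟩ := hx
    rw [mul_assoc, ← map_mul]
    exact word_mul_mem hw _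
  | zero => simp
  | add x y _ _ hx hy => rw [add_mul]; exact add_mem hx hy
  | smul c x _ hx => rw [smul_mul_assoc]; exact Submodule.smul_mem _ c hx

theorem mul_word {w : H} (hw : IsWord ιA ιB hA hB w) (a : A) : IsWord ιA ιB hA hB (ιA a * w) := by
  induction hw with
  | base a' b => rw [← mul_assoc, ← map_mul]; exact .base _ _
  | step w a' b _ ih => rw [← mul_assoc, ← mul_assoc]; exact .step _ _ _ ih

theorem mul_wordSpan {x : H} (hx : x ∈ wordSpan ιA ιB hA hB) (a : A) :
    ιA a * x ∈ wordSpan ιA ιB hA hB := by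
  induction hx using Submodule.span_induction with
  | mem x hx =>
    obtain ⟨w, b, hw, rfl⟩ := hx
    rw [← mul_assoc]
    exact word_mul_mem (mul_word hw a) _
  | zero => simp
  | add x y _ _ hx hy => rw [mul_add]; exact add_mem hx hy
  | smul c x _ hx => rw [mul_smul_comm]; exact Submodule.smul_mem _ c hx

/-- The free product is spanned by the first factor and the reduced words. -/
theorem IsFreeProd.exists_add_word (h : IsFreeProd ιA ιB) (hA : A →ₗ[k] k) (hB : B →ₗ[k] k)
    (x : H) : ∃ a, ∃ m ∈ wordSpan ιA ιB hA hB, x = ιA a + m := by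
  -- T contains 1 and is stable under right multiplication by both factors, hence by H; so T = H.
  let T : Submodule k H := LinearMap.range ιA.toLinearMap ⊔ wordSpan ιA ιB hA hB
  have hT : ∀ a, ιA a ∈ T := fun a => Submodule.mem_sup_left ⟨a, rfl⟩
  have hM : ∀ m ∈ wordSpan ιA ιB hA hB, m ∈ T := fun m hm => Submodule.mem_sup_right hm
  have hTA : ∀ y ∈ T, ∀ a, y * ιA a ∈ T := by
    intro y hy a
    obtain ⟨_, ⟨b, rfl⟩, m, hm, rfl⟩ := Submodule.mem_sup.1 hy
    rw [add_mul]
    refine add_mem ?_ (hM _ (wordSpan_mul hm a))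
    rw [AlgHom.toLinearMap_apply, ← map_mul]
    exact hT _
  have h1 : ∀ a b, ιA a * ιB b ∈ T := by
    intro a b
    rw [haarProj_add hB b, map_add, mul_add, map_smul, map_one, mul_smul_comm, mul_one]
    exact add_mem (hM _ (word_mem (.base a b))) (Submodule.smul_mem _ _ (hT a))
  have h2 : ∀ w a b, IsWord ιA ιB hA hB w → w * ιA (haarProj hA a) * ιB b ∈ T := by
    intro w a b hw
    rw [haarProj_add hB b, map_add, mul_add, map_smul, map_one, mul_smul_comm, mul_one]
    exact add_mem (hM _ (word_mem (.step w a b hw)))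
      (Submodule.smul_mem _ _ (hM _ (word_mul_mem hw _)))
  -- The word ends in a letter of B, which merges with b; the merged letter is split again into its
  -- projection and a scalar.
  have h3 : ∀ w b, IsWord ιA ιB hA hB w → w * ιB b ∈ T := by
    intro w b hw
    cases hw with
    | base a' b' => rw [mul_assoc, ← map_mul]; exact h1 _ _
    | step w a' b' hw => rw [mul_assoc, ← map_mul]; exact h2 _ _ _ hw
  have hMB : ∀ m ∈ wordSpan ιA ιB hA hB, ∀ b, m * ιB b ∈ T := by
    intro m hm b
    induction hm using Submodule.span_induction with
    | mem x hx =>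
      obtain ⟨w, a, hw, rfl⟩ := hx
      rw [haarProj_add hA a, map_add, mul_add, map_smul, map_one, mul_smul_comm, mul_one, add_mul,
        smul_mul_assoc]
      exact add_mem (h2 w a b hw) (Submodule.smul_mem _ _ (h3 w b hw))
    | zero => simp
    | add x y _ _ hx hy => rw [add_mul]; exact add_mem hx hy
    | smul c x _ hx => rw [smul_mul_assoc]; exact Submodule.smul_mem _ c hx
  have hTB : ∀ y ∈ T, ∀ b, y * ιB b ∈ T := by
    intro y hy b
    obtain ⟨_, ⟨a, rfl⟩, m, hm, rfl⟩ := Submodule.mem_sup.1 hy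
    rw [add_mul]
    exact add_mem (h1 a b) (hMB m hm b)
  let S : Subalgebra k H :=
    { carrier := {x | ∀ y ∈ T, y * x ∈ T}
      mul_mem' := by
        intro x x' hx hx' y hy
        rw [← mul_assoc]
        exact hx' _ (hx _ hy)
      add_mem' := by
        intro x x' hx hx' y hy
        rw [mul_add]
        exact add_mem (hx _ hy) (hx' _ hy)
      algebraMap_mem' := by
        intro c y hy
        rw [Algebra.algebraMap_eq_smul_one, mul_smul_comm, mul_one]
        exact Submodule.smul_mem _ _ hy }
  have hx := h.generates S (fun a y hy => hTA y hy a) (fun b y hy => hTB y hy b) x 1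
    (by rw [← map_one ιA]; exact hT 1)
  rw [one_mul] at hx
  obtain ⟨_, ⟨a, rfl⟩, m, hm, rfl⟩ := Submodule.mem_sup.1 hx
  exact ⟨a, m, hm, rfl⟩

/-- The reduced words span a subcoalgebra. -/
theorem comul_wordSpan (hιA : IsHopfHom ιA) (hιB : IsHopfHom ιB) (hhA : IsHaar hA)
    (hhB : IsHaar hB) {m : H} (hm : m ∈ wordSpan ιA ιB hA hB) :
    Coalgebra.comul (R := k) m ∈ Submodule.span k
      {z : H ⊗[k] H | ∃ x ∈ wordSpan ιA ιB hA hB, ∃ y ∈ wordSpan ιA ιB hA hB, z = x ⊗ₜ y} := by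
  -- In a coproduct of a word both tensor legs are words of the same length, because the kernels of
  -- the Haar functionals are subcoalgebras.
  let WW : Submodule k (H ⊗[k] H) := Submodule.span k
    {z | ∃ x y, IsWord ιA ιB hA hB x ∧ IsWord ιA ιB hA hB y ∧ z = x ⊗ₜ y}
  have hbase : ∀ (s : A ⊗[k] A) (t : B ⊗[k] B),
      TensorProduct.map ιA.toLinearMap ιA.toLinearMap s *
        TensorProduct.map ιB.toLinearMap ιB.toLinearMap
          (TensorProduct.map (haarProj hB) (haarProj hB) t) ∈ WW := by
    intro s t
    induction s with
    | zero => simp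
    | add x y hx hy => rw [map_add, add_mul]; exact add_mem hx hy
    | tmul a a' =>
      induction t with
      | zero => simp
      | add x y hx hy => rw [map_add, map_add, mul_add]; exact add_mem hx hy
      | tmul b b' =>
        refine Submodule.subset_span ⟨_, _, .base a b, .base a' b', ?_⟩
        simp
  have hstep : ∀ z ∈ WW, ∀ (s : A ⊗[k] A) (t : B ⊗[k] B),
      z * TensorProduct.map ιA.toLinearMap ιA.toLinearMap
          (TensorProduct.map (haarProj hA) (haarProj hA) s) *
        TensorProduct.map ιB.toLinearMap ιB.toLinearMap
          (TensorProduct.map (haarProj hB) (haarProj hB) t) ∈ WW := by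
    intro z hz s t
    induction hz using Submodule.span_induction with
    | zero => simp
    | add x y _ _ hx hy => rw [add_mul, add_mul]; exact add_mem hx hy
    | smul c x _ hx => rw [smul_mul_assoc, smul_mul_assoc]; exact Submodule.smul_mem _ c hx
    | mem z hz =>
      obtain ⟨x, y, hx, hy, rfl⟩ := hz
      induction s with
      | zero => simp
      | add x y hx hy => rw [map_add, map_add, mul_add, add_mul]; exact add_mem hx hy
      | tmul a a' =>
        induction t with
        | zero => simp
        | add x y hx hy => rw [map_add, map_add, mul_add]; exact add_mem hx hy
        | tmul b b' =>
          refine Submodule.subset_span ⟨_, _, .step x a b hx, .step y a' b' hy, ?_⟩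
          simp
  have hword : ∀ w, IsWord ιA ιB hA hB w → Coalgebra.comul (R := k) w ∈ WW := by
    intro w hw
    induction hw with
    | base a b =>
      rw [Bialgebra.comul_mul, hιA.map_comul, hιB.map_comul, hhB.comul_haarProj]
      exact hbase _ _
    | step w a b _ ih =>
      rw [Bialgebra.comul_mul, Bialgebra.comul_mul, hιA.map_comul, hιB.map_comul,
        hhB.comul_haarProj, hhA.comul_haarProj]
      exact hstep _ ih _ _
  induction hm using Submodule.span_induction with
  | zero => simp
  | add x y _ _ hx hy => rw [map_add]; exact add_mem hx hy
  | smul c x _ hx => rw [map_smul]; exact Submodule.smul_mem _ c hx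
  | mem x hx =>
    obtain ⟨w, a, hw, rfl⟩ := hx
    rw [Bialgebra.comul_mul, hιA.map_comul]
    have h1 := hword w hw
    generalize Coalgebra.comul (R := k) w = z at h1
    generalize Coalgebra.comul (R := k) a = s
    induction h1 using Submodule.span_induction with
    | zero => simp
    | add x y _ _ hx hy => rw [add_mul]; exact add_mem hx hy
    | smul c x _ hx => rw [smul_mul_assoc]; exact Submodule.smul_mem _ c hx
    | mem z hz =>
      obtain ⟨x, y, hx, hy, rfl⟩ := hz
      induction s with
      | zero => simp
      | add x y hx hy => rw [map_add, mul_add]; exact add_mem hx hy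
      | tmul a a' =>
        refine Submodule.subset_span ⟨_, word_mul_mem hx a, _, word_mul_mem hy a', ?_⟩
        simp

/-- There is a functional on the free product that is the counit on the first factor and vanishes
on the reduced words. -/
theorem IsFreeProd.exists_functional (h : IsFreeProd ιA ιB) (hhA : IsHaar hA) (hhB : IsHaar hB) :
    ∃ φ : H →ₗ[k] k, (∀ a, φ (ιA a) = Coalgebra.counit (R := k) a) ∧
      ∀ m ∈ wordSpan ιA ιB hA hB, φ m = 0 := by
  -- The aim is a concrete model T ⊕ L of k ⊗_A H. As a B-module it is T ⊗ B = T ⊕ T ⊗ ker hB. As an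
  -- A-module it is k ⊕ L ⊗ A = k ⊕ L ⊗ ker hA ⊕ L, with k carrying the counit action. With L = T ⊗
  -- ker hB these agree because T ≅ k ⊕ T ⊗ (ker hB ⊗ ker hA).
  obtain ⟨T, _, _, ⟨j⟩⟩ :=
    exists_equiv_prod_tensor k (LinearMap.ker hB ⊗[k] LinearMap.ker hA)
  let L := T ⊗[k] LinearMap.ker hB
  let eB : T ⊗[k] B ≃ₗ[k] T × L := splitEquiv hhB T
  let eA : (k × (L ⊗[k] A)) ≃ₗ[k] T × L :=
    LinearEquiv.prodCongr (LinearEquiv.refl k k) (splitEquiv hhA L) ≪≫ₗ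
      LinearEquiv.prodCongr (LinearEquiv.refl k k) (LinearEquiv.prodComm k _ _) ≪≫ₗ
      (LinearEquiv.prodAssoc k k (L ⊗[k] LinearMap.ker hA) L).symm ≪≫ₗ
      LinearEquiv.prodCongr (LinearEquiv.prodCongr (LinearEquiv.refl k k)
        (TensorProduct.assoc k _ _ _) ≪≫ₗ j.symm) (LinearEquiv.refl k L)
  have heB : ∀ t b, eB (t ⊗ₜ b) = (hB b • t, t ⊗ₜ haarKer hhB b) := splitEquiv_tmul hhB T
  have heA : ∀ c l a, eA (c, l ⊗ₜ a) =
      (j.symm (c, TensorProduct.assoc k _ _ _ (l ⊗ₜ haarKer hhA a)), hA a • l) := by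
    intro c l a
    simp [eA, splitEquiv_tmul]
    exact ⟨⟨rfl, rfl⟩, rfl⟩
  let ρ : A →ₗ[k] Module.End k (k × (L ⊗[k] A)) :=
    LinearMap.prodMapLinear k k _ k _ k ∘ₗ
      ((LinearMap.toSpanSingleton k (Module.End k k) LinearMap.id ∘ₗ Coalgebra.counit).prod
        (rightMul k A L))
  have hρ : ∀ a c z, ρ a (c, z) = (Coalgebra.counit (R := k) a * c, rightMul k A L a z) :=
    fun _ _ _ => rfl
  obtain ⟨τ, hτ1, hτm, hτA, hτB⟩ := h.exists_action
    (N := T × L) (eA.conj.toLinearMap ∘ₗ ρ)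
    (by
      intro n
      obtain ⟨⟨c, z⟩, rfl⟩ := eA.surjective n
      simp [LinearEquiv.conj_apply, hρ])
    (by
      intro a b n
      obtain ⟨⟨c, z⟩, rfl⟩ := eA.surjective n
      simp [LinearEquiv.conj_apply, hρ, ← LinearMap.lTensor_comp_apply, LinearMap.mulRight_mul]
      ring)
    (eB.conj.toLinearMap ∘ₗ rightMul k B T)
    (by
      intro n
      obtain ⟨z, rfl⟩ := eB.surjective n
      simp [LinearEquiv.conj_apply])
    (by
      intro a b n
      obtain ⟨z, rfl⟩ := eB.surjective n
      simp [LinearEquiv.conj_apply, ← LinearMap.lTensor_comp_apply])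
  have hA' : ∀ a c z, τ (ιA a) (eA (c, z)) =
      eA (Coalgebra.counit (R := k) a * c, rightMul k A L a z) := by
    intro a c z
    rw [hτA]
    simp [LinearEquiv.conj_apply, hρ]
  have hB' : ∀ b z, τ (ιB b) (eB z) = eB (rightMul k B T b z) := by
    intro b z
    rw [hτB]
    simp [LinearEquiv.conj_apply]
  -- The generator 1 of k, on which A acts through the counit.
  let Ω : T × L := (j.symm (1, 0), 0)
  have hΩ : Ω = eA (1, 0) := by
    simp [Ω, eA]
    exact ⟨⟨rfl, rfl⟩, rfl⟩
  have hΩA : ∀ a, τ (ιA a) Ω = Coalgebra.counit (R := k) a • Ω := by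
    intro a
    rw [hΩ, hA', ← map_smul]
    simp
  have hfst : ∀ t b, ∃ l, τ (ιB (haarProj hB b)) (t, 0) = (0, l) := by
    intro t b
    have h1 : ((t, 0) : T × L) = eB (t ⊗ₜ 1) := by
      have h2 : haarKer hhB 1 = 0 := by
        apply Subtype.ext
        simp [coe_haarKer, haarProj_apply, hhB.map_one]
      rw [heB, hhB.map_one, one_smul, h2, TensorProduct.tmul_zero]
    rw [h1, hB', rightMul_apply, LinearMap.lTensor_tmul, LinearMap.mulRight_apply, one_mul, heB,
      hhB.apply_haarProj, zero_smul]
    exact ⟨_, rfl⟩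
  have hsnd : ∀ l a, τ (ιA a) (0, l) = eA (0, l ⊗ₜ a) := by
    intro l a
    have h1 : ((0, l) : T × L) = eA (0, l ⊗ₜ 1) := by
      have h2 : haarKer hhA 1 = 0 := by
        apply Subtype.ext
        simp [coe_haarKer, haarProj_apply, hhA.map_one]
      rw [heA, hhA.map_one, one_smul, h2, TensorProduct.tmul_zero, map_zero, Prod.mk_zero_zero,
        map_zero]
    rw [h1, hA', rightMul_apply, LinearMap.lTensor_tmul, LinearMap.mulRight_apply, one_mul,
      mul_zero]
  -- Letters of ker hA carry L into T and letters of ker hB carry T into L. A word ends in the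
  -- latter, so it takes Ω into L.
  have hword : ∀ w, IsWord ιA ιB hA hB w → ∃ l, τ w Ω = (0, l) := by
    intro w hw
    induction hw with
    | base a b =>
      obtain ⟨l, hl⟩ := hfst (j.symm (1, 0)) b
      refine ⟨Coalgebra.counit (R := k) a • l, ?_⟩
      rw [hτm, hΩA, map_smul, hl]
      simp
    | step w a b _ ih =>
      obtain ⟨l, hl⟩ := ih
      rw [hτm, hτm, hl, hsnd, heA, hhA.apply_haarProj, zero_smul]
      exact hfst _ b
  -- The k-component of Ω · x. After a word one is in L, and a last factor from A stays in L ⊗ A,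
  -- away from k.
  let φ : H →ₗ[k] k := LinearMap.fst k k _ ∘ₗ j.toLinearMap ∘ₗ LinearMap.fst k T L ∘ₗ τ.flip Ω
  have hφ : ∀ x, φ x = (j (τ x Ω).1).1 := fun _ => rfl
  refine ⟨φ, fun a => ?_, fun m hm => ?_⟩
  · rw [hφ, hΩA]
    simp [Ω]
  · have : wordSpan ιA ιB hA hB ≤ LinearMap.ker φ := by
      rw [wordSpan, Submodule.span_le]
      rintro _ ⟨w, a, hw, rfl⟩
      obtain ⟨l, hl⟩ := hword w hw
      change φ _ = 0
      rw [hφ, hτm, hl, hsnd, heA]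
      simp
    exact this hm

/-- The expectation of a free product on its first factor. -/
theorem IsFreeProd.exists_isExpectation (h : IsFreeProd ιA ιB) (hιA : IsHopfHom ιA)
    (hιB : IsHopfHom ιB) (hhA : IsHaar hA) (hhB : IsHaar hB) :
    ∃ E : H →ₗ[k] A, IsExpectation ιA E := by
  obtain ⟨φ, hφA, hφM⟩ := h.exists_functional hhA hhB
  -- The expectation is E(x) = φ(x₁) π(x₂). It kills the span M of reduced words, as Δ(M) ⊆ M ⊗ M
  -- and φ(M) = 0, and it is the identity on A. Given H = A + M, the required properties follow from
  -- A M A ⊆ M and Δ(M) ⊆ M ⊗ M.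
  obtain ⟨π, hπ, -⟩ := h.exists_lift (AlgHom.id k A)
    ((Algebra.ofId k A).comp (Bialgebra.counitAlgHom k B))
  let E : H →ₗ[k] A := π.toLinearMap ∘ₗ (TensorProduct.lid k H).toLinearMap ∘ₗ φ.rTensor H ∘ₗ
    Coalgebra.comul
  have hEA : ∀ a, E (ιA a) = a := by
    intro a
    have h1 : ∀ z : A ⊗[k] A, π (TensorProduct.lid k H (φ.rTensor H
        (TensorProduct.map ιA.toLinearMap ιA.toLinearMap z))) =
        TensorProduct.lid k A (Coalgebra.counit.rTensor A z) := by
      intro z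
      induction z with
      | zero => simp
      | add x y hx hy => simp only [map_add, hx, hy]
      | tmul x y => simp [hφA, hπ]
    change π (TensorProduct.lid k H (φ.rTensor H (Coalgebra.comul (ιA a)))) = a
    rw [hιA.map_comul, h1]
    simp
  have hker : ∀ {Y : Type u} [AddCommGroup Y] [Module k Y] (F : H ⊗[k] H →ₗ[k] Y),
      (∀ x ∈ wordSpan ιA ιB hA hB, ∀ y ∈ wordSpan ιA ιB hA hB, F (x ⊗ₜ y) = 0) →
      ∀ m ∈ wordSpan ιA ιB hA hB, F (Coalgebra.comul m) = 0 := by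
    intro Y _ _ F hF m hm
    have h1 : Submodule.span k {z : H ⊗[k] H | ∃ x ∈ wordSpan ιA ιB hA hB,
        ∃ y ∈ wordSpan ιA ιB hA hB, z = x ⊗ₜ y} ≤ LinearMap.ker F := by
      rw [Submodule.span_le]
      rintro _ ⟨x, hx, y, hy, rfl⟩
      exact hF x hx y hy
    exact h1 (comul_wordSpan hιA hιB hhA hhB hm)
  have hEM : ∀ m ∈ wordSpan ιA ιB hA hB, E m = 0 :=
    hker (π.toLinearMap ∘ₗ (TensorProduct.lid k H).toLinearMap ∘ₗ φ.rTensor H)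
      (fun x hx y _ => by simp [hφM x hx])
  refine ⟨E, hEA, fun a x => ?_, fun a x => ?_, fun x => ?_, fun x => ?_⟩ <;>
    obtain ⟨a', m, hm, rfl⟩ := h.exists_add_word hA hB x
  · rw [mul_add, ← map_mul, map_add, map_add, hEA, hEA, hEM m hm, hEM _ (mul_wordSpan hm a)]
    simp
  · rw [add_mul, ← map_mul, map_add, map_add, hEA, hEA, hEM m hm, hEM _ (wordSpan_mul hm a)]
    simp
  · rw [map_add, map_add, hker (E.rTensor H) (fun x hx y _ => by simp [hEM x hx]) m hm,
      map_add, hEA, hEM m hm, hιA.map_comul, add_zero, add_zero]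
    induction Coalgebra.comul (R := k) a' with
    | zero => simp
    | add x y hx hy => simp only [map_add, hx, hy]
    | tmul x y => simp [hEA]
  · rw [map_add, map_add, hker (E.lTensor H) (fun x _ y hy => by simp [hEM y hy]) m hm,
      map_add, hEA, hEM m hm, hιA.map_comul, add_zero, add_zero]
    induction Coalgebra.comul (R := k) a' with
    | zero => simp
    | add x y hx hy => simp only [map_add, hx, hy]
    | tmul x y => simp [hEA]

end Expectation

/-! ### Derivations on a free product. -/

section Derivation

variable {k A B H : Type u} [Field k] [Ring A] [HopfAlgebra k A] [Ring B] [HopfAlgebra k B]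
  [Ring H] [HopfAlgebra k H] {ιA : A →ₐ[k] H} {ιB : B →ₐ[k] H}

/-- The derivation of the free product `H` with values in an algebra over `H`, with `H` acting on
the left through the counit, that is inner on `A` and vanishes on `B`. -/
theorem IsFreeProd.exists_derivation (h : IsFreeProd ιA ιB) (hιA : IsHopfHom ιA)
    (hιB : IsHopfHom ιB) {R : Type u} [Ring R] [Algebra k R] (ψ : H →ₐ[k] R) :
    ∃ D : H →ₗ[k] R, (∀ x y, D (x * y) = D x * ψ y + Coalgebra.counit (R := k) x • D y) ∧
      (∀ a, D (ιA a) = ψ (ιA a) - Coalgebra.counit (R := k) a • 1) ∧ ∀ b, D (ιB b) = 0 := by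
  -- A derivation is the off-diagonal entry of a triangular action (r, c) · x = (r ψ(x) + c D(x),
  -- ε(x) c), and such actions can be prescribed on the factors.
  let ρ : A →ₗ[k] Module.End k (R × k) := LinearMap.mk₂ k
    (fun a n => (n.1 * ψ (ιA a) + n.2 • (ψ (ιA a) - Coalgebra.counit (R := k) a • 1),
      Coalgebra.counit (R := k) a * n.2))
    (by intro a b n; ext <;> simp [mul_add, add_mul, add_smul, smul_sub]; abel)
    (by intro c a n; ext <;> simp [mul_smul, smul_add, smul_sub, smul_comm c, mul_assoc])
    (by intro a n m; ext <;> simp [mul_add, add_mul, add_smul, smul_sub]; abel)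
    (by intro c a n; ext <;> simp [mul_smul, mul_left_comm])
  have hρ : ∀ a r c, ρ a (r, c) =
      (r * ψ (ιA a) + c • (ψ (ιA a) - Coalgebra.counit (R := k) a • 1),
        Coalgebra.counit (R := k) a * c) := fun _ _ _ => rfl
  let σ : B →ₗ[k] Module.End k (R × k) := LinearMap.mk₂ k
    (fun a n => (n.1 * ψ (ιB a), Coalgebra.counit (R := k) a * n.2))
    (by intro a b n; ext <;> simp [mul_add, add_mul])
    (by intro c a n; ext <;> simp [mul_assoc])
    (by intro a n m; ext <;> simp [mul_add, add_mul])
    (by intro c a n; ext <;> simp [mul_left_comm])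
  have hσ : ∀ b r c, σ b (r, c) = (r * ψ (ιB b), Coalgebra.counit (R := k) b * c) :=
    fun _ _ _ => rfl
  obtain ⟨τ, hτ1, hτm, hτA, hτB⟩ := h.exists_action ρ
    (by rintro ⟨r, c⟩; simp [hρ])
    (by
      rintro a b ⟨r, c⟩
      simp only [hρ, map_mul, Bialgebra.counit_mul, Prod.mk.injEq]
      refine ⟨?_, by ring⟩
      simp only [add_mul, smul_mul_assoc, sub_mul, one_mul, smul_sub, mul_smul, mul_assoc,
        smul_comm c]
      abel)
    σ (by rintro ⟨r, c⟩; simp [hσ])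
    (by
      rintro a b ⟨r, c⟩
      simp only [hσ, map_mul, Bialgebra.counit_mul, Prod.mk.injEq]
      exact ⟨(mul_assoc _ _ _).symm, by ring⟩)
  let D : H →ₗ[k] R := LinearMap.fst k R k ∘ₗ τ.flip (0, 1)
  have hD : ∀ x, D x = (τ x (0, 1)).1 := fun _ => rfl
  have hDA : ∀ a, D (ιA a) = ψ (ιA a) - Coalgebra.counit (R := k) a • 1 := by
    intro a
    rw [hD, hτA, hρ]
    simp
  have hDB : ∀ b, D (ιB b) = 0 := by
    intro b
    rw [hD, hτB, hσ]
    simp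
  -- The triangular form, known on the factors, propagates to products; the derivation rule is then
  -- read off at (0, 1).
  let S : Subalgebra k H :=
    { carrier := {x | ∀ r c, τ x (r, c) = (r * ψ x + c • D x, Coalgebra.counit (R := k) x * c)}
      mul_mem' := by
        intro x y hx hy r c
        rw [hτm, hx, hy, map_mul, Bialgebra.counit_mul, hD (x * y), hτm, hx, hy]
        simp only [Prod.mk.injEq]
        refine ⟨?_, by ring⟩
        simp only [add_mul, smul_mul_assoc, zero_mul, zero_add, one_smul, mul_assoc, mul_one,
          smul_add, smul_smul, mul_comm c, add_assoc]
      add_mem' := by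
        intro x y hx hy r c
        rw [map_add, LinearMap.add_apply, hx, hy]
        ext <;> simp [mul_add, add_mul]; abel
      algebraMap_mem' := by
        intro c r d
        rw [hD, Algebra.algebraMap_eq_smul_one, map_smul, LinearMap.smul_apply, hτ1,
          LinearMap.smul_apply, hτ1]
        ext <;> simp }
  have hS : ∀ (x : H) r c, τ x (r, c) = (r * ψ x + c • D x, Coalgebra.counit (R := k) x * c) := by
    refine h.generates S ?_ ?_
    · intro a r c
      rw [hτA, hρ, hDA, hιA.map_counit]
    · intro b r c
      rw [hτB, hσ, hDB, hιB.map_counit]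
      simp
  refine ⟨D, fun x y => ?_, hDA, hDB⟩
  rw [hD, hτm, hS x, hS y]
  simp

end Derivation

namespace YetterDrinfeld

/-! ### The trivial module and the modules it induces. -/

section Trivial

variable {k A H : Type u} [Field k] [Ring A] [HopfAlgebra k A] [Ring H] [HopfAlgebra k H]
  {ι : A →ₐ[k] H} (hι : IsHopfHom ι)

theorem trivial_act (a : A) (v : trivial k A) :
    MulOpposite.op a • v = Coalgebra.counit (R := k) a • v := rfl

theorem trivial_coact (v : trivial k A) : (trivial k A).coact v = v ⊗ₜ (1 : A) := rfl

variable (k H) in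
/-- The free Yetter-Drinfeld module on the trivial comodule. -/
abbrev freeTrivial : YetterDrinfeld k H := free (trivial k H).comodule

/-- The canonical map from `k` to the module induced by the trivial module. -/
def trivialUnit : trivial k H →ₗ[k] ind hι (trivial k A) := (indUnit hι (trivial k A)).toLin

theorem trivialUnit_act (a : A) (c : trivial k H) :
    MulOpposite.op (ι a) • trivialUnit hι c = Coalgebra.counit (R := k) a • trivialUnit hι c := by
  refine ((indUnit hι (trivial k A)).map_act a c).symm.trans ?_
  exact map_smul (indUnit hι (trivial k A)).toLin (Coalgebra.counit (R := k) a) c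

theorem trivialUnit_coact (c : trivial k H) :
    (ind hι (trivial k A)).coact (trivialUnit hι c) = trivialUnit hι c ⊗ₜ (1 : H) := by
  refine ((indUnit hι (trivial k A)).map_coact c).trans ?_
  change trivialUnit hι c ⊗ₜ ι 1 = _
  rw [map_one]

/-- The morphism from the free module on the trivial comodule to the module induced by the trivial
module. -/
def freeToInd : freeTrivial k H ⟶ ind hι (trivial k A) :=
  freeHom _ _ (trivialUnit hι) (relColinear_id fun v => by
    rw [trivialUnit_coact]
    rfl)

theorem freeToInd_tmul (x : H) (c : trivial k H) :
    (freeToInd hι).toLin (x ⊗ₜ[k] c : H ⊗[k] trivial k H) = MulOpposite.op x • trivialUnit hι c :=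
  rfl

/-- The canonical morphism from the module induced by the trivial module to the trivial module. -/
def indToTrivial : ind hι (trivial k A) ⟶ trivial k H :=
  indLift (W := trivial k H)
    { toLin := (LinearMap.id : k →ₗ[k] k)
      map_act := fun a v => by
        change Coalgebra.counit (R := k) a * _ = Coalgebra.counit (R := k) (ι a) * _
        rw [hι.map_counit]
        rfl
      map_coact := fun v => by
        change v ⊗ₜ[k] (1 : H) = v ⊗ₜ ι 1
        rw [map_one] }

theorem indToTrivial_unit (c : trivial k H) :
    (indToTrivial hι).toLin (trivialUnit hι c) = c :=
  indLift_unit (hι := hι) _ _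

theorem freeToInd_comp_indToTrivial (x : freeTrivial k H) :
    (indToTrivial hι).toLin ((freeToInd hι).toLin x) = (freeCounit (trivial k H)).toLin x := by
  have h1 : freeToInd hι ≫ indToTrivial hι = freeCounit (trivial k H) := by
    refine free_hom_ext fun v => ?_
    refine (congrArg _ (freeToInd_tmul hι 1 v)).trans ((Hom.map_act _ _ _).trans ?_)
    exact congrArg (fun t => MulOpposite.op (1 : H) • t) (indToTrivial_unit hι v)
  exact congrArg (fun f => Hom.toLin f x) h1

/-- A linear map from the module induced by the trivial module. -/
theorem exists_indTrivialLin {N : Type u} [AddCommGroup N] [Module k N] (D : H →ₗ[k] N)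
    (hD : ∀ a x, D (ι a * x) = Coalgebra.counit (R := k) a • D x) :
    ∃ l : ind hι (trivial k A) →ₗ[k] N, ∀ x : H ⊗[k] k,
      l ((freeToInd hι).toLin x) = D (TensorProduct.rid k H x) := by
  obtain ⟨l, hl⟩ := exists_indLin (hι := hι) (X := trivial k A)
    (D ∘ₗ (TensorProduct.rid k H).toLinearMap : H ⊗[k] k →ₗ[k] N) (by
      intro x a (v : k)
      change D ((Coalgebra.counit (R := k) a * v : k) • x) = D (v • (ι a * x))
      rw [map_smul, map_smul, hD, smul_smul, mul_comm])
  refine ⟨l, fun x => ?_⟩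
  refine Eq.trans (congrArg l ?_) (hl x)
  have h1 : (freeToInd hι).toLin = (indπ hι (trivial k A)).toLin := by
    refine TensorProduct.ext' fun x c => ?_
    exact (indπ_tmul hι (trivial k A) x c).symm
  exact LinearMap.congr_fun h1 x

end Trivial

/-! ### The Mayer-Vietoris sequence. -/

section MayerVietoris

open Limits

variable {k A B H : Type u} [Field k] [Ring A] [HopfAlgebra k A] [Ring B] [HopfAlgebra k B]
  [Ring H] [HopfAlgebra k H] {ιA : A →ₐ[k] H} {ιB : B →ₐ[k] H}

/-- Let D be the derivation with D(a) = a - ε(a) on A and D = 0 on B. Then D factors through k ⊗_B H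
and D - id through k ⊗_A H. An element that dies in both is D(x) - (D - id)(x) = 0. -/
theorem eq_zero_of_freeToInd (h : IsFreeProd ιA ιB) (hιA : IsHopfHom ιA) (hιB : IsHopfHom ιB)
    (x : freeTrivial k H) (hA : (freeToInd hιA).toLin x = 0) (hB : (freeToInd hιB).toLin x = 0) :
    x = 0 := by
  obtain ⟨D, hD, hDA, hDB⟩ := h.exists_derivation hιA hιB (AlgHom.id k H)
  obtain ⟨l, hl⟩ := exists_indTrivialLin hιA (D - LinearMap.id) (by
    intro a x
    simp only [LinearMap.sub_apply, LinearMap.id_apply, hD, hDA, AlgHom.id_apply, hιA.map_counit]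
    rw [sub_mul, smul_mul_assoc, one_mul, smul_sub]
    abel)
  obtain ⟨m, hm⟩ := exists_indTrivialLin hιB D (by
    intro b x
    rw [hD, hDB, hιB.map_counit, zero_mul, zero_add])
  have h1 := hl x
  have h2 := hm x
  rw [hA, map_zero] at h1
  rw [hB, map_zero] at h2
  rw [LinearMap.sub_apply, ← h2, zero_sub, LinearMap.id_apply] at h1
  exact (TensorProduct.rid k H).map_eq_zero_iff.1 (neg_eq_zero.1 h1.symm)

theorem lift_comp_desc (hιA : IsHopfHom ιA) (hιB : IsHopfHom ιB) :
    biprod.lift (freeToInd hιA) (freeToInd hιB) ≫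
      biprod.desc (indToTrivial hιA) (-indToTrivial hιB) = 0 := by
  rw [biprod.lift_desc]
  ext x
  rw [add_toLin, Preadditive.comp_neg, neg_toLin, comp_toLin, comp_toLin,
    freeToInd_comp_indToTrivial, freeToInd_comp_indToTrivial, add_neg_cancel, zero_toLin]

/-- Exactness in the middle. Vanishing on the free module identifies the images of the two
generators up to sign; the common vector is acted on through the counit by A and by B, hence by all
of H. -/
theorem exists_trivial_desc (h : IsFreeProd ιA ιB) (hιA : IsHopfHom ιA) (hιB : IsHopfHom ιB)
    {W : YetterDrinfeld k H} (g : ind hιA (trivial k A) ⊞ ind hιB (trivial k B) ⟶ W)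
    (hg : biprod.lift (freeToInd hιA) (freeToInd hιB) ≫ g = 0) :
    ∃ t : trivial k H ⟶ W, biprod.desc (indToTrivial hιA) (-indToTrivial hιB) ≫ t = g := by
  let w : trivial k H →ₗ[k] W := (biprod.inl ≫ g).toLin ∘ₗ trivialUnit hιA
  have hw : ∀ c, w c = (biprod.inl ≫ g).toLin (trivialUnit hιA c) := fun _ => rfl
  have hwB : ∀ c, w c = -(biprod.inr ≫ g).toLin (trivialUnit hιB c) := by
    intro c
    rw [biprod.lift_eq, Preadditive.add_comp, Category.assoc, Category.assoc] at hg
    have h1 := congrArg (fun f => Hom.toLin f ((1 : H) ⊗ₜ[k] c)) hg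
    have h2 : (biprod.inl ≫ g).toLin ((freeToInd hιA).toLin ((1 : H) ⊗ₜ[k] c)) +
      (biprod.inr ≫ g).toLin ((freeToInd hιB).toLin ((1 : H) ⊗ₜ[k] c)) = 0 := h1
    rw [eq_neg_iff_add_eq_zero]
    have h3 : (freeToInd hιA).toLin ((1 : H) ⊗ₜ[k] c) = trivialUnit hιA c :=
      (freeToInd_tmul hιA 1 c).trans (one_smul _ _)
    have h4 : (freeToInd hιB).toLin ((1 : H) ⊗ₜ[k] c) = trivialUnit hιB c :=
      (freeToInd_tmul hιB 1 c).trans (one_smul _ _)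
    rw [h3, h4] at h2
    exact h2
  let S : Subalgebra k H :=
    { carrier := {x | ∀ c, MulOpposite.op x • w c = Coalgebra.counit (R := k) x • w c}
      mul_mem' := by
        intro x y hx hy c
        rw [MulOpposite.op_mul, mul_smul, hx, smul_algebra_smul_comm, hy, Bialgebra.counit_mul,
          mul_smul]
      add_mem' := by
        intro x y hx hy c
        rw [MulOpposite.op_add, add_smul, hx, hy, map_add, add_smul]
      algebraMap_mem' := by
        intro d c
        rw [Bialgebra.counit_algebraMap, Algebra.algebraMap_eq_smul_one, MulOpposite.op_smul,
          smul_assoc, MulOpposite.op_one, one_smul] }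
  have hS : ∀ (x : H) c, MulOpposite.op x • w c = Coalgebra.counit (R := k) x • w c := by
    refine h.generates S ?_ ?_
    · intro a c
      rw [hw, ← Hom.map_act, trivialUnit_act, map_smul, hιA.map_counit]
    · intro b c
      rw [hwB, smul_neg, ← Hom.map_act, trivialUnit_act, map_smul, hιB.map_counit, smul_neg]
  let t : trivial k H ⟶ W :=
    { toLin := w
      map_act := fun x c => by rw [trivial_act, map_smul, hS]
      map_coact := fun c => by
        rw [trivial_coact, hw, Hom.map_coact, trivialUnit_coact]
        rfl }
  have ht : ∀ c, t.toLin c = w c := fun _ => rfl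
  refine ⟨t, biprod.hom_ext' _ _ (ind_hom_ext fun c => ?_) (ind_hom_ext fun c => ?_)⟩
  · rw [biprod.inl_desc_assoc, comp_toLin]
    exact congrArg t.toLin (indToTrivial_unit hιA c)
  · rw [biprod.inr_desc_assoc, Preadditive.neg_comp, neg_toLin, comp_toLin, neg_eq_iff_eq_neg]
    exact (congrArg t.toLin (indToTrivial_unit hιB c)).trans (hwB c)

/-- The Mayer-Vietoris sequence of a free product of Hopf algebras. -/
theorem mayerVietoris (h : IsFreeProd ιA ιB) (hιA : IsHopfHom ιA) (hιB : IsHopfHom ιB) :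
    (ShortComplex.mk _ _ (lift_comp_desc hιA hιB)).ShortExact := by
  have hm : Mono (biprod.lift (freeToInd hιA) (freeToInd hιB)) := by
    apply mono_of_injective
    rw [injective_iff_map_eq_zero]
    intro x hx
    refine eq_zero_of_freeToInd h hιA hιB x ?_ ?_
    · rw [← biprod.lift_fst (freeToInd hιA) (freeToInd hιB), comp_toLin, hx, map_zero]
    · rw [← biprod.lift_snd (freeToInd hιA) (freeToInd hιB), comp_toLin, hx, map_zero]
  have he : Epi (biprod.desc (indToTrivial hιA) (-indToTrivial hιB)) := by
    apply epi_of_surjective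
    intro c
    refine ⟨(biprod.inl : _ ⟶ _ ⊞ ind hιB (trivial k B)).toLin (trivialUnit hιA c), ?_⟩
    rw [← comp_toLin, biprod.inl_desc, indToTrivial_unit]
  refine ShortComplex.ShortExact.mk' ?_ hm he
  exact ShortComplex.exact_of_g_is_cokernel _ (CokernelCofork.IsColimit.ofπ _ _
    (fun g hg => (exists_trivial_desc h hιA hιB g hg).choose)
    (fun g hg => (exists_trivial_desc h hιA hιB g hg).choose_spec)
    (fun g hg m hm => by
      rw [← cancel_epi (biprod.desc (indToTrivial hιA) (-indToTrivial hιB)), hm,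
        (exists_trivial_desc h hιA hιB g hg).choose_spec]))

end MayerVietoris

end YetterDrinfeld

namespace YetterDrinfeld

/-! ### The trivial module over a free product is not projective. -/

section Nonprojective

variable {k A B H : Type u} [Field k] [Ring A] [HopfAlgebra k A] [Ring B] [HopfAlgebra k B]
  [Ring H] [HopfAlgebra k H] {ιA : A →ₐ[k] H} {ιB : B →ₐ[k] H}

/-- If the trivial module is projective, there is a normalized right integral. -/
theorem exists_integral [Projective (trivial k H)] :
    ∃ t : H, Coalgebra.counit (R := k) t = 1 ∧
      ∀ x, t * x = Coalgebra.counit (R := k) x • t := by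
  have := epi_freeCounit (trivial k H)
  -- The free module is H with right multiplication, and its map to k is the counit; the integral is
  -- the image of 1 under a section.
  let s : trivial k H ⟶ freeTrivial k H := Projective.factorThru (𝟙 _) (freeCounit (trivial k H))
  have hs : s ≫ freeCounit (trivial k H) = 𝟙 _ := Projective.factorThru_comp _ _
  let e : H ⊗[k] k ≃ₗ[k] H := TensorProduct.rid k H
  let t : H ⊗[k] k := s.toLin (1 : k)
  have h1 : ∀ z : H ⊗[k] k, (freeCounit (trivial k H)).toLin z = Coalgebra.counit (R := k) (e z) := by
    intro z
    have h2 : (freeCounit (trivial k H)).toLin = Coalgebra.counit (R := k) ∘ₗ e.toLinearMap := by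
      refine TensorProduct.ext' fun x (c : k) => ?_
      change Coalgebra.counit (R := k) x * c = Coalgebra.counit (R := k) (c • x)
      rw [map_smul, smul_eq_mul, mul_comm]
    exact LinearMap.congr_fun h2 z
  have h3 : ∀ (z : H ⊗[k] k) (x : H), e (MulOpposite.op x • z) = e z * x := by
    intro z x
    induction z with
    | zero => simp
    | add y z hy hz => rw [smul_add, map_add, hy, hz, map_add, add_mul]
    | tmul y c => rw [op_smul_tmul]; simp [e]
  refine ⟨e t, ?_, fun x => ?_⟩
  · rw [← h1]
    exact congrArg (fun f => Hom.toLin f (1 : k)) hs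
  · rw [← h3, ← map_smul]
    refine congrArg e ?_
    refine (s.map_act x (1 : k)).symm.trans ?_
    exact map_smul s.toLin (Coalgebra.counit (R := k) x) (1 : k)

theorem exists_counit_eq_zero (h : ¬ Function.Surjective (algebraMap k A)) :
    ∃ a : A, a ≠ 0 ∧ Coalgebra.counit (R := k) a = 0 := by
  by_contra! h1
  refine h fun a => ⟨Coalgebra.counit (R := k) a, ?_⟩
  by_contra h2
  refine h1 (a - algebraMap k A (Coalgebra.counit (R := k) a)) ?_ ?_
  · exact fun h3 => h2 (sub_eq_zero.1 h3).symm
  · rw [map_sub, Bialgebra.counit_algebraMap, sub_self]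

theorem tmul_ne_zero {V W : Type u} [AddCommGroup V] [Module k V] [AddCommGroup W] [Module k W]
    {v : V} {w : W} (hv : v ≠ 0) (hw : w ≠ 0) : v ⊗ₜ[k] w ≠ 0 := by
  intro h
  refine hv ((Module.forall_dual_apply_eq_zero_iff k v).1 fun f => ?_)
  have h1 := congrArg (fun z => TensorProduct.lid k W (f.rTensor W z)) h
  simpa [hw] using h1

/-- The trivial module over a free product of non-trivial Hopf algebras is not projective. -/
theorem not_projective_trivial (h : IsFreeProd ιA ιB) (hιA : IsHopfHom ιA) (hιB : IsHopfHom ιB)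
    (hA : ¬ Function.Surjective (algebraMap k A)) (hB : ¬ Function.Surjective (algebraMap k B)) :
    ¬ Projective (trivial k H) := by
  intro hP
  obtain ⟨t, ht1, ht⟩ := exists_integral (k := k) (H := H)
  obtain ⟨a, ha, ha0⟩ := exists_counit_eq_zero hA
  obtain ⟨b, hb, hb0⟩ := exists_counit_eq_zero hB
  -- The target A ⊗ B is chosen because there the images of a and b commute and have the nonzero
  -- product a ⊗ b.
  obtain ⟨ψ, hψA, hψB⟩ := h.exists_lift (R := A ⊗[k] B) Algebra.TensorProduct.includeLeft
    Algebra.TensorProduct.includeRight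
  obtain ⟨D, hD, hDA, hDB⟩ := h.exists_derivation hιA hιB ψ
  -- As a and b lie in the kernels of the counits, t a = 0 = t b; apply D to both. Multiplying the
  -- first relation by 1 ⊗ b then leaves a ⊗ b = 0.
  have h1 : D t * (a ⊗ₜ[k] 1) + a ⊗ₜ[k] 1 = 0 := by
    have h2 := hD t (ιA a)
    rw [ht, hιA.map_counit, ha0, zero_smul, map_zero, hDA, ht1, one_smul, ha0, zero_smul,
      sub_zero, hψA] at h2
    exact h2.symm
  have h2 : D t * (1 ⊗ₜ[k] b) = 0 := by
    have h3 := hD t (ιB b)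
    rw [ht, hιB.map_counit, hb0, zero_smul, map_zero, hDB, smul_zero, add_zero, hψB] at h3
    exact h3.symm
  have h3 : D t * (a ⊗ₜ[k] 1) * (1 ⊗ₜ[k] b) = 0 := by
    have h4 : (a ⊗ₜ[k] (1 : B)) * ((1 : A) ⊗ₜ[k] b) = (1 ⊗ₜ b) * (a ⊗ₜ 1) := by simp
    rw [mul_assoc, h4, ← mul_assoc, h2, zero_mul]
  have h5 := congrArg (· * ((1 : A) ⊗ₜ[k] b)) h1
  simp only [add_mul, h3, zero_mul, zero_add, Algebra.TensorProduct.tmul_mul_tmul, mul_one,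
    one_mul] at h5
  exact tmul_ne_zero ha hb h5

end Nonprojective

/-! ### Comparison of dimensions. -/

section Dimension

open Limits

variable {k A B H : Type u} [Field k] [Ring A] [HopfAlgebra k A] [Ring B] [HopfAlgebra k B]
  [Ring H] [HopfAlgebra k H] {ιA : A →ₐ[k] H} {ιB : B →ₐ[k] H} {hA : A →ₗ[k] k} {hB : B →ₗ[k] k}

/-- Read off the Mayer-Vietoris sequence, whose first term is projective. The bound n + 2 is needed:
the first term must have dimension below n + 1, and it has dimension below 1. -/
theorem hasProjectiveDimensionLT_trivial_iff (h : IsFreeProd ιA ιB) (hιA : IsHopfHom ιA)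
    (hιB : IsHopfHom ιB) (hhA : IsHaar hA) (hhB : IsHaar hB) (n : ℕ) :
    HasProjectiveDimensionLT (trivial k H) (n + 2) ↔
      HasProjectiveDimensionLT (trivial k A) (n + 2) ∧
        HasProjectiveDimensionLT (trivial k B) (n + 2) := by
  obtain ⟨EA, hEA⟩ := h.exists_isExpectation hιA hιB hhA hhB
  obtain ⟨EB, hEB⟩ := h.symm.exists_isExpectation hιB hιA hhB hhA
  have hS := mayerVietoris h hιA hιB
  have hP : Projective (freeTrivial k H) := projective_free (hEA.isHaar_comp hhA) _
  rw [← hasProjectiveDimensionLT_ind_iff hιA hEA hhA (fun f hf => h.indMap_injective hιA f hf),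
    ← hasProjectiveDimensionLT_ind_iff hιB hEB hhB (fun f hf => h.symm.indMap_injective hιB f hf)]
  refine ⟨fun h3 => ?_, fun ⟨h1, h2⟩ => ?_⟩
  · have h2 : HasProjectiveDimensionLT (ind hιA (trivial k A) ⊞ ind hιB (trivial k B)) (n + 2) :=
      hS.hasProjectiveDimensionLT_X₂ (n + 2)
        (hasProjectiveDimensionLT_of_ge (freeTrivial k H) 1 (n + 2) (by omega)) h3
    refine ⟨Retract.hasProjectiveDimensionLT (Y := ind hιA (trivial k A) ⊞ ind hιB (trivial k B))
      ⟨biprod.inl, biprod.fst, by simp⟩ _,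
      Retract.hasProjectiveDimensionLT (Y := ind hιA (trivial k A) ⊞ ind hιB (trivial k B))
      ⟨biprod.inr, biprod.snd, by simp⟩ _⟩
  · exact hS.hasProjectiveDimensionLT_X₃ (n + 1)
      (hasProjectiveDimensionLT_of_ge (freeTrivial k H) 1 (n + 1) (by omega)) inferInstance

/-- Projective dimension below n + 1 means that Ext from k vanishes in all degrees from n + 1 on,
not merely in degree n + 1; this is what a bound on the supremum says. -/
theorem cdGS_le_iff (n : ℕ) :
    cdGS k A ≤ n ↔ HasProjectiveDimensionLT (trivial k A) (n + 1) := by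
  rw [cdGS, sSup_le_iff]
  refine ⟨fun h => ⟨fun i hi V => ?_⟩, ?_⟩
  · rw [← not_nontrivial_iff_subsingleton]
    intro h1
    have := h i ⟨i, V, rfl, h1⟩
    rw [Nat.cast_le] at this
    omega
  · rintro h _ ⟨i, V, rfl, h1⟩
    rw [Nat.cast_le]
    by_contra h2
    have : HasExt.{u + 1} (YetterDrinfeld k A) := HasExt.standard _
    exact not_nontrivial_iff_subsingleton.2
      (HasProjectiveDimensionLT.subsingleton (trivial k A) (n + 1) i (by omega) V) h1

end Dimension

end YetterDrinfeld

/-! ### The concrete free product satisfies the abstract conditions. -/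

section HopfFreeProduct

open LinearAlgebra.FreeProduct

variable (k A B : Type u) [Field k] [Ring A] [HopfAlgebra k A] [Ring B] [HopfAlgebra k B]

/-- The inclusion of the first factor. -/
def freeProdInl : A →ₐ[k] HopfFreeProduct k A B := ι k (FactorPair A B) false

/-- The inclusion of the second factor. -/
def freeProdInr : B →ₐ[k] HopfFreeProduct k A B := ι k (FactorPair A B) true

theorem isHopfHom_ι (i : Bool) : IsHopfHom (ι k (FactorPair A B) i) where
  map_comul a := comulHom_ι k (FactorPair A B) i a
  map_counit a := counitHom_ι k (FactorPair A B) i a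
  map_antipode a := antipodeLin_ι k (FactorPair A B) i a

theorem isHopfHom_inl : IsHopfHom (freeProdInl k A B) :=
  { map_comul := (isHopfHom_ι k A B false).map_comul
    map_counit := (isHopfHom_ι k A B false).map_counit
    map_antipode := (isHopfHom_ι k A B false).map_antipode }

theorem isHopfHom_inr : IsHopfHom (freeProdInr k A B) :=
  { map_comul := (isHopfHom_ι k A B true).map_comul
    map_counit := (isHopfHom_ι k A B true).map_counit
    map_antipode := (isHopfHom_ι k A B true).map_antipode }

theorem isFreeProd : IsFreeProd (freeProdInl k A B) (freeProdInr k A B) where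
  exists_lift {R} _ _ f g := by
    let F : ∀ i, FactorPair A B i →ₐ[k] R
      | false => f
      | true => g
    exact ⟨lift k (FactorPair A B) (fun {i} => F i), lift_ι_apply F false, lift_ι_apply F true⟩
  generates S h1 h2 := mem_of_factors S fun i => match i with
    | false => h1
    | true => h2

end HopfFreeProduct

end

theorem corollary5 (k A B : Type u) [Field k] [IsAlgClosed k] [CharZero k]
    [Ring A] [HopfAlgebra k A] [Ring B] [HopfAlgebra k B]
    (hA : IsCosemisimple k A) (hB : IsCosemisimple k B)
    (hA_nontrivial : ¬ Function.Surjective (algebraMap k A))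
    (hB_nontrivial : ¬ Function.Surjective (algebraMap k B)) :
    (cdGS k A = 0 ∧ cdGS k B = 0 → cdGS k (HopfFreeProduct k A B) = 1) ∧
    (1 ≤ max (cdGS k A) (cdGS k B) →
      cdGS k (HopfFreeProduct k A B) = max (cdGS k A) (cdGS k B)) := by
  obtain ⟨_, hhA⟩ := exists_isHaar hA
  obtain ⟨_, hhB⟩ := exists_isHaar hB
  have hF := isFreeProd k A B
  -- Both quantities have the same finite upper bounds that are at least 1. This settles everything
  -- as soon as both are at least 1.
  have hle : ∀ n : ℕ, cdGS k (HopfFreeProduct k A B) ≤ ((n + 1 : ℕ) : ℕ∞) ↔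
      max (cdGS k A) (cdGS k B) ≤ ((n + 1 : ℕ) : ℕ∞) := by
    intro n
    rw [max_le_iff, YetterDrinfeld.cdGS_le_iff, YetterDrinfeld.cdGS_le_iff, YetterDrinfeld.cdGS_le_iff]
    exact YetterDrinfeld.hasProjectiveDimensionLT_trivial_iff hF (isHopfHom_inl k A B) (isHopfHom_inr k A B)
      hhA hhB n
  have hpos : 1 ≤ cdGS k (HopfFreeProduct k A B) := by
    rw [Order.one_le_iff_ne_zero]
    intro h0
    refine YetterDrinfeld.not_projective_trivial hF (isHopfHom_inl k A B) (isHopfHom_inr k A B) hA_nontrivial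
      hB_nontrivial (CategoryTheory.projective_iff_hasProjectiveDimensionLT_one.2 ?_)
    exact (YetterDrinfeld.cdGS_le_iff 0).1 h0.le
  refine ⟨fun ⟨h1, h2⟩ => le_antisymm ?_ hpos, fun h => le_antisymm ?_ ?_⟩
  -- Dimensions 0 and 0 only give the bound 1, which `hpos` shows to be attained.
  · have := (hle 0).2 (by rw [h1, h2]; simp)
    simpa using this
  · generalize max (cdGS k A) (cdGS k B) = M at *
    induction M with
    | top => exact le_top
    | coe m =>
      -- A finite value is itself a bound of the form n + 1, by positivity, so it can be fed to
      -- `hle`.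
      obtain ⟨n, rfl⟩ : ∃ n, m = n + 1 := ⟨m - 1, by have : 1 ≤ m := by exact_mod_cast h
                                                     omega⟩
      exact (hle n).2 le_rfl
  · generalize cdGS k (HopfFreeProduct k A B) = M at *
    induction M with
    | top => exact le_top
    | coe m =>
      obtain ⟨n, rfl⟩ : ∃ n, m = n + 1 := ⟨m - 1, by have : 1 ≤ m := by exact_mod_cast hpos
                                                     omega⟩
      exact (hle n).1 le_rfl
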